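/- Let $q\ge 7$. Consider the $q$-state Potts antiferromagnet at zero temperature on the triangular lattice $\mathcal T$: for finite $\Lambda\subset\mathcal T$, the kernel $\pi_\Lambda(\cdot\mid\sigma_{\Lambda^c})$ is proportional to $\prod_{xy}(1-\delta_{\sigma_x,\sigma_y})$, the product being over the nearest-neighbour edges $xy$ meeting $\Lambda$. Fix one of the three sublattices of $\mathcal T$, call its sites centres, and let $\mathcal L$ be the hexagonal lattice formed by the other sites; each centre $c$ is surrounded by a hexagon of six sites of $\mathcal L$. The decimated model on $\mathcal L$ has the kernels $\rho_\Lambda(\cdot\mid t_{\Lambda^c})$, $\Lambda\subset\mathcal L$ finite, proportional to the weight $$w_\Lambda(t)=\prod_{c}\,[q-C_c(t)]\;\prod_{xy}(1-\delta_{t_x,t_y}),$$ where $c$ runs over the centres whose hexagon meets $\Lambda$, $C_c(t)$ is the number of distinct spin values on the hexagon around $c$, and $xy$ runs over the edges of $\mathcal L$ meeting $\Lambda$. A Gibbs measure of a model is a probability measure whose conditional distributions in all finite volumes, given the spins outside, are these kernels. For $i\neq j$ in $\mathcal L$ put $$c_{ij}=\sup\; d\big(\rho_{\{i\}}(\cdot\mid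 t),\rho_{\{i\}}(\cdot\mid \tilde t)\big),\qquad d(\mu_1,\mu_2)=\sup_A|\mu_1(A)-\mu_2(A)|,$$ the supremum being over all pairs of configurations $t,\tilde t$ that agree off $j$, and let $\alpha=\sup_i\sum_{j\ne i}c_{ij}$. Call $j$ a nearest neighbour of $i$ if $ij$ is an edge of $\mathcal L$, and a next-to-nearest neighbour if $j\neq i$ is not a nearest neighbour but lies on a common hexagon with $i$. (1) All partition functions (for all finite $\Lambda$ and all boundary conditions) of both models are positive. Summing the weight of the original model in the volume $\Lambda\cup\{\text{centres whose hexagon meets }\Lambda\}$ over the spins of those centres gives $w_\Lambda$, for every finite $\Lambda\subset\mathcal L$; and the restriction to $\mathcal L$ of any Gibbs measure of the original model is a Gibbs measure of the decimated model. (2) Every $i\in\mathcal L$ has exactly $3$ nearest and $9$ next-to-nearest neighbours, and $$c_{ij}=c_{\rm nn}=\frac{(q-5)^3}{q^4-21q^3+168q^2-609q+847}\quad\text{for nearest neighbours},$$ $$c_{ij}=c_{\rm nnn}=\frac{(q-5)^2}{q^4-21q^3+168q^2-608q+841}\quad\text{for next-to-nearest neighbours},$$ and $c_{ij}=0$ for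 all other $j\neq i$. Hence $\alpha=3c_{\rm nn}+9c_{\rm nnn}$. (3) If $q\ge 11$, then $\alpha<1$. Moreover, for $q\geq 11$, the decimated model and the original zero-temperature model on $\mathcal T$ each have exactly one Gibbs measure $\mu$, and each of these measures has exponentially decaying correlations: there are constants $K$ and $m>0$ such that $$|\mu(fg)-\mu(f)\mu(g)|\le K\sum_{i,j}\delta_i(f)\,e^{-m|i-j|}\,\delta_j(g)$$ for all continuous (i.e. quasilocal) functions $f,g$ of finite total oscillation $\sum_i\delta_i(f)<\infty$, $\sum_j\delta_j(g)<\infty$ (in particular for all functions of finitely many spins), where $\delta_i(f)$ is the supremum of $|f(\sigma)-f(\sigma')|$ over $\sigma,\sigma'$ that agree off $i$, and $|i-j|$ is the distance in the lattice. -/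

import Mathlib

open scoped MeasureTheory

namespace Potts

section General

variable {V : Type*} [DecidableEq V] {q : ℕ}

/-- The configuration equal to `ξ` on the finite set `Λ` and to `σ` outside `Λ`. -/
def glue (Λ : Finset V) (ξ : Λ → Fin q) (σ : V → Fin q) : V → Fin q :=
  fun v => if h : v ∈ Λ then ξ ⟨v, h⟩ else σ v

/-- A model is given by its Boltzmann weights: `W Λ σ` is the product of the Boltzmann factors of
all interactions whose support meets the finite set `Λ` (i.e. `exp (-H_Λ(σ))`, with `exp (-∞) = 0`).
`partition W Λ σ` is the partition function of `Λ` with boundary condition `σ` outside `Λ`. -/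
noncomputable def partition (W : Finset V → (V → Fin q) → ℝ) (Λ : Finset V) (σ : V → Fin q) : ℝ :=
  ∑ ξ : Λ → Fin q, W Λ (glue Λ ξ σ)

/-- The Boltzmann--Gibbs kernel `π_Λ(ξ | σ)`; it depends on `σ` only through the spins
outside `Λ`. -/
noncomputable def kernel (W : Finset V → (V → Fin q) → ℝ) (Λ : Finset V) (σ : V → Fin q)
    (ξ : Λ → Fin q) : ℝ :=
  W Λ (glue Λ ξ σ) / partition W Λ σ

/-- The single-site kernel `π_{i}(a | σ)`. -/
noncomputable def siteKernel (W : Finset V → (V → Fin q) → ℝ) (i : V) (σ : V → Fin q)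
    (a : Fin q) : ℝ :=
  kernel W {i} σ (fun _ => a)

/-- The σ-algebra generated by the spins outside `Λ`. -/
abbrev outside (q : ℕ) (Λ : Finset V) : MeasurableSpace (V → Fin q) :=
  MeasurableSpace.comap (fun (σ : V → Fin q) (v : {v : V // v ∉ Λ}) => σ v) inferInstance

/-- Infinite-volume Gibbs measures: probability measures whose conditional distribution in every
finite volume `Λ`, given the spins outside `Λ`, is `π_Λ`. -/
def IsGibbs (W : Finset V → (V → Fin q) → ℝ) (μ : MeasureTheory.Measure (V → Fin q)) : Prop :=
  MeasureTheory.IsProbabilityMeasure μ ∧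
    ∀ (Λ : Finset V) (ξ : Λ → Fin q),
      μ[Set.indicator {σ : V → Fin q | ∀ v : Λ, σ v = ξ v} (fun _ => (1 : ℝ)) | outside q Λ]
        =ᵐ[μ] fun σ => kernel W Λ σ ξ

/-- Half the variation distance, `sup_A |p(A) - p'(A)|`. -/
noncomputable def tvDist (p p' : Fin q → ℝ) : ℝ :=
  ⨆ A : Finset (Fin q), |∑ a ∈ A, p a - ∑ a ∈ A, p' a|

/-- Dobrushin's interdependence coefficient `c_{ij}`. -/
noncomputable def dobrushinCoeff (W : Finset V → (V → Fin q) → ℝ) (i j : V) : ℝ :=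
  sSup {d : ℝ | ∃ σ τ : V → Fin q, (∀ k, k ≠ j → σ k = τ k) ∧
    d = tvDist (siteKernel W i σ) (siteKernel W i τ)}

/-- The Dobrushin constant `α = sup_i ∑_{j ≠ i} c_{ij}`, as an extended nonnegative real. -/
noncomputable def dobrushinConst (W : Finset V → (V → Fin q) → ℝ) : ENNReal :=
  ⨆ i : V, ∑' j : {j : V // j ≠ i}, ENNReal.ofReal (dobrushinCoeff W i j)

/-- The oscillation of `f` at the site `i`. -/
noncomputable def osc (f : (V → Fin q) → ℝ) (i : V) : ℝ :=
  sSup {d : ℝ | ∃ σ τ : V → Fin q, (∀ k, k ≠ i → σ k = τ k) ∧ d = |f σ - f τ|}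

/-- Exponential decay of correlations, for all quasilocal (i.e. continuous) observables of finite
total oscillation; in particular for all functions of finitely many spins. -/
def ExpDecay [Dist V] (μ : MeasureTheory.Measure (V → Fin q)) : Prop :=
  ∃ K m : ℝ, 0 < m ∧ ∀ f g : (V → Fin q) → ℝ, Continuous f → Continuous g →
    Summable (osc f) → Summable (osc g) →
      |(∫ σ, f σ * g σ ∂μ) - (∫ σ, f σ ∂μ) * ∫ σ, g σ ∂μ| ≤
        K * ∑' i : V, ∑' j : V, osc f i * Real.exp (-m * dist i j) * osc g j

open Classical in
/-- The product of the nearest-neighbour factors `1 - δ(σ_x, σ_y)` over all edges `xy` of the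
graph with (symmetric) adjacency relation `adj` that have at least one endpoint in `Λ`. -/
noncomputable def exclusion (adj : V → V → Prop) (Λ : Finset V) (σ : V → Fin q) : ℝ :=
  if ∀ x ∈ Λ, ∀ y, adj x y → σ x ≠ σ y then 1 else 0

end General

/-- The six neighbours of a site of the triangular lattice, in the basis of two lattice vectors
at an angle of 60 degrees. -/
def nbrs (x : ℤ × ℤ) : Finset (ℤ × ℤ) :=
  {x + (1, 0), x + (-1, 0), x + (0, 1), x + (0, -1), x + (1, -1), x + (-1, 1)}

/-- The weights of the zero-temperature `q`-state Potts antiferromagnet on the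
triangular lattice. -/
noncomputable def triWeight (q : ℕ) : Finset (ℤ × ℤ) → (ℤ × ℤ → Fin q) → ℝ :=
  exclusion (fun x y => y ∈ nbrs x)

/-- Membership in the `r`-th (mod 3) of the three sublattices of the triangular lattice. -/
def IsCentre (r : ℤ) (x : ℤ × ℤ) : Prop := 3 ∣ x.1 - x.2 - r

instance (r : ℤ) : DecidablePred (IsCentre r) :=
  fun x => inferInstanceAs (Decidable ((3 : ℤ) ∣ x.1 - x.2 - r))

/-- The sites (of a hexagonal lattice) that survive when the `r`-th sublattice is decimated. -/
abbrev Surv (r : ℤ) : Type := {x : ℤ × ℤ // ¬ IsCentre r x}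

/-- Nearest neighbours in the hexagonal lattice. -/
def NN {r : ℤ} (x y : Surv r) : Prop := y.1 ∈ nbrs x.1

/-- The decimated sites whose surrounding hexagon meets `Λ`. -/
def centres (r : ℤ) (Λ : Finset (Surv r)) : Finset (ℤ × ℤ) :=
  (Λ.biUnion fun x => nbrs x.1).filter (IsCentre r)

/-- Next-to-nearest neighbours: distinct sites that lie on a common hexagon and are not nearest
neighbours. -/
def NNN {r : ℤ} (x y : Surv r) : Prop :=
  x ≠ y ∧ ¬ NN x y ∧ ∃ c, IsCentre r c ∧ x.1 ∈ nbrs c ∧ y.1 ∈ nbrs c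

open Classical in
/-- The set of colours on the hexagon around the decimated site `c`. -/
noncomputable def hexColours {q : ℕ} {r : ℤ} (c : ℤ × ℤ) (t : Surv r → Fin q) : Finset (Fin q) :=
  Finset.univ.filter fun a => ∃ y : Surv r, y.1 ∈ nbrs c ∧ t y = a

/-- The weights of the decimated model: a factor `q - C` for each hexagon, with `C` the number of
distinct colours on it, and the exclusions along the edges of the hexagonal lattice. -/
noncomputable def decWeight (q : ℕ) (r : ℤ) (Λ : Finset (Surv r)) (t : Surv r → Fin q) : ℝ :=
  (∏ c ∈ centres r Λ, ((q : ℝ) - (hexColours c t).card)) * exclusion NN Λ t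

/-- The value of `c_{0,nn}`. -/
noncomputable def cNN (q : ℕ) : ℝ :=
  ((q : ℝ) - 5) ^ 3 / ((q : ℝ) ^ 4 - 21 * (q : ℝ) ^ 3 + 168 * (q : ℝ) ^ 2 - 609 * (q : ℝ) + 847)

/-- The value of `c_{0,nnn}`. -/
noncomputable def cNNN (q : ℕ) : ℝ :=
  ((q : ℝ) - 5) ^ 2 / ((q : ℝ) ^ 4 - 21 * (q : ℝ) ^ 3 + 168 * (q : ℝ) ^ 2 - 608 * (q : ℝ) + 841)

end Potts

/-! The centres are pairwise non-adjacent, so given the spins of the hexagonal lattice they are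
independent, and a centre whose hexagon shows C colours has q - C choices. Summing them out
(`sum_triWeight`) gives the decimated weights, and the DLR equations descend (`IsGibbs.map_restr`).
Dobrushin's method is then applied to the decimated model and its consequences are carried back to
the triangular lattice.

The abstract part is one comparison principle, `isEstimate_of_supersolution`. Suppose a functional F
changes by at most b_i times the oscillation at i when its argument is averaged over the spin at i.
Then any bounded nonnegative A with CA + b ≤ A, where C is the Dobrushin matrix, satisfies |F f| ≤ ∑
A_i osc_i f. For the difference of two Gibbs measures b = A = 0 works, which is uniqueness. For the
covariance with g one has b = osc g, and an exponentially weighted sum of osc g is a supersolution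
because C has finite range, which is decay of correlations. Existence on the triangular lattice
comes from compactness and consistency.

The way back rests on averaging over finitely many centres: expectations are preserved, covariances
change only by diagonal terms, and the result is almost a function of the surviving spins
(`exists_avg_centres`, `abs_sub_forget_le`).

The quantitative part computes C. Put u = q - 5. The weight of a colour at a site is zero if a
neighbour carries it, and otherwise a product of three hexagon factors, each of two values whose
ratio is at most u / (u - 1). A next-to-nearest neighbour enters one factor only, and the worst
event is essentially one colour gaining or losing that factor (`tvDist_nextNearest_le`). A nearest
neighbour changing from x to y forbids y instead of x and also perturbs two factors. The bound would
be 1 / (1 + T), with T the least ratio of the weight of the unaffected colours to that of the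
affected one, if those colours kept their weights. The perturbation is controlled by cross ratios at
least 1 - 1/u², and a perturbed hexagon always makes an affected colour lighter than the minimal T
allows for; the sign of the bilinear form `gap` records this trade-off (`tvDist_nearest_le`).
Explicit seven-colour boundary conditions attain both bounds (`cNN_le_dobrushinCoeff`,
`cNNN_le_dobrushinCoeff`), and 3 c_nn + 9 c_nnn < 1 for q ≥ 11 is a polynomial inequality. -/

open scoped MeasureTheory

namespace Potts

set_option linter.unusedSectionVars false

/-! ### Specifications, finite-volume averages and the DLR equations. -/

section General

variable {V : Type*} [DecidableEq V] {q : ℕ}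

/-- A specification whose weights are nonnegative and continuous, with positive partition
functions. -/
structure Regular (W : Finset V → (V → Fin q) → ℝ) : Prop where
  nonneg : ∀ Λ σ, 0 ≤ W Λ σ
  pos : ∀ Λ σ, 0 < partition W Λ σ
  cont : ∀ Λ, Continuous (W Λ)

/-- The action `π_Λ f` of the finite-volume kernel on observables. -/
noncomputable def avg (W : Finset V → (V → Fin q) → ℝ) (Λ : Finset V) (f : (V → Fin q) → ℝ)
    (σ : V → Fin q) : ℝ :=
  ∑ ξ : Λ → Fin q, kernel W Λ σ ξ * f (glue Λ ξ σ)

lemma glue_of_mem {Λ : Finset V} (ξ : Λ → Fin q) (σ : V → Fin q) {v : V} (h : v ∈ Λ) :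
    glue Λ ξ σ v = ξ ⟨v, h⟩ := dif_pos h

lemma glue_of_notMem {Λ : Finset V} (ξ : Λ → Fin q) (σ : V → Fin q) {v : V} (h : v ∉ Λ) :
    glue Λ ξ σ v = σ v := dif_neg h

lemma glue_congr {Λ : Finset V} (ξ : Λ → Fin q) {σ τ : V → Fin q} (h : ∀ v, v ∉ Λ → σ v = τ v) :
    glue Λ ξ σ = glue Λ ξ τ := by
  funext v
  by_cases hv : v ∈ Λ
  · rw [glue_of_mem _ _ hv, glue_of_mem _ _ hv]
  · rw [glue_of_notMem _ _ hv, glue_of_notMem _ _ hv, h v hv]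

lemma glue_self (Λ : Finset V) (σ : V → Fin q) : glue Λ (fun v => σ v) σ = σ := by
  funext v
  by_cases hv : v ∈ Λ
  · rw [glue_of_mem _ _ hv]
  · rw [glue_of_notMem _ _ hv]

lemma continuous_glue {Λ : Finset V} (ξ : Λ → Fin q) :
    Continuous (fun σ : V → Fin q => glue Λ ξ σ) := by
  refine continuous_pi fun v => ?_
  by_cases hv : v ∈ Λ
  · simp only [glue_of_mem _ _ hv]; exact continuous_const
  · simp only [glue_of_notMem _ _ hv]; exact continuous_apply v

/-- A function of finitely many spins is continuous. -/
lemma continuous_of_local (S : Finset V) {α : Type*} [TopologicalSpace α] {F : (V → Fin q) → α}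
    (h : ∀ σ τ : V → Fin q, (∀ v ∈ S, σ v = τ v) → F σ = F τ) : Continuous F := by
  refine continuous_iff_continuousAt.2 fun σ => ?_
  have : F =ᶠ[nhds σ] fun _ => F σ := by
    have hopen : IsOpen (⋂ v ∈ S, {τ : V → Fin q | τ v = σ v}) :=
      isOpen_biInter_finset fun v _ =>
        (isOpen_discrete {σ v}).preimage (continuous_apply (A := fun _ : V => Fin q) v)
    filter_upwards [hopen.mem_nhds (by simp)] with τ hτ
    exact h _ _ fun v hv => by simpa using Set.mem_iInter₂.1 hτ v hv
  exact continuousAt_const.congr this.symm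

variable {W : Finset V → (V → Fin q) → ℝ}

lemma partition_congr {Λ : Finset V} {σ τ : V → Fin q} (h : ∀ v, v ∉ Λ → σ v = τ v) :
    partition W Λ σ = partition W Λ τ :=
  Finset.sum_congr rfl fun ξ _ => by rw [glue_congr ξ h]

lemma kernel_congr {Λ : Finset V} {σ τ : V → Fin q} (h : ∀ v, v ∉ Λ → σ v = τ v)
    (ξ : Λ → Fin q) : kernel W Λ σ ξ = kernel W Λ τ ξ := by
  rw [kernel, kernel, glue_congr ξ h, partition_congr h]

lemma avg_congr {Λ : Finset V} {σ τ : V → Fin q} (h : ∀ v, v ∉ Λ → σ v = τ v)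
    (f : (V → Fin q) → ℝ) : avg W Λ f σ = avg W Λ f τ :=
  Finset.sum_congr rfl fun ξ _ => by rw [kernel_congr h, glue_congr ξ h]

lemma Regular.kernel_nonneg (hW : Regular W) (Λ : Finset V) (σ : V → Fin q) (ξ : Λ → Fin q) :
    0 ≤ kernel W Λ σ ξ :=
  div_nonneg (hW.nonneg _ _) (hW.pos _ _).le

lemma Regular.sum_kernel (hW : Regular W) (Λ : Finset V) (σ : V → Fin q) :
    ∑ ξ, kernel W Λ σ ξ = 1 := by
  simp only [kernel]
  rw [← Finset.sum_div]
  exact div_self (hW.pos Λ σ).ne'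

lemma Regular.continuous_kernel (hW : Regular W) (Λ : Finset V) (ξ : Λ → Fin q) :
    Continuous (fun σ => kernel W Λ σ ξ) := by
  refine ((hW.cont Λ).comp (continuous_glue ξ)).div₀ ?_ fun σ => (hW.pos Λ σ).ne'
  exact continuous_finsetSum _ fun η _ => (hW.cont Λ).comp (continuous_glue η)

lemma Regular.continuous_avg (hW : Regular W) (Λ : Finset V) {f : (V → Fin q) → ℝ}
    (hf : Continuous f) : Continuous (avg W Λ f) :=
  continuous_finsetSum _ fun ξ _ => (hW.continuous_kernel Λ ξ).mul (hf.comp (continuous_glue ξ))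

/-- Functions of the spins outside `Λ` can be pulled out of `π_Λ`. -/
lemma avg_mul_of_outside {Λ : Finset V} (f : (V → Fin q) → ℝ) {g : (V → Fin q) → ℝ}
    (hg : ∀ σ τ : V → Fin q, (∀ v, v ∉ Λ → σ v = τ v) → g σ = g τ) (σ : V → Fin q) :
    avg W Λ (fun τ => f τ * g τ) σ = avg W Λ f σ * g σ := by
  simp only [avg, Finset.sum_mul]
  refine Finset.sum_congr rfl fun ξ _ => ?_
  rw [hg (glue Λ ξ σ) σ fun v hv => glue_of_notMem _ _ hv, mul_assoc]

lemma outside_le (Λ : Finset V) : outside q Λ ≤ (MeasurableSpace.pi : MeasurableSpace (V → Fin q)) :=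
  Measurable.comap_le (measurable_pi_lambda _ fun v => measurable_pi_apply v.1)

/-- A measurable function of the spins outside `Λ` is measurable for the σ-algebra `outside`. -/
lemma measurable_outside [NeZero q] {Λ : Finset V} {F : (V → Fin q) → ℝ} (hF : Measurable F)
    (h : ∀ σ τ : V → Fin q, (∀ v, v ∉ Λ → σ v = τ v) → F σ = F τ) :
    Measurable[outside q Λ] F := by
  -- Filling Λ with the colour 0 is harmless because `F` ignores those spins; this factors `F`
  -- measurably through the outside configuration.
  set ext : ({v : V // v ∉ Λ} → Fin q) → V → Fin q :=
    fun s v => if hv : v ∉ Λ then s ⟨v, hv⟩ else 0 with hext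
  have hm : Measurable ext := by
    refine measurable_pi_lambda _ fun v => ?_
    by_cases hv : v ∉ Λ
    · simp only [hext, dif_pos hv]; exact measurable_pi_apply _
    · simp only [hext, dif_neg hv]; exact measurable_const
  have : F = (F ∘ ext) ∘ fun (σ : V → Fin q) (v : {v : V // v ∉ Λ}) => σ v := by
    funext σ
    refine h _ _ fun v hv => ?_
    simp [hext, hv]
  rw [this]
  exact (hF.comp hm).comp (comap_measurable _)

lemma measurableSet_cyl (Λ : Finset V) (ξ : Λ → Fin q) :
    MeasurableSet {σ : V → Fin q | ∀ v : Λ, σ v = ξ v} := by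
  rw [Set.ofPred_forall]
  exact MeasurableSet.iInter fun v =>
    measurableSet_eq_fun (measurable_pi_apply (X := fun _ : V => Fin q) v.1) measurable_const

/-- Only the cylinder given by σ itself contributes. This decomposition reduces the DLR equation for
`f` to conditional probabilities of cylinders. -/
lemma sum_indicator_cyl (Λ : Finset V) (f : (V → Fin q) → ℝ) (σ : V → Fin q) :
    ∑ ξ : Λ → Fin q, {σ : V → Fin q | ∀ v : Λ, σ v = ξ v}.indicator (fun _ => (1 : ℝ)) σ *
      f (glue Λ ξ σ) = f σ := by
  rw [Finset.sum_eq_single (fun v : Λ => σ v)]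
  · rw [Set.indicator_of_mem (by simp), glue_self, one_mul]
  · intro ξ _ hξ
    rw [Set.indicator_of_notMem, zero_mul]
    intro h
    exact hξ (funext fun v => (h v).symm)
  · simp

lemma integrable_of_continuous [Countable V] {μ : MeasureTheory.Measure (V → Fin q)}
    [MeasureTheory.IsFiniteMeasure μ] {f : (V → Fin q) → ℝ} (hf : Continuous f) :
    MeasureTheory.Integrable f μ := by
  obtain ⟨C, hC⟩ := isCompact_univ.exists_bound_of_continuousOn hf.continuousOn
  exact MeasureTheory.Integrable.of_bound hf.measurable.aestronglyMeasurable C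
    (Filter.Eventually.of_forall fun σ => hC σ trivial)

lemma integral_avg_eq_sum [Countable V] (hW : Regular W) {μ : MeasureTheory.Measure (V → Fin q)}
    [MeasureTheory.IsFiniteMeasure μ] (Λ : Finset V) {f : (V → Fin q) → ℝ} (hf : Continuous f) :
    ∫ σ, avg W Λ f σ ∂μ = ∑ ξ : Λ → Fin q, ∫ σ, kernel W Λ σ ξ * f (glue Λ ξ σ) ∂μ :=
  MeasureTheory.integral_finsetSum _ fun ξ _ => integrable_of_continuous
    ((hW.continuous_kernel Λ ξ).mul (hf.comp (continuous_glue ξ)))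

/-- The DLR equation for continuous observables. -/
lemma IsGibbs.integral_avg [NeZero q] [Countable V] (hW : Regular W)
    {μ : MeasureTheory.Measure (V → Fin q)}
    (hμ : IsGibbs W μ) (Λ : Finset V) {f : (V → Fin q) → ℝ} (hf : Continuous f) :
    ∫ σ, avg W Λ f σ ∂μ = ∫ σ, f σ ∂μ := by
  have := hμ.1
  have hind : ∀ ξ : Λ → Fin q, MeasureTheory.Integrable
      ({σ : V → Fin q | ∀ v : Λ, σ v = ξ v}.indicator (fun _ => (1 : ℝ))) μ := fun ξ =>
    (MeasureTheory.integrable_const 1).indicator (measurableSet_cyl Λ ξ)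
  have hfm : ∀ ξ : Λ → Fin q, Measurable[outside q Λ] (fun σ => f (glue Λ ξ σ)) := fun ξ =>
    measurable_outside (hf.comp (continuous_glue ξ)).measurable fun σ τ h => by
      rw [glue_congr ξ h]
  have hint : ∀ ξ : Λ → Fin q, MeasureTheory.Integrable
      ({σ : V → Fin q | ∀ v : Λ, σ v = ξ v}.indicator (fun _ => (1 : ℝ)) *
        fun σ => f (glue Λ ξ σ)) μ := fun ξ => by
    obtain ⟨C, hC⟩ := isCompact_univ.exists_bound_of_continuousOn
      (hf.comp (continuous_glue ξ)).continuousOn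
    exact (hind ξ).mul_bdd (c := C)
      (hf.comp (continuous_glue ξ)).measurable.aestronglyMeasurable
      (Filter.Eventually.of_forall fun σ => hC σ trivial)
  rw [integral_avg_eq_sum hW Λ hf]
  have key : ∀ ξ : Λ → Fin q, ∫ σ, kernel W Λ σ ξ * f (glue Λ ξ σ) ∂μ =
      ∫ σ, {σ : V → Fin q | ∀ v : Λ, σ v = ξ v}.indicator (fun _ => (1 : ℝ)) σ *
        f (glue Λ ξ σ) ∂μ := by
    intro ξ
    -- Once the spins in Λ are fixed to ξ, `f` depends only on the outside spins and leaves the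
    -- conditional expectation.
    have h1 := MeasureTheory.condExp_mul_of_stronglyMeasurable_right (m := outside q Λ) (μ := μ)
      (hfm ξ).stronglyMeasurable (hint ξ) (hind ξ)
    have h2 := MeasureTheory.integral_condExp (outside_le Λ) (μ := μ)
      (f := {σ : V → Fin q | ∀ v : Λ, σ v = ξ v}.indicator (fun _ => (1 : ℝ)) *
        fun σ => f (glue Λ ξ σ))
    simp only [Pi.mul_apply] at h2
    rw [← h2]
    refine MeasureTheory.integral_congr_ae ?_
    filter_upwards [h1, hμ.2 Λ ξ] with σ h3 h4
    rw [h3, Pi.mul_apply, h4]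
  rw [Finset.sum_congr rfl fun ξ _ => key ξ]
  refine (MeasureTheory.integral_finsetSum _ fun ξ _ => hint ξ).symm.trans ?_
  exact MeasureTheory.integral_congr_ae
    (Filter.Eventually.of_forall fun σ => sum_indicator_cyl Λ f σ)

/-- A probability measure satisfying the DLR equations for continuous observables is Gibbs. -/
lemma isGibbs_of_integral_avg [NeZero q] [Countable V] (hW : Regular W)
    {μ : MeasureTheory.Measure (V → Fin q)} [MeasureTheory.IsProbabilityMeasure μ]
    (h : ∀ (Λ : Finset V) (f : (V → Fin q) → ℝ), Continuous f →
      ∫ σ, avg W Λ f σ ∂μ = ∫ σ, f σ ∂μ) : IsGibbs W μ := by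
  refine ⟨inferInstance, fun Λ ξ => ?_⟩
  have hkm : ∀ ξ, Measurable fun σ => kernel W Λ σ ξ := fun ξ =>
    (hW.continuous_kernel Λ ξ).measurable
  have hgm : ∀ ξ, Measurable fun σ : V → Fin q => glue Λ ξ σ := fun ξ =>
    (continuous_glue ξ).measurable
  -- `ν ξ` is the part of μ on which the spins in Λ should equal ξ. The DLR equations for continuous
  -- functions give μ = ∑ `ν ξ` as measures, and this identity can then be tested on non-continuous
  -- indicators.
  set ν : (Λ → Fin q) → MeasureTheory.Measure (V → Fin q) := fun ξ =>
    (μ.withDensity fun σ => ENNReal.ofReal (kernel W Λ σ ξ)).map fun σ => glue Λ ξ σ with hν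
  have hfin : ∀ ξ, MeasureTheory.IsFiniteMeasure (ν ξ) := fun ξ => by
    have : MeasureTheory.IsFiniteMeasure
        (μ.withDensity fun σ => ENNReal.ofReal (kernel W Λ σ ξ)) :=
      MeasureTheory.isFiniteMeasure_withDensity_ofReal
        (integrable_of_continuous (hW.continuous_kernel Λ ξ)).2
    exact MeasureTheory.Measure.isFiniteMeasure_map _ _
  have hνint : ∀ ξ (f : (V → Fin q) → ℝ), Measurable f →
      ∫ σ, f σ ∂(ν ξ) = ∫ σ, kernel W Λ σ ξ * f (glue Λ ξ σ) ∂μ := by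
    intro ξ f hf
    rw [hν, MeasureTheory.integral_map (hgm ξ).aemeasurable hf.aestronglyMeasurable,
      integral_withDensity_eq_integral_toReal_smul (hkm ξ).ennreal_ofReal
        (Filter.Eventually.of_forall fun σ => ENNReal.ofReal_lt_top)]
    simp only [ENNReal.toReal_ofReal (hW.kernel_nonneg Λ _ ξ), smul_eq_mul]
  have hμν : μ = ∑ ξ, ν ξ := by
    refine MeasureTheory.ext_of_forall_integral_eq_of_IsFiniteMeasure fun f => ?_
    rw [MeasureTheory.integral_finsetSum_measure fun ξ _ => integrable_of_continuous f.continuous,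
      ← h Λ f f.continuous, integral_avg_eq_sum hW Λ f.continuous]
    exact Finset.sum_congr rfl fun ξ _ => (hνint ξ f f.continuous.measurable).symm
  symm
  have hmeas : ∀ s : Set (V → Fin q), MeasurableSet[outside q Λ] s → MeasurableSet s :=
    fun s hs => outside_le Λ s hs
  refine MeasureTheory.ae_eq_condExp_of_forall_setIntegral_eq (outside_le Λ)
    ((MeasureTheory.integrable_const 1).indicator (measurableSet_cyl Λ ξ))
    (fun s _ _ => (integrable_of_continuous (hW.continuous_kernel Λ ξ)).integrableOn) ?_
    (measurable_outside (hkm ξ) fun σ τ h => kernel_congr h ξ).aestronglyMeasurable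
  intro s hs _
  have hs' : ∀ σ τ : V → Fin q, (∀ v, v ∉ Λ → σ v = τ v) → (σ ∈ s ↔ τ ∈ s) := by
    obtain ⟨u, _, rfl⟩ := hs
    intro σ τ hστ
    have : (fun (v : {v : V // v ∉ Λ}) => σ v) = fun (v : {v : V // v ∉ Λ}) => τ v :=
      funext fun v => hστ v.1 v.2
    simp only [Set.mem_preimage, this]
  have hcyl : MeasurableSet (s ∩ {σ : V → Fin q | ∀ v : Λ, σ v = ξ v}) :=
    (hmeas s hs).inter (measurableSet_cyl Λ ξ)
  set g : (V → Fin q) → ℝ := (s ∩ {σ : V → Fin q | ∀ v : Λ, σ v = ξ v}).indicator fun _ => 1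
    with hg
  have hgmeas : Measurable g := measurable_const.indicator hcyl
  rw [← MeasureTheory.integral_indicator (hmeas s hs),
    ← MeasureTheory.integral_indicator (hmeas s hs), Set.indicator_indicator, ← hg]
  conv_rhs => rw [hμν]
  rw [MeasureTheory.integral_finsetSum_measure fun ξ _ =>
    (MeasureTheory.integrable_const 1).indicator hcyl, Finset.sum_eq_single ξ]
  · rw [hνint ξ g hgmeas]
    refine MeasureTheory.integral_congr_ae (Filter.Eventually.of_forall fun σ => ?_)
    have h1 : glue Λ ξ σ ∈ s ↔ σ ∈ s := hs' _ _ fun v hv => glue_of_notMem _ _ hv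
    have h2 : ∀ v : Λ, glue Λ ξ σ v = ξ v := fun v => glue_of_mem _ _ v.2
    by_cases hσ : σ ∈ s
    · have h3 : g (glue Λ ξ σ) = 1 :=
        Set.indicator_of_mem (Set.mem_inter (h1.2 hσ) (by simpa using h2)) _
      simp only [Set.indicator_of_mem hσ, h3, mul_one]
    · have h3 : g (glue Λ ξ σ) = 0 := Set.indicator_of_notMem (fun h => hσ (h1.1 h.1)) _
      simp only [Set.indicator_of_notMem hσ, h3, mul_zero]
  · intro η _ hη
    rw [hνint η g hgmeas]
    have : ∀ σ, g (glue Λ η σ) = 0 := fun σ => Set.indicator_of_notMem (fun hmem => hη (by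
      funext v
      rw [← hmem.2 v, glue_of_mem _ _ v.2])) _
    simp [this]
  · simp

end General

end Potts

open scoped MeasureTheory

namespace Potts

set_option linter.unusedSectionVars false

/-! ### Oscillations, the comparison principle and Dobrushin uniqueness. -/

section Dobrushin

open MeasureTheory

variable {V : Type*} [DecidableEq V] {q : ℕ}

lemma bddAbove_osc {f : (V → Fin q) → ℝ} (hf : Continuous f) (i : V) :
    BddAbove {d : ℝ | ∃ σ τ : V → Fin q, (∀ k, k ≠ i → σ k = τ k) ∧ d = |f σ - f τ|} := by
  obtain ⟨C, hC⟩ := isCompact_univ.exists_bound_of_continuousOn hf.continuousOn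
  refine ⟨C + C, ?_⟩
  rintro d ⟨σ, τ, -, rfl⟩
  exact (abs_sub _ _).trans (add_le_add (hC σ trivial) (hC τ trivial))

lemma osc_nonneg (f : (V → Fin q) → ℝ) (i : V) : 0 ≤ osc f i := by
  refine Real.sSup_nonneg ?_
  rintro d ⟨σ, τ, -, rfl⟩
  exact abs_nonneg _

lemma abs_sub_le_osc {f : (V → Fin q) → ℝ} (hf : Continuous f) {i : V} {σ τ : V → Fin q}
    (h : ∀ k, k ≠ i → σ k = τ k) : |f σ - f τ| ≤ osc f i :=
  le_csSup (bddAbove_osc hf i) ⟨σ, τ, h, rfl⟩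

lemma osc_le {f : (V → Fin q) → ℝ} {i : V} {c : ℝ} (hc : 0 ≤ c)
    (h : ∀ σ τ : V → Fin q, (∀ k, k ≠ i → σ k = τ k) → |f σ - f τ| ≤ c) : osc f i ≤ c := by
  refine Real.sSup_le ?_ hc
  rintro d ⟨σ, τ, hst, rfl⟩
  exact h σ τ hst

lemma osc_eq_zero {f : (V → Fin q) → ℝ} {i : V}
    (h : ∀ σ τ : V → Fin q, (∀ k, k ≠ i → σ k = τ k) → f σ = f τ) : osc f i = 0 :=
  le_antisymm (osc_le le_rfl fun σ τ hst => by simp [h σ τ hst]) (osc_nonneg f i)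

lemma glue_piecewise_insert (S : Finset V) (σ τ : V → Fin q) {i : V} (k : V) (hk : k ≠ i) :
    (insert i S).piecewise τ σ k = S.piecewise τ σ k := by
  simp [Finset.piecewise, Finset.mem_insert, hk]

/-- The spins are changed one site at a time. Recording that agreeing sites cost nothing matters
later, when two configurations differ only on the decimated sublattice. -/
lemma abs_piecewise_sub_le {f : (V → Fin q) → ℝ} (hf : Continuous f) (S : Finset V)
    (σ τ : V → Fin q) :
    |f (S.piecewise τ σ) - f σ| ≤ ∑ i ∈ S, if σ i = τ i then 0 else osc f i := by
  induction S using Finset.induction_on with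
  | empty => simp
  | insert i S hi ih =>
    rw [Finset.sum_insert hi]
    refine (abs_sub_le _ (f (S.piecewise τ σ)) _).trans (add_le_add ?_ ih)
    split_ifs with h
    · have : (insert i S).piecewise τ σ = S.piecewise τ σ := by
        funext k
        by_cases hk : k = i
        · subst hk; simp [hi, h]
        · exact glue_piecewise_insert S σ τ k hk
      simp [this]
    · exact abs_sub_le_osc hf (glue_piecewise_insert S σ τ)

lemma tendsto_piecewise (σ τ : V → Fin q) :
    Filter.Tendsto (fun S : Finset V => S.piecewise τ σ) Filter.atTop (nhds τ) := by
  refine tendsto_pi_nhds.2 fun v => ?_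
  refine tendsto_const_nhds.congr' ?_
  filter_upwards [Filter.eventually_ge_atTop {v}] with S hS
  have : v ∈ S := Finset.singleton_subset_iff.1 hS
  simp [this]

/-- Continuity for the product topology allows the finite telescoping to exhaust the lattice. -/
lemma abs_sub_le_tsum_ite_osc {f : (V → Fin q) → ℝ} (hf : Continuous f) (hs : Summable (osc f))
    (σ τ : V → Fin q) : |f τ - f σ| ≤ ∑' i, if σ i = τ i then 0 else osc f i := by
  have h := ((hf.tendsto τ).comp (tendsto_piecewise σ τ)).sub_const (f σ) |>.abs
  have h0 : ∀ i, 0 ≤ if σ i = τ i then 0 else osc f i := fun i => by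
    split_ifs; exacts [le_rfl, osc_nonneg f i]
  have hs' : Summable fun i => if σ i = τ i then 0 else osc f i :=
    Summable.of_nonneg_of_le h0 (fun i => by split_ifs; exacts [osc_nonneg f i, le_rfl]) hs
  exact le_of_tendsto' h fun S =>
    (abs_piecewise_sub_le hf S σ τ).trans (hs'.sum_le_tsum S fun i _ => h0 i)

lemma abs_sub_le_tsum_osc {f : (V → Fin q) → ℝ} (hf : Continuous f) (hs : Summable (osc f))
    (σ τ : V → Fin q) : |f τ - f σ| ≤ ∑' i, osc f i := by
  refine (abs_sub_le_tsum_ite_osc hf hs σ τ).trans ?_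
  have h0 : ∀ i, (if σ i = τ i then 0 else osc f i) ≤ osc f i := fun i => by
    split_ifs; exacts [osc_nonneg f i, le_rfl]
  exact Summable.tsum_le_tsum h0 (Summable.of_nonneg_of_le (fun i => by
    split_ifs; exacts [le_rfl, osc_nonneg f i]) h0 hs) hs

/-- Probability measures that agree on observables of finite total oscillation are equal. -/
lemma measure_ext_of_summable_osc [NeZero q] [Countable V] {μ ν : Measure (V → Fin q)}
    [IsProbabilityMeasure μ] [IsProbabilityMeasure ν]
    (h : ∀ f : (V → Fin q) → ℝ, Continuous f → Summable (osc f) → ∫ σ, f σ ∂μ = ∫ σ, f σ ∂ν) :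
    μ = ν := by
  refine ext_of_forall_integral_eq_of_IsFiniteMeasure fun f => ?_
  -- Freezing the spins off S gives local functions, hence of finite total oscillation, converging
  -- boundedly to `f`.
  set g : Finset V → (V → Fin q) → ℝ := fun S σ => f (S.piecewise σ fun _ => 0) with hg
  have hgc : ∀ S, Continuous (g S) := fun S => f.continuous.comp <| continuous_pi fun v => by
    by_cases hv : v ∈ S
    · simp only [Finset.piecewise, hv, if_true]; exact continuous_apply v
    · simp only [Finset.piecewise, hv, if_false]; exact continuous_const
  have hgs : ∀ S, Summable (osc (g S)) := fun S => by
    refine summable_of_ne_finset_zero (s := S) fun i hi => osc_eq_zero fun σ τ hst => ?_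
    simp only [hg]
    congr 1
    funext v
    by_cases hv : v ∈ S
    · simp only [Finset.piecewise, hv, if_true]; exact hst v fun h => hi (h ▸ hv)
    · simp only [Finset.piecewise, hv, if_false]
  have lim : ∀ ρ : Measure (V → Fin q), IsProbabilityMeasure ρ →
      Filter.Tendsto (fun S => ∫ σ, g S σ ∂ρ) Filter.atTop (nhds (∫ σ, f σ ∂ρ)) := by
    intro ρ hρ
    refine tendsto_integral_filter_of_dominated_convergence (fun _ => ‖f‖)
      (Filter.Eventually.of_forall fun S => (hgc S).measurable.aestronglyMeasurable)
      (Filter.Eventually.of_forall fun S => Filter.Eventually.of_forall fun σ =>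
        f.norm_coe_le_norm _) (integrable_const _)
      (Filter.Eventually.of_forall fun σ =>
        (f.continuous.tendsto σ).comp (tendsto_piecewise (fun _ => 0) σ))
  refine tendsto_nhds_unique (lim μ inferInstance) ?_
  simp only [h _ (hgc _) (hgs _)]
  exact lim ν inferInstance

lemma le_tvDist (p p' : Fin q → ℝ) (A : Finset (Fin q)) :
    |∑ a ∈ A, p a - ∑ a ∈ A, p' a| ≤ tvDist p p' :=
  le_ciSup (f := fun A : Finset (Fin q) => |∑ a ∈ A, p a - ∑ a ∈ A, p' a|)
    (Set.finite_range _).bddAbove A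

lemma tvDist_nonneg (p p' : Fin q → ℝ) : 0 ≤ tvDist p p' :=
  (abs_nonneg _).trans (le_tvDist p p' ∅)

lemma tvDist_le {p p' : Fin q → ℝ} {c : ℝ}
    (h : ∀ A : Finset (Fin q), |∑ a ∈ A, p a - ∑ a ∈ A, p' a| ≤ c) : tvDist p p' ≤ c :=
  ciSup_le h

/-- Equal total masses allow the minimum of φ to be subtracted; then only the colours with p ≥ p'
contribute positively, each with a factor at most D. -/
lemma sum_sub_mul_le [NeZero q] {p p' φ : Fin q → ℝ} (hs : ∑ a, p a = ∑ a, p' a) {D : ℝ}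
    (hD : ∀ a b, φ a - φ b ≤ D) : ∑ a, (p a - p' a) * φ a ≤ tvDist p p' * D := by
  obtain ⟨b, -, hb⟩ := Finset.exists_min_image Finset.univ φ Finset.univ_nonempty
  have hD0 : 0 ≤ D := by simpa using hD b b
  set A := Finset.univ.filter fun a => p' a ≤ p a
  have h1 : ∑ a, (p a - p' a) * φ a = ∑ a, (p a - p' a) * (φ a - φ b) := by
    simp only [mul_sub, Finset.sum_sub_distrib, ← Finset.sum_mul]
    rw [hs]; ring
  rw [h1]
  calc ∑ a, (p a - p' a) * (φ a - φ b) ≤ ∑ a, if p' a ≤ p a then (p a - p' a) * D else 0 := by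
        refine Finset.sum_le_sum fun a _ => ?_
        split_ifs with h
        · exact mul_le_mul_of_nonneg_left (hD a b) (sub_nonneg.2 h)
        · exact mul_nonpos_of_nonpos_of_nonneg (by linarith)
            (sub_nonneg.2 (hb a (Finset.mem_univ a)))
    _ = (∑ a ∈ A, p a - ∑ a ∈ A, p' a) * D := by
        rw [← Finset.sum_filter, ← Finset.sum_sub_distrib, Finset.sum_mul]
    _ ≤ tvDist p p' * D :=
        mul_le_mul_of_nonneg_right ((le_abs_self _).trans (le_tvDist p p' A)) hD0

lemma abs_sum_sub_mul_le [NeZero q] {p p' φ : Fin q → ℝ} (hs : ∑ a, p a = ∑ a, p' a) {D : ℝ}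
    (hD : ∀ a b, |φ a - φ b| ≤ D) : |∑ a, (p a - p' a) * φ a| ≤ tvDist p p' * D := by
  refine abs_le'.2 ⟨sum_sub_mul_le hs fun a b => (le_abs_self _).trans (hD a b), ?_⟩
  have := sum_sub_mul_le (φ := fun a => - φ a) hs (D := D) fun a b => by
    have := (neg_le_abs _).trans (hD a b); linarith
  simpa [mul_neg, Finset.sum_neg_distrib] using this

variable {W : Finset V → (V → Fin q) → ℝ}

lemma siteKernel_congr {i : V} {σ τ : V → Fin q} (h : ∀ k, k ≠ i → σ k = τ k) (a : Fin q) :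
    siteKernel W i σ a = siteKernel W i τ a :=
  kernel_congr (fun v hv => h v (by simpa using hv)) _

lemma glue_singleton (i : V) (ξ : ({i} : Finset V) → Fin q) (σ : V → Fin q) :
    glue {i} ξ σ = Function.update σ i (ξ ⟨i, Finset.mem_singleton_self i⟩) := by
  funext v
  by_cases hv : v = i
  · subst hv; rw [glue_of_mem _ _ (Finset.mem_singleton_self v), Function.update_self]
  · rw [glue_of_notMem _ _ (by simpa using hv), Function.update_of_ne hv]

/-- A spin on the one-point set `{i}` is a function on it. -/
def singletonEquiv (q : ℕ) (i : V) : Fin q ≃ (({i} : Finset V) → Fin q) where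
  toFun a := fun _ => a
  invFun ξ := ξ ⟨i, Finset.mem_singleton_self i⟩
  left_inv _ := rfl
  right_inv ξ := by
    funext ⟨v, hv⟩
    obtain rfl := Finset.mem_singleton.1 hv
    rfl

lemma partition_singleton (i : V) (σ : V → Fin q) :
    partition W {i} σ = ∑ a, W {i} (Function.update σ i a) := by
  rw [partition, ← (singletonEquiv q i).sum_comp]
  exact Finset.sum_congr rfl fun a _ => by rw [glue_singleton]; rfl

lemma siteKernel_eq (i : V) (σ : V → Fin q) (a : Fin q) :
    siteKernel W i σ a =
      W {i} (Function.update σ i a) / ∑ b, W {i} (Function.update σ i b) := by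
  rw [siteKernel, kernel, glue_singleton, partition_singleton]

lemma avg_singleton (i : V) (f : (V → Fin q) → ℝ) (σ : V → Fin q) :
    avg W {i} f σ = ∑ a, siteKernel W i σ a * f (Function.update σ i a) := by
  rw [avg, ← (singletonEquiv q i).sum_comp]
  exact Finset.sum_congr rfl fun a _ => by rw [glue_singleton]; rfl

lemma Regular.siteKernel_nonneg (hW : Regular W) (i : V) (σ : V → Fin q) (a : Fin q) :
    0 ≤ siteKernel W i σ a := hW.kernel_nonneg _ _ _

lemma Regular.sum_siteKernel (hW : Regular W) (i : V) (σ : V → Fin q) :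
    ∑ a, siteKernel W i σ a = 1 := by
  rw [← hW.sum_kernel {i} σ, ← (singletonEquiv q i).sum_comp]
  rfl

lemma Regular.tvDist_siteKernel_le_one (hW : Regular W) (i : V) (σ τ : V → Fin q) :
    tvDist (siteKernel W i σ) (siteKernel W i τ) ≤ 1 := by
  have h : ∀ (σ : V → Fin q) (A : Finset (Fin q)),
      0 ≤ ∑ a ∈ A, siteKernel W i σ a ∧ ∑ a ∈ A, siteKernel W i σ a ≤ 1 := fun σ A =>
    ⟨Finset.sum_nonneg fun a _ => hW.siteKernel_nonneg i σ a, by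
      rw [← hW.sum_siteKernel i σ]
      exact Finset.sum_le_univ_sum_of_nonneg fun a => hW.siteKernel_nonneg i σ a⟩
  refine tvDist_le fun A => abs_le.2 ⟨?_, ?_⟩ <;> linarith [(h σ A).1, (h σ A).2, (h τ A).1, (h τ A).2]

lemma Regular.tvDist_le_dobrushinCoeff (hW : Regular W) {i j : V} {σ τ : V → Fin q}
    (h : ∀ k, k ≠ j → σ k = τ k) :
    tvDist (siteKernel W i σ) (siteKernel W i τ) ≤ dobrushinCoeff W i j := by
  refine le_csSup ⟨1, ?_⟩ ⟨σ, τ, h, rfl⟩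
  rintro d ⟨σ, τ, -, rfl⟩
  exact hW.tvDist_siteKernel_le_one i σ τ

lemma dobrushinCoeff_nonneg (W : Finset V → (V → Fin q) → ℝ) (i j : V) :
    0 ≤ dobrushinCoeff W i j := by
  refine Real.sSup_nonneg ?_
  rintro d ⟨σ, τ, -, rfl⟩
  exact tvDist_nonneg _ _

lemma dobrushinCoeff_le {i j : V} {c : ℝ} (hc : 0 ≤ c)
    (h : ∀ σ τ : V → Fin q, (∀ k, k ≠ j → σ k = τ k) →
      tvDist (siteKernel W i σ) (siteKernel W i τ) ≤ c) : dobrushinCoeff W i j ≤ c := by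
  refine Real.sSup_le ?_ hc
  rintro d ⟨σ, τ, hst, rfl⟩
  exact h σ τ hst

lemma dobrushinCoeff_eq_zero {i j : V}
    (h : ∀ σ τ : V → Fin q, (∀ k, k ≠ j → σ k = τ k) → siteKernel W i σ = siteKernel W i τ) :
    dobrushinCoeff W i j = 0 :=
  le_antisymm (dobrushinCoeff_le le_rfl fun σ τ hst => by
    rw [h σ τ hst]; exact tvDist_le fun A => by simp) (dobrushinCoeff_nonneg W i j)

lemma dobrushinCoeff_self (i : V) : dobrushinCoeff W i i = 0 :=
  dobrushinCoeff_eq_zero fun _ _ h => funext fun a => siteKernel_congr h a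

/-- The observable is changed under a fixed kernel, costing the oscillation at j; then the kernel is
changed under a fixed observable, costing the variation distance times the oscillation at i. -/
lemma Regular.abs_avg_sub_le [NeZero q] (hW : Regular W) {f : (V → Fin q) → ℝ} (hf : Continuous f)
    {i j : V} (hij : j ≠ i) {σ τ : V → Fin q} (h : ∀ k, k ≠ j → σ k = τ k) :
    |avg W {i} f σ - avg W {i} f τ| ≤
      osc f j + tvDist (siteKernel W i σ) (siteKernel W i τ) * osc f i := by
  have e : avg W {i} f σ - avg W {i} f τ =
      (∑ a, siteKernel W i σ a * (f (Function.update σ i a) - f (Function.update τ i a))) +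
        ∑ a, (siteKernel W i σ a - siteKernel W i τ a) * f (Function.update τ i a) := by
    rw [avg_singleton, avg_singleton, ← Finset.sum_add_distrib, ← Finset.sum_sub_distrib]
    exact Finset.sum_congr rfl fun a _ => by ring
  rw [e]
  refine (abs_add_le _ _).trans (add_le_add ?_ ?_)
  · refine (Finset.abs_sum_le_sum_abs _ _).trans ?_
    calc _ ≤ ∑ a, siteKernel W i σ a * osc f j := by
          refine Finset.sum_le_sum fun a _ => ?_
          rw [abs_mul, abs_of_nonneg (hW.siteKernel_nonneg i σ a)]
          refine mul_le_mul_of_nonneg_left (abs_sub_le_osc hf fun k hk => ?_)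
            (hW.siteKernel_nonneg i σ a)
          by_cases hki : k = i
          · subst hki; simp
          · simp [Function.update_of_ne hki, h k hk]
      _ = osc f j := by rw [← Finset.sum_mul, hW.sum_siteKernel, one_mul]
  · refine abs_sum_sub_mul_le ((hW.sum_siteKernel i σ).trans (hW.sum_siteKernel i τ).symm) ?_
    intro a b
    exact abs_sub_le_osc hf fun k hk => by simp [Function.update_of_ne hk]

lemma Regular.osc_avg_le [NeZero q] (hW : Regular W) {f : (V → Fin q) → ℝ} (hf : Continuous f)
    {i j : V} (hij : j ≠ i) :
    osc (avg W {i} f) j ≤ osc f j + dobrushinCoeff W i j * osc f i := by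
  refine osc_le (add_nonneg (osc_nonneg _ _)
    (mul_nonneg (dobrushinCoeff_nonneg _ _ _) (osc_nonneg _ _))) fun σ τ h => ?_
  exact (hW.abs_avg_sub_le hf hij h).trans (add_le_add le_rfl
    (mul_le_mul_of_nonneg_right (hW.tvDist_le_dobrushinCoeff h) (osc_nonneg _ _)))

lemma osc_avg_self (f : (V → Fin q) → ℝ) (i : V) : osc (avg W {i} f) i = 0 :=
  osc_eq_zero fun _ _ h => avg_congr (fun v hv => h v (by simpa using hv)) f

lemma Regular.summable_osc_avg [NeZero q] (hW : Regular W) {f : (V → Fin q) → ℝ}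
    (hf : Continuous f) (hs : Summable (osc f)) {i : V} (hc : Summable (dobrushinCoeff W i)) :
    Summable (osc (avg W {i} f)) := by
  refine Summable.of_nonneg_of_le (fun j => osc_nonneg _ j) (fun j => ?_)
    (hs.add (hc.mul_right (osc f i)))
  by_cases hij : j = i
  · subst hij
    rw [osc_avg_self]
    exact add_nonneg (osc_nonneg _ _) (mul_nonneg (dobrushinCoeff_nonneg _ _ _) (osc_nonneg _ _))
  · exact hW.osc_avg_le hf hij

lemma summable_mul_of_bdd {a d : V → ℝ} {B : ℝ} (ha : ∀ j, 0 ≤ a j) (hB : ∀ j, a j ≤ B)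
    (hd : ∀ j, 0 ≤ d j) (hs : Summable d) : Summable fun j => a j * d j :=
  Summable.of_nonneg_of_le (fun j => mul_nonneg (ha j) (hd j))
    (fun j => mul_le_mul_of_nonneg_right (hB j) (hd j)) (hs.mul_left B)

/-- `a` bounds the functional `F` in terms of oscillations. -/
def IsEstimate (F : ((V → Fin q) → ℝ) → ℝ) (a : V → ℝ) : Prop :=
  ∀ f : (V → Fin q) → ℝ, Continuous f → Summable (osc f) → |F f| ≤ ∑' j, a j * osc f j

lemma IsEstimate.mono {F : ((V → Fin q) → ℝ) → ℝ} {a a' : V → ℝ} {B : ℝ}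
    (h : IsEstimate F a) (ha : ∀ j, 0 ≤ a j) (haa' : ∀ j, a j ≤ a' j) (hB : ∀ j, a' j ≤ B) :
    IsEstimate F a' := fun f hf hs =>
  (h f hf hs).trans <| Summable.tsum_le_tsum
    (fun j => mul_le_mul_of_nonneg_right (haa' j) (osc_nonneg f j))
    (summable_mul_of_bdd ha (fun j => (haa' j).trans (hB j)) (osc_nonneg f) hs)
    (summable_mul_of_bdd (fun j => (ha j).trans (haa' j)) hB (osc_nonneg f) hs)

/-- Updating an estimate at the site `i`. -/
lemma IsEstimate.update [NeZero q] (hW : Regular W) {F : ((V → Fin q) → ℝ) → ℝ} {a : V → ℝ}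
    {B β : ℝ} {i : V} (h : IsEstimate F a) (ha : ∀ j, 0 ≤ a j) (hB : ∀ j, a j ≤ B)
    (hc : Summable (dobrushinCoeff W i))
    (hF : ∀ f, Continuous f → Summable (osc f) →
      |F f| ≤ |F (avg W {i} f)| + β * osc f i) :
    IsEstimate F (Function.update a i ((∑' j, a j * dobrushinCoeff W i j) + β)) := by
  intro f hf hs
  set x := (∑' j, a j * dobrushinCoeff W i j) + β with hx
  have hs1 := hW.summable_osc_avg hf hs hc
  have h0 : ∀ j, 0 ≤ Function.update a i 0 j := fun j => by
    by_cases hj : j = i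
    · subst hj; simp
    · rw [Function.update_of_ne hj]; exact ha j
  have h0B : ∀ j, Function.update a i 0 j ≤ B := fun j => by
    by_cases hj : j = i
    · subst hj; simpa using (ha j).trans (hB j)
    · rw [Function.update_of_ne hj]; exact hB j
  have hS0 := summable_mul_of_bdd h0 h0B (osc_nonneg f) hs
  have hSc := summable_mul_of_bdd ha hB (dobrushinCoeff_nonneg W i) hc
  have e : ∑' j, Function.update a i x j * osc f j =
      (∑' j, Function.update a i 0 j * osc f j) + x * osc f i := by
    rw [← tsum_ite_eq i (fun j => x * osc f j), ← hS0.tsum_add]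
    · refine tsum_congr fun j => ?_
      by_cases hj : j = i
      · subst hj; simp
      · simp [hj]
    · exact (hasSum_ite_eq i (x * osc f i)).summable.congr fun j => by
        by_cases hj : j = i
        · subst hj; simp
        · simp [hj]
  -- Averaging kills the oscillation at i and sends c_ij times it to each j; collecting these terms
  -- gives the new coefficient at i.
  have e2 : ∑' j, a j * osc (avg W {i} f) j ≤
      (∑' j, Function.update a i 0 j * osc f j) +
        (∑' j, a j * dobrushinCoeff W i j) * osc f i := by
    rw [← tsum_mul_right, ← hS0.tsum_add (hSc.mul_right _)]
    refine Summable.tsum_le_tsum (fun j => ?_)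
      (summable_mul_of_bdd ha hB (osc_nonneg _) hs1) (hS0.add (hSc.mul_right _))
    by_cases hj : j = i
    · subst hj
      rw [osc_avg_self, dobrushinCoeff_self]; simp
    · rw [Function.update_of_ne hj]
      have := mul_le_mul_of_nonneg_left (hW.osc_avg_le hf hj) (ha j)
      linarith
  rw [e]
  have h1 := hF f hf hs
  have h2 := h _ (hW.continuous_avg {i} hf) hs1
  rw [hx, add_mul]
  linarith

/-- If `A` is a supersolution of `C A + b ≤ A`, with `C` a Dobrushin matrix of norm less than one,
then `A` is an estimate. -/
theorem isEstimate_of_supersolution [NeZero q] (hW : Regular W) {F : ((V → Fin q) → ℝ) → ℝ}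
    {A b : V → ℝ} {α B ε₀ : ℝ} (hα0 : 0 ≤ α) (hα : α < 1)
    (hc : ∀ i, Summable (dobrushinCoeff W i)) (hcα : ∀ i, ∑' j, dobrushinCoeff W i j ≤ α)
    (hA : ∀ j, 0 ≤ A j) (hB : ∀ j, A j ≤ B) (hb : ∀ j, 0 ≤ b j)
    (hF : ∀ i f, Continuous f → Summable (osc f) → |F f| ≤ |F (avg W {i} f)| + b i * osc f i)
    (hF0 : ∀ f, Continuous f → Summable (osc f) → |F f| ≤ ε₀ * ∑' j, osc f j) (hε₀ : 0 ≤ ε₀)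
    (hsup : ∀ i, (∑' j, A j * dobrushinCoeff W i j) + b i ≤ A i) : IsEstimate F A := by
  have step : ∀ ε, 0 ≤ ε → IsEstimate F (fun j => A j + ε) → IsEstimate F fun j => A j + α * ε := by
    intro ε hε h
    have hle : α * ε ≤ ε := by nlinarith
    -- A sweep updates one site after another, always using the current estimate. Since all excesses
    -- over `A` are at most ε and the row sums of C at most α, the excess at the updated site drops
    -- to αε.
    have hS : ∀ S : Finset V, IsEstimate F fun j => A j + if j ∈ S then α * ε else ε := by
      intro S
      induction S using Finset.induction_on with
      | empty => simpa using h
      | insert i S hi ih =>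
        have hnn : ∀ j, 0 ≤ A j + if j ∈ S then α * ε else ε := fun j => by
          split_ifs <;> have := hA j <;> positivity
        have hbd : ∀ j, (A j + if j ∈ S then α * ε else ε) ≤ B + ε := fun j => by
          split_ifs <;> linarith [hB j]
        have hup := ih.update hW hnn hbd (hc i) (hF i)
        refine IsEstimate.mono (B := B + ε) hup ?_ ?_ ?_
        · intro j
          by_cases hj : j = i
          · subst hj
            rw [Function.update_self]
            exact add_nonneg (tsum_nonneg fun k =>
              mul_nonneg (hnn k) (dobrushinCoeff_nonneg W j k)) (hb j)
          · rw [Function.update_of_ne hj]; exact hnn j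
        · intro j
          by_cases hj : j = i
          · subst hj
            rw [Function.update_self, if_pos (Finset.mem_insert_self j S)]
            have : ∑' k, (A k + if k ∈ S then α * ε else ε) * dobrushinCoeff W j k ≤
                (∑' k, A k * dobrushinCoeff W j k) + ε * α := by
              have h1 := summable_mul_of_bdd hA hB (dobrushinCoeff_nonneg W j) (hc j)
              calc _ ≤ ∑' k, (A k * dobrushinCoeff W j k + ε * dobrushinCoeff W j k) := by
                    refine Summable.tsum_le_tsum (fun k => ?_)
                      (summable_mul_of_bdd hnn hbd (dobrushinCoeff_nonneg W j) (hc j))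
                      (h1.add ((hc j).mul_left ε))
                    rw [← add_mul]
                    refine mul_le_mul_of_nonneg_right ?_ (dobrushinCoeff_nonneg W j k)
                    split_ifs <;> linarith
                _ = (∑' k, A k * dobrushinCoeff W j k) + ε * ∑' k, dobrushinCoeff W j k := by
                    rw [h1.tsum_add ((hc j).mul_left ε), tsum_mul_left]
                _ ≤ _ := by
                    have := mul_le_mul_of_nonneg_left (hcα j) hε
                    linarith
            linarith [hsup j]
          · rw [Function.update_of_ne hj]
            simp [Finset.mem_insert, hj]
        · intro j
          split_ifs <;> linarith [hB j]
    intro f hf hs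
    have hAs := summable_mul_of_bdd hA hB (osc_nonneg f) hs
    -- The sweep over the infinite lattice is the limit over finite S; convergence uses the finite
    -- total oscillation.
    have hlim : Filter.Tendsto (fun S : Finset V => (∑' j, A j * osc f j) + ε * (∑' j, osc f j)
        - (1 - α) * ε * ∑ j ∈ S, osc f j) Filter.atTop
        (nhds ((∑' j, A j * osc f j) + ε * (∑' j, osc f j) - (1 - α) * ε * ∑' j, osc f j)) :=
      tendsto_const_nhds.sub (hs.hasSum.const_mul _ |>.congr fun S => rfl)
    have hgoal : ∑' j, (A j + α * ε) * osc f j =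
        (∑' j, A j * osc f j) + ε * (∑' j, osc f j) - (1 - α) * ε * ∑' j, osc f j := by
      simp only [add_mul]
      rw [hAs.tsum_add (hs.mul_left _), tsum_mul_left]
      ring
    rw [hgoal]
    refine ge_of_tendsto' hlim fun S => (hS S f hf hs).trans (le_of_eq ?_)
    have : ∀ j, (A j + if j ∈ S then α * ε else ε) * osc f j =
        A j * osc f j + ε * osc f j - (if j ∈ S then (1 - α) * ε * osc f j else 0) := fun j => by
      split_ifs <;> ring
    have hfin : HasSum (fun j => if j ∈ S then (1 - α) * ε * osc f j else 0)
        ((1 - α) * ε * ∑ j ∈ S, osc f j) := by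
      rw [Finset.mul_sum, Finset.sum_congr rfl fun j hj =>
        (if_pos hj : (if j ∈ S then (1 - α) * ε * osc f j else 0) = _).symm]
      exact hasSum_sum_of_ne_finset_zero fun j hj => if_neg hj
    simp only [this]
    rw [Summable.tsum_sub (hAs.add (hs.mul_left _)) hfin.summable,
      hAs.tsum_add (hs.mul_left _), tsum_mul_left, hfin.tsum_eq]
  -- Each full sweep gains a factor α, starting from the a priori constant ε₀.
  have hn : ∀ n : ℕ, IsEstimate F fun j => A j + α ^ n * ε₀ := by
    intro n
    induction n with
    | zero =>
      have h0 : IsEstimate F fun _ => ε₀ := fun f hf hs => by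
        rw [tsum_mul_left]; exact hF0 f hf hs
      refine h0.mono (B := B + ε₀) (fun _ => hε₀) (fun j => ?_) fun j => ?_
      · have := hA j; simp only [pow_zero]; linarith
      · have := hB j; simp only [pow_zero]; linarith
    | succ n ih =>
      have := step (α ^ n * ε₀) (by positivity) ih
      simpa only [pow_succ', mul_assoc] using this
  intro f hf hs
  have hAs := summable_mul_of_bdd hA hB (osc_nonneg f) hs
  have hlim : Filter.Tendsto (fun n : ℕ => (∑' j, A j * osc f j) + α ^ n * ε₀ * ∑' j, osc f j)
      Filter.atTop (nhds ((∑' j, A j * osc f j) + 0 * ε₀ * ∑' j, osc f j)) :=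
    (((tendsto_pow_atTop_nhds_zero_of_lt_one hα0 hα).mul_const _).mul_const _).const_add _
  rw [zero_mul, zero_mul, add_zero] at hlim
  refine ge_of_tendsto' hlim fun n => (hn n f hf hs).trans (le_of_eq ?_)
  simp only [add_mul]
  rw [hAs.tsum_add (hs.mul_left _), tsum_mul_left]

/-- **Dobrushin's uniqueness theorem.** -/
theorem IsGibbs.unique_of_dobrushin [NeZero q] [Countable V] (hW : Regular W) {α : ℝ}
    (hα0 : 0 ≤ α) (hα : α < 1)
    (hc : ∀ i, Summable (dobrushinCoeff W i)) (hcα : ∀ i, ∑' j, dobrushinCoeff W i j ≤ α)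
    {μ ν : Measure (V → Fin q)} (hμ : IsGibbs W μ) (hν : IsGibbs W ν) : μ = ν := by
  have := hμ.1
  have := hν.1
  refine measure_ext_of_summable_osc fun f hf hs => ?_
  -- Both measures are invariant under single-site averages, so A = b = 0 is a supersolution. The a
  -- priori constant 2 comes from comparing each integral with `f 0`.
  have key := isEstimate_of_supersolution hW (F := fun f => ∫ σ, f σ ∂μ - ∫ σ, f σ ∂ν)
    (A := fun _ => 0) (b := fun _ => 0) (B := 0) (ε₀ := 1 + 1) hα0 hα hc hcα (fun _ => le_rfl)
    (fun _ => le_rfl) (fun _ => le_rfl)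
    (fun i f hf _ => by simp [hμ.integral_avg hW {i} hf, hν.integral_avg hW {i} hf])
    (fun f hf hs => ?_) (by norm_num) (fun i => by simp) f hf hs
  · simp only [zero_mul, tsum_zero] at key
    exact sub_eq_zero.1 (abs_nonpos_iff.1 key)
  · have hb : ∀ ρ : Measure (V → Fin q), IsProbabilityMeasure ρ →
        |∫ σ, f σ ∂ρ - f 0| ≤ ∑' j, osc f j := fun ρ hρ => by
      have : ∫ σ, f σ ∂ρ - f 0 = ∫ σ, (f σ - f 0) ∂ρ := by
        rw [integral_sub (integrable_of_continuous hf) (integrable_const _)]; simp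
      rw [this]
      have := norm_integral_le_of_norm_le_const (μ := ρ) (f := fun σ => f σ - f 0)
        (Filter.Eventually.of_forall fun σ => abs_sub_le_tsum_osc hf hs 0 σ)
      simpa using this
    have h1 := hb μ inferInstance
    have h2 := hb ν inferInstance
    calc _ = |(∫ σ, f σ ∂μ - f 0) - (∫ σ, f σ ∂ν - f 0)| := by congr 1; ring
      _ ≤ _ := (abs_sub _ _).trans (by linarith)

/-- The covariance of two observables. -/
noncomputable def cov (μ : Measure (V → Fin q)) (f g : (V → Fin q) → ℝ) : ℝ :=
  (∫ σ, f σ * g σ ∂μ) - (∫ σ, f σ ∂μ) * ∫ σ, g σ ∂μ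

lemma cov_comm (μ : Measure (V → Fin q)) (f g : (V → Fin q) → ℝ) : cov μ f g = cov μ g f := by
  simp only [cov, mul_comm]

lemma Regular.abs_sub_avg_le (hW : Regular W) {f : (V → Fin q) → ℝ} (hf : Continuous f) (i : V)
    (σ : V → Fin q) : |f σ - avg W {i} f σ| ≤ osc f i := by
  have : f σ - avg W {i} f σ =
      ∑ a, siteKernel W i σ a * (f σ - f (Function.update σ i a)) := by
    rw [avg_singleton]
    simp only [mul_sub, Finset.sum_sub_distrib, ← Finset.sum_mul]
    rw [hW.sum_siteKernel, one_mul]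
  rw [this]
  refine (Finset.abs_sum_le_sum_abs _ _).trans ?_
  calc _ ≤ ∑ a, siteKernel W i σ a * osc f i := by
        refine Finset.sum_le_sum fun a _ => ?_
        rw [abs_mul, abs_of_nonneg (hW.siteKernel_nonneg i σ a)]
        exact mul_le_mul_of_nonneg_left (abs_sub_le_osc hf fun k hk => by
          simp [Function.update_of_ne hk]) (hW.siteKernel_nonneg i σ a)
    _ = osc f i := by rw [← Finset.sum_mul, hW.sum_siteKernel, one_mul]

/-- Averaging one factor over the spin at `i` changes the covariance by at most the product of the
oscillations at `i`. -/
lemma IsGibbs.abs_cov_sub_cov_avg_le [NeZero q] [Countable V] (hW : Regular W)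
    {μ : Measure (V → Fin q)} (hμ : IsGibbs W μ) {f g : (V → Fin q) → ℝ} (hf : Continuous f)
    (hg : Continuous g) (i : V) :
    |cov μ f g - cov μ (avg W {i} f) g| ≤ osc f i * osc g i := by
  have := hμ.1
  have hPf := hW.continuous_avg {i} hf
  have hPg := hW.continuous_avg {i} hg
  have i1 : Continuous fun σ => f σ * g σ := hf.mul hg
  have i2 : Continuous fun σ => avg W {i} f σ * g σ := hPf.mul hg
  have i3 : Continuous fun σ => f σ * avg W {i} g σ := hf.mul hPg
  have i4 : Continuous fun σ => avg W {i} f σ * avg W {i} g σ := hPf.mul hPg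
  have i5 : Continuous fun σ => f σ * g σ - avg W {i} f σ * g σ := i1.sub i2
  have i6 : Continuous fun σ => f σ * avg W {i} g σ - avg W {i} f σ * avg W {i} g σ := i3.sub i4
  -- The average of `g` does not see the spin at i, so `f` minus its average is orthogonal to it;
  -- the change of the covariance is thus the integral of a product of two fluctuations at i.
  have h1 : ∫ σ, f σ * avg W {i} g σ ∂μ = ∫ σ, avg W {i} f σ * avg W {i} g σ ∂μ := by
    rw [← hμ.integral_avg hW {i} i3]
    exact integral_congr_ae (Filter.Eventually.of_forall fun σ =>
      avg_mul_of_outside f (fun σ τ h => avg_congr h g) σ)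
  have e : cov μ f g - cov μ (avg W {i} f) g =
      ∫ σ, (f σ - avg W {i} f σ) * (g σ - avg W {i} g σ) ∂μ := by
    have h2 : ∀ σ, (f σ - avg W {i} f σ) * (g σ - avg W {i} g σ) =
        (f σ * g σ - avg W {i} f σ * g σ) - (f σ * avg W {i} g σ - avg W {i} f σ * avg W {i} g σ) :=
      fun σ => by ring
    simp only [h2]
    rw [integral_sub (integrable_of_continuous i5) (integrable_of_continuous i6),
      integral_sub (integrable_of_continuous i1) (integrable_of_continuous i2),
      integral_sub (integrable_of_continuous i3) (integrable_of_continuous i4),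
      h1, cov, cov, hμ.integral_avg hW {i} hf]
    ring
  rw [e]
  have := norm_integral_le_of_norm_le_const (μ := μ) (C := osc f i * osc g i)
    (f := fun σ => (f σ - avg W {i} f σ) * (g σ - avg W {i} g σ))
    (Filter.Eventually.of_forall fun σ => by
      rw [Real.norm_eq_abs, abs_mul]
      exact mul_le_mul (hW.abs_sub_avg_le hf i σ) (hW.abs_sub_avg_le hg i σ) (abs_nonneg _)
        (osc_nonneg _ _))
  simpa using this

end Dobrushin

end Potts

open scoped MeasureTheory

namespace Potts

set_option linter.unusedSectionVars false

/-! ### Exponential decay of correlations in Dobrushin's region. -/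

section Decay

open MeasureTheory

variable {V : Type*} [DecidableEq V] {q : ℕ} {W : Finset V → (V → Fin q) → ℝ}

/-- At m = 0 the factor is α < 1, so by continuity a small exponential weight over the range R is
affordable. -/
lemma exists_pos_mul_exp_lt_one {α : ℝ} (hα : α < 1) (R : ℝ) :
    ∃ m : ℝ, 0 < m ∧ α * Real.exp (m * R) < 1 := by
  have hc : Continuous fun m : ℝ => α * Real.exp (m * R) := by fun_prop
  have h0 : α * Real.exp (0 * R) < 1 := by simpa using hα
  have h1 := (hc.tendsto 0).eventually (gt_mem_nhds h0)
  obtain ⟨ε, hε, h⟩ := Metric.eventually_nhds_iff.1 h1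
  refine ⟨ε / 2, by positivity, h ?_⟩
  rw [Real.dist_eq, sub_zero, abs_of_pos (by positivity)]
  linarith

/-- Exponential decay of correlations for a finite-range model in Dobrushin's region. -/
theorem IsGibbs.expDecay_of_dobrushin [NeZero q] [Countable V] [PseudoMetricSpace V]
    (hW : Regular W) {α : ℝ} (hα0 : 0 ≤ α) (hα : α < 1)
    (hc : ∀ i, Summable (dobrushinCoeff W i)) (hcα : ∀ i, ∑' j, dobrushinCoeff W i j ≤ α) {R : ℝ}
    (hR : ∀ i j, dobrushinCoeff W i j ≠ 0 → dist i j ≤ R)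
    {μ : Measure (V → Fin q)} (hμ : IsGibbs W μ) : ExpDecay μ := by
  have := hμ.1
  obtain ⟨m, hm, hαm⟩ := exists_pos_mul_exp_lt_one hα R
  set α' := α * Real.exp (m * R) with hα'
  have h1α : 0 < 1 - α' := by linarith
  refine ⟨1 / (1 - α'), m, hm, fun f g hf hg hfs hgs => ?_⟩
  set K := 1 / (1 - α') with hK
  have hK0 : 0 < K := by positivity
  have hexp : ∀ i j : V, Real.exp (-m * dist i j) ≤ 1 := fun i j => by
    rw [Real.exp_le_one_iff]
    have := dist_nonneg (x := i) (y := j)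
    nlinarith
  have hS : ∀ i, Summable fun j => Real.exp (-m * dist i j) * osc g j := fun i =>
    summable_mul_of_bdd (fun j => (Real.exp_pos _).le) (hexp i) (osc_nonneg g) hgs
  have hSnn : ∀ i, 0 ≤ ∑' j, Real.exp (-m * dist i j) * osc g j := fun i =>
    tsum_nonneg fun j => mul_nonneg (Real.exp_pos _).le (osc_nonneg g j)
  -- The candidate supersolution. Moving i within the range R multiplies it by at most exp(mR), so C
  -- maps it below α' `A`, and K = 1/(1 - α') leaves room for the source term osc g.
  set A : V → ℝ := fun i => K * ∑' j, Real.exp (-m * dist i j) * osc g j with hA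
  have hA0 : ∀ i, 0 ≤ A i := fun i => mul_nonneg hK0.le (hSnn i)
  have hAB : ∀ i, A i ≤ K * ∑' j, osc g j := fun i =>
    mul_le_mul_of_nonneg_left (Summable.tsum_le_tsum (fun j => by
      have := mul_le_mul_of_nonneg_right (hexp i j) (osc_nonneg g j)
      rwa [one_mul] at this) (hS i) hgs) hK0.le
  have hAk : ∀ i k, A k * dobrushinCoeff W i k ≤
      Real.exp (m * R) * A i * dobrushinCoeff W i k := by
    intro i k
    by_cases h0 : dobrushinCoeff W i k = 0
    · simp [h0]
    · refine mul_le_mul_of_nonneg_right ?_ (dobrushinCoeff_nonneg W i k)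
      simp only [hA]
      rw [mul_left_comm]
      refine mul_le_mul_of_nonneg_left ?_ hK0.le
      rw [← tsum_mul_left]
      refine Summable.tsum_le_tsum (fun j => ?_) (hS k) ((hS i).mul_left _)
      rw [← mul_assoc, ← Real.exp_add]
      refine mul_le_mul_of_nonneg_right (Real.exp_le_exp.2 ?_) (osc_nonneg g j)
      have h1 := dist_triangle i k j
      have h2 := hR i k h0
      nlinarith
  -- The diagonal term j = i of the weighted sum already dominates the source.
  have hgA : ∀ i, osc g i ≤ (1 - α') * A i := by
    intro i
    have h1 := (hS i).le_tsum i fun j _ => mul_nonneg (Real.exp_pos _).le (osc_nonneg g j)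
    have h2 : (1 - α') * A i = ∑' j, Real.exp (-m * dist i j) * osc g j := by
      simp only [hA, hK]; field_simp
    rw [h2]
    simpa using h1
  have key := isEstimate_of_supersolution hW (F := fun f => cov μ f g) (A := A) (b := osc g)
    (ε₀ := ∫ σ, |g σ - ∫ τ, g τ ∂μ| ∂μ) hα0 hα hc hcα hA0 hAB (osc_nonneg g)
    (fun i f hf _ => ?_) (fun f hf hs => ?_) (integral_nonneg fun _ => abs_nonneg _) (fun i => ?_)
    f hf hfs
  · refine key.trans (le_of_eq ?_)
    rw [← tsum_mul_left]
    refine tsum_congr fun i => ?_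
    simp only [hA]
    rw [mul_assoc, mul_comm (tsum _), ← tsum_mul_left]
    congr 1
    exact tsum_congr fun j => by ring
  · have h1 := hμ.abs_cov_sub_cov_avg_le hW hf hg i
    have h2 := abs_sub_abs_le_abs_sub (cov μ f g) (cov μ (avg W {i} f) g)
    rw [mul_comm (osc g i)]
    linarith
  · set c := ∫ τ, g τ ∂μ with hcdef
    have hgc : Continuous fun σ => g σ - c := hg.sub continuous_const
    have i1 : Continuous fun σ => f σ * g σ := hf.mul hg
    have i2 : Continuous fun σ => f σ * c := hf.mul continuous_const
    have i3 : Continuous fun σ => f σ * g σ - f σ * c := i1.sub i2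
    have i4 : Continuous fun σ => f 0 * (g σ - c) := hgc.const_mul _
    have e : cov μ f g = ∫ σ, (f σ - f 0) * (g σ - c) ∂μ := by
      have e1 : ∀ σ, (f σ - f 0) * (g σ - c) = (f σ * g σ - f σ * c) - f 0 * (g σ - c) :=
        fun σ => by ring
      simp only [e1]
      rw [integral_sub (integrable_of_continuous i3) (integrable_of_continuous i4),
        integral_sub (integrable_of_continuous i1) (integrable_of_continuous i2),
        integral_const_mul, integral_sub (integrable_of_continuous hg) (integrable_const _),
        integral_mul_const, cov]
      simp [← hcdef]
    rw [e]
    refine (abs_integral_le_integral_abs).trans ?_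
    rw [← integral_mul_const]
    refine integral_mono (integrable_of_continuous
      (((hf.sub continuous_const).mul hgc).abs)) (integrable_of_continuous (hgc.abs.mul_const _))
      fun σ => ?_
    simp only
    rw [abs_mul, mul_comm]
    exact mul_le_mul_of_nonneg_left (abs_sub_le_tsum_osc hf hs 0 σ) (abs_nonneg _)
  · have h1 : ∑' k, A k * dobrushinCoeff W i k ≤ α' * A i := by
      calc _ ≤ ∑' k, Real.exp (m * R) * A i * dobrushinCoeff W i k :=
            Summable.tsum_le_tsum (hAk i)
              (summable_mul_of_bdd hA0 hAB (dobrushinCoeff_nonneg W i) (hc i)) ((hc i).mul_left _)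
        _ = Real.exp (m * R) * A i * ∑' k, dobrushinCoeff W i k := tsum_mul_left
        _ ≤ Real.exp (m * R) * A i * α := mul_le_mul_of_nonneg_left (hcα i)
            (mul_nonneg (Real.exp_pos _).le (hA0 i))
        _ = α' * A i := by rw [hα']; ring
    linarith [hgA i]

end Decay

/-! ### Consistency of the kernels and existence of Gibbs measures. -/

section Existence

open MeasureTheory

variable {V : Type*} [DecidableEq V] {q : ℕ} {W : Finset V → (V → Fin q) → ℝ}

/-- The factors of `W Λ'` that are not factors of `W Λ` do not depend on the spins in `Λ`. -/
def Consistent (W : Finset V → (V → Fin q) → ℝ) : Prop :=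
  ∀ Λ Λ' : Finset V, Λ ⊆ Λ' → ∀ σ τ : V → Fin q, (∀ v, v ∉ Λ → σ v = τ v) →
    W Λ' σ * W Λ τ = W Λ' τ * W Λ σ

/-- Exchanging the spins in `Λ ⊆ Λ'` between two configurations. -/
def swapSpins {Λ Λ' : Finset V} (h : Λ ⊆ Λ') (p : (Λ' → Fin q) × (Λ → Fin q)) :
    (Λ' → Fin q) × (Λ → Fin q) :=
  (fun v => if hv : v.1 ∈ Λ then p.2 ⟨v, hv⟩ else p.1 v, fun v => p.1 ⟨v, h v.2⟩)

lemma swapSpins_involutive {Λ Λ' : Finset V} (h : Λ ⊆ Λ') :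
    Function.Involutive (swapSpins (q := q) h) := by
  rintro ⟨ξ, η⟩
  refine Prod.ext (funext fun v => ?_) (funext fun v => ?_)
  · by_cases hv : v.1 ∈ Λ <;> simp [swapSpins, hv]
  · simp [swapSpins]

lemma glue_swapSpins {Λ Λ' : Finset V} (h : Λ ⊆ Λ') (p : (Λ' → Fin q) × (Λ → Fin q))
    (σ : V → Fin q) : glue Λ' (swapSpins h p).1 σ = glue Λ p.2 (glue Λ' p.1 σ) := by
  funext v
  by_cases hv : v ∈ Λ
  · rw [glue_of_mem _ _ hv, glue_of_mem _ _ (h hv)]; simp [swapSpins, hv]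
  · rw [glue_of_notMem _ _ hv]
    by_cases hv' : v ∈ Λ'
    · rw [glue_of_mem _ _ hv', glue_of_mem _ _ hv']; simp [swapSpins, hv]
    · rw [glue_of_notMem _ _ hv', glue_of_notMem _ _ hv']

/-- Both sides are sums over pairs: a configuration in Λ' and a resampled one in Λ. Exchanging the
two samples in Λ is an involution that carries one sum to the other, and `Consistent` is the
detailed balance relation making the joint weights agree. -/
lemma Regular.avg_avg (hW : Regular W) (hC : Consistent W) {Λ Λ' : Finset V} (h : Λ ⊆ Λ')
    (f : (V → Fin q) → ℝ) (σ : V → Fin q) : avg W Λ' (avg W Λ f) σ = avg W Λ' f σ := by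
  have e1 : avg W Λ' (avg W Λ f) σ = ∑ p : (Λ' → Fin q) × (Λ → Fin q),
      kernel W Λ' σ p.1 * (kernel W Λ (glue Λ' p.1 σ) p.2 *
        f (glue Λ p.2 (glue Λ' p.1 σ))) := by
    rw [Fintype.sum_prod_type]
    exact Finset.sum_congr rfl fun ξ _ => by rw [avg, Finset.mul_sum]
  have e2 : avg W Λ' f σ = ∑ p : (Λ' → Fin q) × (Λ → Fin q),
      kernel W Λ' σ p.1 * (kernel W Λ (glue Λ' p.1 σ) p.2 * f (glue Λ' p.1 σ)) := by
    rw [Fintype.sum_prod_type]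
    refine Finset.sum_congr rfl fun ξ _ => ?_
    simp only
    rw [← Finset.mul_sum, ← Finset.sum_mul, hW.sum_kernel, one_mul]
  rw [e1, e2, ← Equiv.sum_comp (swapSpins_involutive h).toPerm]
  refine Finset.sum_congr rfl fun p _ => ?_
  simp only [Function.Involutive.coe_toPerm]
  have h1 : glue Λ (swapSpins h p).2 (glue Λ' (swapSpins h p).1 σ) = glue Λ' p.1 σ := by
    rw [← glue_swapSpins h, swapSpins_involutive h p]
  rw [h1, ← mul_assoc, ← mul_assoc]
  congr 1
  have h2 : ∀ v, v ∉ Λ → glue Λ' (swapSpins h p).1 σ v = glue Λ' p.1 σ v := fun v hv => by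
    rw [glue_swapSpins, glue_of_notMem _ _ hv]
  have h3 := hC Λ Λ' h _ _ h2
  have h4 := (glue_swapSpins h p σ).symm
  simp only [kernel]
  rw [h1, partition_congr h2, h4, div_mul_div_comm, div_mul_div_comm, h3]

/-- The Gibbs distribution in the volume `Λ` with boundary condition `σ`. -/
noncomputable def volumeMeasure (W : Finset V → (V → Fin q) → ℝ) (σ : V → Fin q) (Λ : Finset V) :
    Measure (V → Fin q) :=
  ∑ ξ : Λ → Fin q, ENNReal.ofReal (kernel W Λ σ ξ) • Measure.dirac (glue Λ ξ σ)

lemma Regular.isProbabilityMeasure_volumeMeasure (hW : Regular W) (σ : V → Fin q)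
    (Λ : Finset V) : IsProbabilityMeasure (volumeMeasure W σ Λ) := by
  refine ⟨?_⟩
  simp only [volumeMeasure, Measure.coe_finsetSum, Finset.sum_apply, Measure.smul_apply,
    measure_univ, smul_eq_mul, mul_one]
  rw [← ENNReal.ofReal_sum_of_nonneg fun ξ _ => hW.kernel_nonneg Λ σ ξ, hW.sum_kernel,
    ENNReal.ofReal_one]

lemma Regular.integral_volumeMeasure [Countable V] (hW : Regular W) (σ : V → Fin q) (Λ : Finset V)
    {f : (V → Fin q) → ℝ} (hf : Continuous f) :
    ∫ τ, f τ ∂(volumeMeasure W σ Λ) = avg W Λ f σ := by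
  rw [volumeMeasure, integral_finsetSum_measure]
  · refine Finset.sum_congr rfl fun ξ _ => ?_
    rw [integral_smul_measure, integral_dirac' _ _ hf.stronglyMeasurable,
      ENNReal.toReal_ofReal (hW.kernel_nonneg Λ σ ξ), smul_eq_mul]
  · intro ξ _
    exact (integrable_of_continuous hf).smul_measure ENNReal.ofReal_ne_top

/-- Existence of infinite-volume Gibbs measures, by compactness. -/
theorem exists_isGibbs [NeZero q] [Countable V] (hW : Regular W) (hC : Consistent W) :
    ∃ μ : Measure (V → Fin q), IsGibbs W μ := by
  set ω : Finset V → ProbabilityMeasure (V → Fin q) := fun Λ =>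
    ⟨volumeMeasure W 0 Λ, hW.isProbabilityMeasure_volumeMeasure 0 Λ⟩ with hω
  -- An ultrafilter finer than `atTop` selects a limit point of the finite-volume measures while
  -- keeping "eventually Λ ⊆ Λ'", which is what consistency needs to pass the DLR equation to the
  -- limit.
  obtain ⟨μ, -, hμ⟩ := isCompact_univ.ultrafilter_le_nhds
    ((Ultrafilter.of (Filter.atTop : Filter (Finset V))).map ω) (by simp)
  have hlim : ∀ f : (V → Fin q) → ℝ, Continuous f → Filter.Tendsto (fun Λ => avg W Λ f 0)
      (Ultrafilter.of (Filter.atTop : Filter (Finset V))) (nhds (∫ σ, f σ ∂(μ : Measure _))) := by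
    intro f hf
    have := (ProbabilityMeasure.tendsto_iff_forall_integral_tendsto.1
      (show Filter.Tendsto ω (Ultrafilter.of (Filter.atTop : Filter (Finset V))) (nhds μ) from hμ))
      (BoundedContinuousFunction.mkOfCompact ⟨f, hf⟩)
    refine this.congr fun Λ => ?_
    exact hW.integral_volumeMeasure 0 Λ hf
  refine ⟨μ, isGibbs_of_integral_avg hW fun Λ f hf => ?_⟩
  refine tendsto_nhds_unique (hlim _ (hW.continuous_avg Λ hf)) ((hlim f hf).congr' ?_)
  filter_upwards [Ultrafilter.of_le _ (Filter.mem_atTop Λ)] with Λ' hΛ'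
  exact (hW.avg_avg hC hΛ' f 0).symm

end Existence

end Potts

open scoped MeasureTheory

namespace Potts

set_option linter.unusedSectionVars false

/-! ### The two models and the restriction of Gibbs measures to the hexagonal lattice. -/

section Models

open MeasureTheory

variable {V : Type*} [DecidableEq V] {q : ℕ}

lemma exclusion_nonneg (adj : V → V → Prop) (Λ : Finset V) (σ : V → Fin q) :
    0 ≤ exclusion adj Λ σ := by
  unfold exclusion; split_ifs <;> norm_num

lemma exclusion_eq_one {adj : V → V → Prop} {Λ : Finset V} {σ : V → Fin q}
    (h : ∀ x ∈ Λ, ∀ y, adj x y → σ x ≠ σ y) : exclusion adj Λ σ = 1 := if_pos h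

lemma exclusion_eq_zero {adj : V → V → Prop} {Λ : Finset V} {σ : V → Fin q}
    (h : ¬ ∀ x ∈ Λ, ∀ y, adj x y → σ x ≠ σ y) : exclusion adj Λ σ = 0 := if_neg h

lemma continuous_exclusion {adj : V → V → Prop} (hadj : ∀ x, ∃ N : Finset V, ∀ y, adj x y → y ∈ N)
    (Λ : Finset V) : Continuous (exclusion (q := q) adj Λ) := by
  choose N hN using hadj
  refine continuous_of_local (Λ ∪ Λ.biUnion N) fun σ τ h => ?_
  have : (∀ x ∈ Λ, ∀ y, adj x y → σ x ≠ σ y) ↔ ∀ x ∈ Λ, ∀ y, adj x y → τ x ≠ τ y := by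
    refine forall₂_congr fun x hx => forall₂_congr fun y hy => ?_
    rw [h x (Finset.mem_union_left _ hx),
      h y (Finset.mem_union_right _ (Finset.mem_biUnion.2 ⟨x, hx, hN x y hy⟩))]
  by_cases hτ : ∀ x ∈ Λ, ∀ y, adj x y → τ x ≠ τ y
  · rw [exclusion_eq_one hτ, exclusion_eq_one (this.2 hτ)]
  · rw [exclusion_eq_zero hτ, exclusion_eq_zero fun h => hτ (this.1 h)]

/-- An edge counted for Λ' either meets Λ, and is then tested by the weight of Λ, or has both ends
off Λ, where the two configurations coincide. -/
lemma exclusion_consistent {adj : V → V → Prop} (hsymm : ∀ x y, adj x y → adj y x) :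
    Consistent (exclusion (q := q) adj) := by
  have key : ∀ Λ Λ' : Finset V, Λ ⊆ Λ' → ∀ σ τ : V → Fin q, (∀ v, v ∉ Λ → σ v = τ v) →
      (∀ x ∈ Λ', ∀ y, adj x y → σ x ≠ σ y) → (∀ x ∈ Λ, ∀ y, adj x y → τ x ≠ τ y) →
      ∀ x ∈ Λ', ∀ y, adj x y → τ x ≠ τ y := by
    intro Λ Λ' _ σ τ hst h1 h2 x hx y hxy
    by_cases hxΛ : x ∈ Λ
    · exact h2 x hxΛ y hxy
    by_cases hyΛ : y ∈ Λ
    · exact (h2 y hyΛ x (hsymm x y hxy)).symm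
    rw [← hst x hxΛ, ← hst y hyΛ]
    exact h1 x hx y hxy
  intro Λ Λ' h σ τ hst
  have hsub : ∀ σ : V → Fin q, (∀ x ∈ Λ', ∀ y, adj x y → σ x ≠ σ y) →
      ∀ x ∈ Λ, ∀ y, adj x y → σ x ≠ σ y := fun σ hσ x hx => hσ x (h hx)
  have k1 := key Λ Λ' h σ τ hst
  have k2 := key Λ Λ' h τ σ fun v hv => (hst v hv).symm
  have s1 := hsub σ
  have s2 := hsub τ
  clear key hsub
  unfold exclusion
  split_ifs with a b c d c d
  all_goals first
  | rfl
  | norm_num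
  all_goals first
  | exact absurd (k1 a b) c
  | exact absurd (s1 a) d
  | skip
  all_goals tauto

/-- Greedy colouring. -/
lemma exists_proper_colouring {adj : V → V → Prop} (hsymm : ∀ x y, adj x y → adj y x)
    (hirr : ∀ x, ¬ adj x x)
    (hdeg : ∀ x, ∃ N : Finset V, N.card < q ∧ ∀ y, adj x y → y ∈ N) (Λ : Finset V)
    (σ : V → Fin q) :
    ∃ τ : V → Fin q, (∀ v, v ∉ Λ → τ v = σ v) ∧ ∀ x ∈ Λ, ∀ y, adj x y → τ x ≠ τ y := by
  induction Λ using Finset.induction_on with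
  | empty => exact ⟨σ, fun _ _ => rfl, by simp⟩
  | insert x Λ hx ih =>
    obtain ⟨τ, h1, h2⟩ := ih
    obtain ⟨N, hN, hadj⟩ := hdeg x
    -- Fewer than q neighbours always leave a free colour, whatever the boundary condition.
    obtain ⟨a, ha⟩ : ∃ a, a ∉ N.image τ := by
      by_contra! h
      have : (Finset.univ : Finset (Fin q)).card ≤ (N.image τ).card :=
        Finset.card_le_card fun a _ => h a
      have := this.trans Finset.card_image_le
      simp at this
      omega
    have hne : ∀ y, adj x y → a ≠ τ y := fun y hy h =>
      ha (Finset.mem_image.2 ⟨y, hadj y hy, h.symm⟩)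
    refine ⟨Function.update τ x a, fun v hv => ?_, fun z hz y hzy => ?_⟩
    · rw [Finset.mem_insert, not_or] at hv
      rw [Function.update_of_ne hv.1, h1 v hv.2]
    · by_cases hzx : z = x
      · subst hzx
        have hyz : y ≠ z := fun h => hirr z (h ▸ hzy)
        rw [Function.update_self, Function.update_of_ne hyz]
        exact hne y hzy
      · rw [Function.update_of_ne hzx]
        by_cases hyx : y = x
        · subst hyx
          rw [Function.update_self]
          exact (hne z (hsymm z y hzy)).symm
        · rw [Function.update_of_ne hyx]
          exact h2 z ((Finset.mem_insert.1 hz).resolve_left hzx) y hzy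

lemma exists_exclusion_eq_one {adj : V → V → Prop} (hsymm : ∀ x y, adj x y → adj y x)
    (hirr : ∀ x, ¬ adj x x)
    (hdeg : ∀ x, ∃ N : Finset V, N.card < q ∧ ∀ y, adj x y → y ∈ N) (Λ : Finset V)
    (σ : V → Fin q) : ∃ ξ : Λ → Fin q, exclusion adj Λ (glue Λ ξ σ) = 1 := by
  obtain ⟨τ, h1, h2⟩ := exists_proper_colouring hsymm hirr hdeg Λ σ
  refine ⟨fun v => τ v, ?_⟩
  rw [glue_congr _ fun v hv => (h1 v hv).symm, glue_self]
  exact if_pos h2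

lemma mem_nbrs {x y : ℤ × ℤ} : y ∈ nbrs x ↔
    (y.1 = x.1 + 1 ∧ y.2 = x.2) ∨ (y.1 = x.1 - 1 ∧ y.2 = x.2) ∨ (y.1 = x.1 ∧ y.2 = x.2 + 1) ∨
    (y.1 = x.1 ∧ y.2 = x.2 - 1) ∨ (y.1 = x.1 + 1 ∧ y.2 = x.2 - 1) ∨
    (y.1 = x.1 - 1 ∧ y.2 = x.2 + 1) := by
  simp [nbrs, Prod.ext_iff, sub_eq_add_neg]

lemma nbrs_symm {x y : ℤ × ℤ} : y ∈ nbrs x ↔ x ∈ nbrs y := by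
  simp only [mem_nbrs]; omega

lemma not_mem_nbrs_self (x : ℤ × ℤ) : x ∉ nbrs x := by
  simp only [mem_nbrs]; omega

lemma card_nbrs_le (x : ℤ × ℤ) : (nbrs x).card ≤ 6 := Finset.card_le_six

lemma not_isCentre_of_mem_nbrs {r : ℤ} {c x : ℤ × ℤ} (hc : IsCentre r c) (hx : x ∈ nbrs c) :
    ¬ IsCentre r x := by
  simp only [mem_nbrs, IsCentre] at *; omega

lemma isCentre_of_mem_centres {r : ℤ} {Λ : Finset (Surv r)} {c : ℤ × ℤ} (h : c ∈ centres r Λ) :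
    IsCentre r c := (Finset.mem_filter.1 h).2

lemma mem_centres {r : ℤ} {Λ : Finset (Surv r)} {c : ℤ × ℤ} :
    c ∈ centres r Λ ↔ IsCentre r c ∧ ∃ x ∈ Λ, c ∈ nbrs x.1 := by
  simp only [centres, Finset.mem_filter, Finset.mem_biUnion]; tauto

lemma triWeight_consistent (q : ℕ) : Consistent (triWeight q) :=
  exclusion_consistent fun _ _ h => nbrs_symm.1 h

lemma triWeight_regular (hq : 7 ≤ q) : Regular (triWeight q) where
  nonneg := exclusion_nonneg _
  cont := continuous_exclusion fun x => ⟨nbrs x, fun _ h => h⟩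
  pos Λ σ := by
    obtain ⟨ξ, hξ⟩ := exists_exclusion_eq_one (q := q) (adj := fun x y => y ∈ nbrs x)
      (fun _ _ h => nbrs_symm.1 h) not_mem_nbrs_self
      (fun x => ⟨nbrs x, (card_nbrs_le x).trans_lt (by omega), fun _ h => h⟩) Λ σ
    refine Finset.sum_pos' (fun ξ _ => exclusion_nonneg _ _ _) ⟨ξ, Finset.mem_univ _, ?_⟩
    rw [triWeight, hξ]; norm_num

lemma NN.symm {r : ℤ} {x y : Surv r} (h : NN x y) : NN y x := nbrs_symm.1 h

lemma NN_subset {r : ℤ} (x : Surv r) :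
    ∃ N : Finset (Surv r), N.card < 7 ∧ ∀ y, NN x y → y ∈ N :=
  ⟨(nbrs x.1).subtype _, by
    have := card_nbrs_le x.1
    rw [Finset.card_subtype]
    exact (Finset.card_filter_le _ _).trans_lt (by omega),
    fun y h => Finset.mem_subtype.2 h⟩

lemma mem_hexColours {r : ℤ} {c : ℤ × ℤ} {t : Surv r → Fin q} {a : Fin q} :
    a ∈ hexColours c t ↔ ∃ y : Surv r, y.1 ∈ nbrs c ∧ t y = a := by
  simp [hexColours]

lemma card_hexColours_le {r : ℤ} (c : ℤ × ℤ) (t : Surv r → Fin q) :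
    (hexColours c t).card ≤ 6 := by
  have : hexColours c t ⊆ ((nbrs c).subtype fun x => ¬ IsCentre r x).image t := fun a ha => by
    obtain ⟨y, hy, rfl⟩ := mem_hexColours.1 ha
    exact Finset.mem_image_of_mem t (Finset.mem_subtype.2 hy)
  refine (Finset.card_le_card this).trans (Finset.card_image_le.trans ?_)
  rw [Finset.card_subtype]
  exact (Finset.card_filter_le _ _).trans (card_nbrs_le c)

lemma hexColours_congr {r : ℤ} {c : ℤ × ℤ} {t t' : Surv r → Fin q}
    (h : ∀ y : Surv r, y.1 ∈ nbrs c → t y = t' y) : hexColours c t = hexColours c t' := by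
  ext a
  simp only [mem_hexColours]
  exact exists_congr fun y => and_congr_right fun hy => by rw [h y hy]

/-- A hexagon shows at most six colours, so its factor is at least q - 6 > 0; only the exclusions
can make a weight vanish, and greedy colouring handles those. -/
lemma decWeight_regular (hq : 7 ≤ q) (r : ℤ) : Regular (decWeight q r) := by
  have hpos : ∀ (Λ : Finset (Surv r)) (t : Surv r → Fin q),
      0 < ∏ c ∈ centres r Λ, ((q : ℝ) - (hexColours c t).card) := fun Λ t =>
    Finset.prod_pos fun c _ => by
      have h1 : ((hexColours c t).card : ℝ) ≤ 6 := by exact_mod_cast card_hexColours_le c t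
      have h2 : (7 : ℝ) ≤ q := by exact_mod_cast hq
      linarith
  refine ⟨fun Λ t => mul_nonneg (hpos Λ t).le (exclusion_nonneg _ _ _), fun Λ t => ?_, fun Λ => ?_⟩
  · obtain ⟨ξ, hξ⟩ := exists_exclusion_eq_one (q := q) (adj := NN (r := r)) (fun _ _ h => h.symm)
      (fun x => not_mem_nbrs_self x.1)
      (fun x => (NN_subset x).imp fun N hN => ⟨hN.1.trans_le hq, hN.2⟩) Λ t
    refine Finset.sum_pos' (fun ξ _ => mul_nonneg (hpos Λ _).le (exclusion_nonneg _ _ _))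
      ⟨ξ, Finset.mem_univ _, ?_⟩
    rw [decWeight, hξ, mul_one]
    exact hpos Λ _
  · refine (continuous_finsetProd _ fun c _ => ?_).mul
      (continuous_exclusion (fun x => (NN_subset x).imp fun N hN => hN.2) Λ)
    exact continuous_of_local ((nbrs c).subtype _) fun t t' h => by
      rw [hexColours_congr fun y hy => h y (Finset.mem_subtype.2 hy)]

/-- Restriction of a configuration to the surviving sites. -/
def restr {r : ℤ} (σ : ℤ × ℤ → Fin q) : Surv r → Fin q := fun x => σ x.1

lemma glue_centres_surv {r : ℤ} (Λ : Finset (Surv r)) (s : centres r Λ → Fin q)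
    (σ : ℤ × ℤ → Fin q) {x : ℤ × ℤ} (hx : ¬ IsCentre r x) : glue (centres r Λ) s σ x = σ x :=
  glue_of_notMem _ _ fun h => hx (isCentre_of_mem_centres h)

/-- No two centres are adjacent, and every centre adjacent to Λ belongs to `centres r Λ`. Hence each
relevant edge joins either one of these centres to a survivor or two survivors, and the constraint
factorizes over the centres. -/
lemma triWeight_glue_centres {r : ℤ} (Λ : Finset (Surv r)) (σ : ℤ × ℤ → Fin q)
    (s : centres r Λ → Fin q) :
    triWeight q (Λ.image Subtype.val ∪ centres r Λ) (glue (centres r Λ) s σ) =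
      (∏ c : centres r Λ, if s c ∉ hexColours c.1 (restr (r := r) σ) then (1 : ℝ) else 0) *
        exclusion NN Λ (restr (r := r) σ) := by
  have key : (∀ x ∈ Λ.image Subtype.val ∪ centres r Λ, ∀ y, y ∈ nbrs x →
      glue (centres r Λ) s σ x ≠ glue (centres r Λ) s σ y) ↔
      (∀ c : centres r Λ, s c ∉ hexColours c.1 (restr (r := r) σ)) ∧
        ∀ x ∈ Λ, ∀ y, NN x y → restr (r := r) σ x ≠ restr (r := r) σ y := by
    refine ⟨fun h => ⟨fun c hc => ?_, fun x hx y hxy => ?_⟩, ?_⟩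
    · obtain ⟨y, hy, hyc⟩ := mem_hexColours.1 hc
      refine h c.1 (Finset.mem_union_right _ c.2) y.1 hy ?_
      rw [glue_of_mem _ _ c.2, glue_centres_surv Λ s σ y.2]
      exact hyc.symm
    · have := h x.1 (Finset.mem_union_left _ (Finset.mem_image_of_mem _ hx)) y.1 hxy
      rwa [glue_centres_surv Λ s σ y.2, glue_centres_surv Λ s σ x.2] at this
    · rintro ⟨h1, h2⟩ x hx y hxy
      rcases Finset.mem_union.1 hx with hx | hx
      · obtain ⟨x, hxΛ, rfl⟩ := Finset.mem_image.1 hx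
        rw [glue_centres_surv Λ s σ x.2]
        by_cases hy : IsCentre r y
        · have hyC : y ∈ centres r Λ := mem_centres.2 ⟨hy, x, hxΛ, hxy⟩
          rw [glue_of_mem _ _ hyC]
          intro he
          exact h1 ⟨y, hyC⟩ (mem_hexColours.2 ⟨x, nbrs_symm.1 hxy, he⟩)
        · rw [glue_centres_surv Λ s σ hy]
          exact h2 x hxΛ ⟨y, hy⟩ hxy
      · have hy := not_isCentre_of_mem_nbrs (isCentre_of_mem_centres hx) hxy
        rw [glue_of_mem _ _ hx, glue_centres_surv Λ s σ hy]
        intro he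
        exact h1 ⟨x, hx⟩ (mem_hexColours.2 ⟨⟨y, hy⟩, hxy, he.symm⟩)
  by_cases h1 : ∀ c : centres r Λ, s c ∉ hexColours c.1 (restr (r := r) σ)
  · rw [Finset.prod_congr rfl fun c _ => if_pos (h1 c), Finset.prod_const_one, one_mul]
    by_cases h2 : ∀ x ∈ Λ, ∀ y, NN x y → restr (r := r) σ x ≠ restr (r := r) σ y
    · rw [exclusion_eq_one h2]; exact exclusion_eq_one (key.2 ⟨h1, h2⟩)
    · rw [exclusion_eq_zero h2]; exact exclusion_eq_zero fun h => h2 (key.1 h).2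
  · obtain ⟨c, hc⟩ := not_forall.1 h1
    rw [Finset.prod_eq_zero (Finset.mem_univ c) (if_neg hc), zero_mul]
    exact exclusion_eq_zero fun h => h1 (key.1 h).1

/-- Summing over the spins of the decimated sites yields the weights of the decimated model. -/
lemma sum_triWeight {r : ℤ} (Λ : Finset (Surv r)) (σ : ℤ × ℤ → Fin q) :
    ∑ s : centres r Λ → Fin q,
      triWeight q (Λ.image Subtype.val ∪ centres r Λ) (glue (centres r Λ) s σ) =
        decWeight q r Λ (restr σ) := by
  simp only [triWeight_glue_centres]
  rw [← Finset.sum_mul, decWeight]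
  congr 1
  have := Finset.prod_univ_sum (R := ℝ) (fun _ : centres r Λ => (Finset.univ : Finset (Fin q)))
    (fun c a => if a ∉ hexColours c.1 (restr (r := r) σ) then (1 : ℝ) else 0)
  rw [Fintype.piFinset_univ] at this
  rw [← this]
  refine Eq.trans ?_ (Finset.prod_coe_sort (centres r Λ)
    fun c => (q : ℝ) - (hexColours c (restr (r := r) σ)).card)
  refine Finset.prod_congr rfl fun c _ => ?_
  have hcompl : (Finset.univ.filter fun a => a ∉ hexColours c.1 (restr (r := r) σ)) =
      (hexColours c.1 (restr (r := r) σ))ᶜ := by ext a; simp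
  rw [Finset.sum_boole, hcompl, Finset.card_compl, Fintype.card_fin, Nat.cast_sub]
  exact (Finset.card_le_univ _).trans_eq (Fintype.card_fin q)

/-- Configurations on a disjoint union. -/
lemma sum_glue_union {A B : Finset V} (h : Disjoint A B) (F : (V → Fin q) → ℝ) (σ : V → Fin q) :
    ∑ ξ : ↥(A ∪ B) → Fin q, F (glue (A ∪ B) ξ σ) =
      ∑ η : A → Fin q, ∑ s : B → Fin q, F (glue B s (glue A η σ)) := by
  have e : ∑ η : A → Fin q, ∑ s : B → Fin q, F (glue B s (glue A η σ)) =
      ∑ p : (A → Fin q) × (B → Fin q), F (glue B p.2 (glue A p.1 σ)) := by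
    rw [Fintype.sum_prod_type]
  rw [e]
  have hA : ∀ v ∈ A, v ∉ B := fun v hv => Finset.disjoint_left.1 h hv
  let E : (↥(A ∪ B) → Fin q) ≃ (A → Fin q) × (B → Fin q) :=
    { toFun := fun ξ => (fun v => ξ ⟨v, Finset.mem_union_left _ v.2⟩,
        fun v => ξ ⟨v, Finset.mem_union_right _ v.2⟩)
      invFun := fun p v => glue B p.2 (glue A p.1 σ) v
      left_inv := fun ξ => by
        funext v
        by_cases hv : v.1 ∈ B
        · simp only [glue_of_mem _ _ hv]
        · have hvA : v.1 ∈ A := (Finset.mem_union.1 v.2).resolve_right hv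
          simp only [glue_of_notMem _ _ hv, glue_of_mem _ _ hvA]
      right_inv := fun p => by
        refine Prod.ext (funext fun v => ?_) (funext fun v => ?_)
        · simp only [glue_of_notMem _ _ (hA v v.2), glue_of_mem _ _ v.2]
        · simp only [glue_of_mem _ _ v.2] }
  refine Fintype.sum_equiv E _ _ fun ξ => ?_
  congr 1
  funext v
  by_cases hv : v ∈ B
  · rw [glue_of_mem _ _ hv, glue_of_mem _ _ (Finset.mem_union_right _ hv)]; rfl
  · rw [glue_of_notMem _ _ hv]
    by_cases hv' : v ∈ A
    · rw [glue_of_mem _ _ hv', glue_of_mem _ _ (Finset.mem_union_left _ hv')]; rfl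
    · rw [glue_of_notMem _ _ hv', glue_of_notMem _ _ (by simp [hv, hv'])]

lemma sum_glue_image {r : ℤ} (Λ : Finset (Surv r)) (F : (Surv r → Fin q) → ℝ)
    (σ : ℤ × ℤ → Fin q) :
    ∑ η : ↥(Λ.image Subtype.val) → Fin q,
      F (restr (glue (Λ.image Subtype.val) η σ)) =
      ∑ ζ : Λ → Fin q, F (glue Λ ζ (restr σ)) := by
  have hmem : ∀ v ∈ Λ.image Subtype.val, ∃ h : ¬ IsCentre r v, (⟨v, h⟩ : Surv r) ∈ Λ := by
    intro v hv
    obtain ⟨x, hx, rfl⟩ := Finset.mem_image.1 hv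
    exact ⟨x.2, hx⟩
  refine Fintype.sum_equiv
    { toFun := fun η x => η ⟨x.1.1, Finset.mem_image_of_mem _ x.2⟩
      invFun := fun ζ v => ζ ⟨⟨v.1, (hmem v.1 v.2).1⟩, (hmem v.1 v.2).2⟩
      left_inv := fun _ => rfl
      right_inv := fun _ => rfl } _ _ fun η => ?_
  congr 1
  funext x
  by_cases hx : x ∈ Λ
  · rw [glue_of_mem _ _ hx, restr, glue_of_mem _ _ (Finset.mem_image_of_mem _ hx)]; rfl
  · rw [glue_of_notMem _ _ hx, restr, glue_of_notMem _ _ fun h => hx (hmem _ h).2]; rfl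

lemma disjoint_image_centres {r : ℤ} (Λ : Finset (Surv r)) :
    Disjoint (Λ.image Subtype.val) (centres r Λ) :=
  Finset.disjoint_left.2 fun v hv hc => by
    obtain ⟨x, -, rfl⟩ := Finset.mem_image.1 hv
    exact x.2 (isCentre_of_mem_centres hc)

lemma restr_glue_centres {r : ℤ} (Λ : Finset (Surv r)) (s : centres r Λ → Fin q)
    (σ : ℤ × ℤ → Fin q) : restr (r := r) (glue (centres r Λ) s σ) = restr σ :=
  funext fun x => glue_centres_surv Λ s σ x.2

lemma sum_triWeight_mul {r : ℤ} (Λ : Finset (Surv r)) (f : (Surv r → Fin q) → ℝ)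
    (σ : ℤ × ℤ → Fin q) :
    ∑ ξ : ↥(Λ.image Subtype.val ∪ centres r Λ) → Fin q,
      triWeight q (Λ.image Subtype.val ∪ centres r Λ)
        (glue (Λ.image Subtype.val ∪ centres r Λ) ξ σ) *
          f (restr (glue (Λ.image Subtype.val ∪ centres r Λ) ξ σ)) =
      ∑ ζ : Λ → Fin q, decWeight q r Λ (glue Λ ζ (restr σ)) * f (glue Λ ζ (restr σ)) := by
  rw [sum_glue_union (disjoint_image_centres Λ) (fun τ =>
    triWeight q (Λ.image Subtype.val ∪ centres r Λ) τ * f (restr τ)),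
    ← sum_glue_image Λ (fun t => decWeight q r Λ t * f t)]
  refine Finset.sum_congr rfl fun η _ => ?_
  simp only [restr_glue_centres]
  rw [← Finset.sum_mul, sum_triWeight]

/-- Summing out the centres in both the numerator and the partition function turns the triangular
kernel on observables of the survivors into the decimated one, so the DLR equations descend. -/
lemma avg_decWeight_restr {r : ℤ} (Λ : Finset (Surv r)) (f : (Surv r → Fin q) → ℝ)
    (σ : ℤ × ℤ → Fin q) :
    avg (decWeight q r) Λ f (restr σ) =
      avg (triWeight q) (Λ.image Subtype.val ∪ centres r Λ) (fun τ => f (restr τ)) σ := by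
  have h1 := sum_triWeight_mul Λ f σ
  have h2 := sum_triWeight_mul Λ (fun _ => 1) σ
  simp only [mul_one] at h2
  simp only [avg, kernel, div_mul_eq_mul_div]
  rw [← Finset.sum_div, ← Finset.sum_div, h1, partition, partition, h2]

lemma continuous_restr {r : ℤ} : Continuous (restr (q := q) (r := r)) :=
  continuous_pi fun x => continuous_apply x.1

/-- The restriction of a Gibbs measure to the surviving sites is Gibbs for the decimated model. -/
theorem IsGibbs.map_restr (hq : 7 ≤ q) {r : ℤ} {μ : Measure (ℤ × ℤ → Fin q)}
    (hμ : IsGibbs (triWeight q) μ) : IsGibbs (decWeight q r) (μ.map restr) := by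
  have : NeZero q := ⟨by omega⟩
  have := hμ.1
  have hm : Measurable (restr (q := q) (r := r)) := continuous_restr.measurable
  have : IsProbabilityMeasure (μ.map (restr (r := r))) :=
    Measure.isProbabilityMeasure_map hm.aemeasurable
  have hW := decWeight_regular hq r
  refine isGibbs_of_integral_avg hW fun Λ f hf => ?_
  rw [integral_map hm.aemeasurable (hW.continuous_avg Λ hf).measurable.aestronglyMeasurable,
    integral_map hm.aemeasurable hf.measurable.aestronglyMeasurable]
  simp only [avg_decWeight_restr]
  exact hμ.integral_avg (triWeight_regular hq) _ (hf.comp continuous_restr)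

end Models

end Potts

open scoped MeasureTheory

namespace Potts

set_option linter.unusedSectionVars false

/-! ### Recovering the triangular model from its decimation. -/

section Decimation

open MeasureTheory

variable {q : ℕ}

lemma siteKernel_triWeight_congr {c : ℤ × ℤ} {σ τ : ℤ × ℤ → Fin q}
    (h : ∀ v ∈ nbrs c, σ v = τ v) : siteKernel (triWeight q) c σ = siteKernel (triWeight q) c τ := by
  have key : ∀ a, triWeight q {c} (Function.update σ c a) =
      triWeight q {c} (Function.update τ c a) := by
    intro a
    have : (∀ x ∈ ({c} : Finset (ℤ × ℤ)), ∀ y, y ∈ nbrs x →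
        Function.update σ c a x ≠ Function.update σ c a y) ↔
        ∀ x ∈ ({c} : Finset (ℤ × ℤ)), ∀ y, y ∈ nbrs x →
        Function.update τ c a x ≠ Function.update τ c a y := by
      refine forall₂_congr fun x hx => forall₂_congr fun y hy => ?_
      obtain rfl := Finset.mem_singleton.1 hx
      have hyx : y ≠ x := fun e => not_mem_nbrs_self x (e ▸ hy)
      rw [Function.update_self, Function.update_self, Function.update_of_ne hyx,
        Function.update_of_ne hyx, h y hy]
    by_cases hτ : ∀ x ∈ ({c} : Finset (ℤ × ℤ)), ∀ y, y ∈ nbrs x →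
        Function.update τ c a x ≠ Function.update τ c a y
    · exact (exclusion_eq_one (this.2 hτ)).trans (exclusion_eq_one hτ).symm
    · exact (exclusion_eq_zero fun h => hτ (this.1 h)).trans (exclusion_eq_zero hτ).symm
  funext a
  rw [siteKernel_eq, siteKernel_eq, key]
  simp only [key]

/-- The trivial bound 1 on the Dobrushin coefficient suffices, since each centre is averaged only
once. -/
lemma osc_avg_triWeight_le_add (hq : 7 ≤ q) {f : (ℤ × ℤ → Fin q) → ℝ} (hf : Continuous f)
    {c v : ℤ × ℤ} (h : v ≠ c) : osc (avg (triWeight q) {c} f) v ≤ osc f v + osc f c := by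
  have : NeZero q := ⟨by omega⟩
  have hW := triWeight_regular hq
  refine (hW.osc_avg_le hf h).trans (add_le_add le_rfl ?_)
  refine mul_le_of_le_one_left (osc_nonneg _ _) (dobrushinCoeff_le zero_le_one fun σ τ _ => ?_)
  exact hW.tvDist_siteKernel_le_one c σ τ

lemma osc_avg_triWeight_le (hq : 7 ≤ q) {f : (ℤ × ℤ → Fin q) → ℝ} (hf : Continuous f)
    {c v : ℤ × ℤ} (h : v ∉ nbrs c) : osc (avg (triWeight q) {c} f) v ≤ osc f v := by
  have : NeZero q := ⟨by omega⟩
  by_cases hvc : v = c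
  · subst hvc; rw [osc_avg_self]; exact osc_nonneg _ _
  refine ((triWeight_regular hq).osc_avg_le hf hvc).trans ?_
  have h0 : dobrushinCoeff (triWeight q) c v = 0 :=
    dobrushinCoeff_eq_zero fun σ τ hst => siteKernel_triWeight_congr fun k hk =>
      hst k fun e => h (e ▸ hk)
  rw [h0, zero_mul, add_zero]

/-- Averaging over the spins of finitely many decimated sites. -/
lemma exists_avg_centres (hq : 7 ≤ q) {r : ℤ} {f : (ℤ × ℤ → Fin q) → ℝ} (hf : Continuous f)
    (D : Finset (ℤ × ℤ)) (hD : ∀ c ∈ D, IsCentre r c) :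
    ∃ h : (ℤ × ℤ → Fin q) → ℝ, Continuous h ∧ (∀ c ∈ D, osc h c = 0) ∧
      (∀ c, IsCentre r c → osc h c ≤ osc f c) ∧
      (∀ v, osc h v ≤ osc f v + ∑ c ∈ D, if c ∈ nbrs v then osc f c else 0) ∧
      ∀ μ : Measure (ℤ × ℤ → Fin q), IsGibbs (triWeight q) μ → ∫ σ, h σ ∂μ = ∫ σ, f σ ∂μ ∧
        ∀ g : (ℤ × ℤ → Fin q) → ℝ, Continuous g →
          |cov μ f g - cov μ h g| ≤ ∑ c ∈ D, osc f c * osc g c := by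
  have : NeZero q := ⟨by omega⟩
  have hW := triWeight_regular hq
  induction D using Finset.induction_on with
  | empty => exact ⟨f, hf, by simp, fun _ _ => le_rfl, by simp, fun μ _ => ⟨rfl, by simp⟩⟩
  | insert c D hc ih =>
    obtain ⟨h, hh, h0, h1, h2, h3⟩ := ih fun c hc => hD c (Finset.mem_insert_of_mem hc)
    have hcc : IsCentre r c := hD c (Finset.mem_insert_self c D)
    have hnot : ∀ c', IsCentre r c' → c' ∉ nbrs c := fun c' hc' hm =>
      not_isCentre_of_mem_nbrs hcc hm hc'
    -- Centres are averaged one at a time. The kernel at `c` depends only on neighbours of `c`, none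
    -- of which is a centre, so oscillations already removed at other centres do not return.
    refine ⟨avg (triWeight q) {c} h, hW.continuous_avg _ hh, fun c' hc' => ?_, fun c' hc' => ?_,
      fun v => ?_, fun μ hμ => ⟨(hμ.integral_avg hW _ hh).trans (h3 μ hμ).1, fun g hg => ?_⟩⟩
    · rcases Finset.mem_insert.1 hc' with rfl | hc'D
      · exact osc_avg_self h c'
      · refine le_antisymm ?_ (osc_nonneg _ _)
        rw [← h0 c' hc'D]
        exact osc_avg_triWeight_le hq hh (hnot c' (hD c' hc'))
    · exact (osc_avg_triWeight_le hq hh (hnot c' hc')).trans (h1 c' hc')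
    · rw [Finset.sum_insert hc]
      by_cases hv : c ∈ nbrs v
      · rw [if_pos hv]
        have hvc : v ≠ c := fun e => not_mem_nbrs_self c (e ▸ hv)
        have := osc_avg_triWeight_le_add hq hh hvc
        linarith [h1 c hcc, h2 v]
      · rw [if_neg hv, zero_add]
        exact (osc_avg_triWeight_le hq hh fun e => hv (nbrs_symm.1 e)).trans (h2 v)
    · rw [Finset.sum_insert hc]
      have e1 := (h3 μ hμ).2 g hg
      have e2 := hμ.abs_cov_sub_cov_avg_le hW hh hg c
      have e3 := mul_le_mul_of_nonneg_right (h1 c hcc) (osc_nonneg g c)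
      have e4 := abs_sub_le (cov μ f g) (cov μ h g) (cov μ (avg (triWeight q) {c} h) g)
      linarith

/-- The displacements to a site and its neighbours. -/
@[irreducible] def offsets : Finset (ℤ × ℤ) := insert 0 (nbrs 0)

/-- The sum of `a` over a site and its neighbours. -/
noncomputable def localSum (a : ℤ × ℤ → ℝ) (v : ℤ × ℤ) : ℝ := ∑ d ∈ offsets, a (v + d)

/-- Neighbourhoods are translates of one finite set, so the oscillations produced by averaging are
dominated, uniformly in `D`, by a finite sum of translates. -/
lemma sum_ite_nbrs_le_localSum {a : ℤ × ℤ → ℝ} (ha : ∀ v, 0 ≤ a v) (D : Finset (ℤ × ℤ))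
    (v : ℤ × ℤ) : a v + ∑ c ∈ D, (if c ∈ nbrs v then a c else 0) ≤ localSum a v := by
  rw [localSum, offsets, Finset.sum_insert (not_mem_nbrs_self 0), add_zero]
  refine add_le_add le_rfl ?_
  rw [← Finset.sum_filter]
  have : ∑ d ∈ nbrs 0, a (v + d) = ∑ c ∈ (nbrs 0).image (v + ·), a c :=
    (Finset.sum_image fun x _ y _ h => add_left_cancel h).symm
  rw [this]
  refine Finset.sum_le_sum_of_subset_of_nonneg (fun c hc => ?_) fun c _ _ => ha c
  refine Finset.mem_image.2 ⟨c - v, ?_, by simp⟩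
  have := (Finset.mem_filter.1 hc).2
  simp only [mem_nbrs, Prod.fst_sub, Prod.snd_sub, Prod.fst_zero, Prod.snd_zero] at *
  omega

lemma le_localSum {a : ℤ × ℤ → ℝ} (ha : ∀ v, 0 ≤ a v) (v : ℤ × ℤ) : a v ≤ localSum a v := by
  simpa using sum_ite_nbrs_le_localSum ha ∅ v

lemma summable_localSum {a : ℤ × ℤ → ℝ} (ha : Summable a) : Summable (localSum a) :=
  summable_sum fun d _ => (Equiv.addRight d).summable_iff.2 ha

/-- The configuration in which the spins of the decimated sites are forgotten. -/
def forget (r : ℤ) [NeZero q] (σ : ℤ × ℤ → Fin q) : ℤ × ℤ → Fin q :=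
  fun v => if IsCentre r v then 0 else σ v

/-- Extension of a configuration on the surviving sites by a constant. -/
def extend {r : ℤ} [NeZero q] (t : Surv r → Fin q) : ℤ × ℤ → Fin q :=
  fun v => if h : IsCentre r v then 0 else t ⟨v, h⟩

lemma extend_restr {r : ℤ} [NeZero q] (σ : ℤ × ℤ → Fin q) :
    extend (r := r) (restr σ) = forget r σ := by
  funext v; by_cases h : IsCentre r v <;> simp [extend, forget, restr, h]

lemma continuous_extend {r : ℤ} [NeZero q] : Continuous (extend (q := q) (r := r)) := by
  refine continuous_pi fun v => ?_
  by_cases h : IsCentre r v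
  · simp only [extend, dif_pos h]; exact continuous_const
  · simp only [extend, dif_neg h]; exact continuous_apply _

lemma osc_comp_extend_le {r : ℤ} [NeZero q] {h : (ℤ × ℤ → Fin q) → ℝ} (hh : Continuous h)
    (j : Surv r) : osc (fun t : Surv r → Fin q => h (extend t)) j ≤ osc h j.1 := by
  refine osc_le (osc_nonneg _ _) fun s t hst => abs_sub_le_osc hh fun v hv => ?_
  by_cases hc : IsCentre r v
  · simp [extend, hc]
  · simp only [extend, hc, dite_false]
    exact hst _ fun e => hv (congrArg Subtype.val e)

lemma continuous_forget {r : ℤ} [NeZero q] : Continuous (forget (q := q) r) := by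
  have : forget (q := q) r = fun σ => extend (r := r) (restr σ) :=
    funext fun σ => (extend_restr σ).symm
  rw [this]; exact continuous_extend.comp continuous_restr

/-- Forgetting alters only centres: those in `D` no longer matter to `h`, and the others cost at
most the tail of the oscillations of `f`. -/
lemma abs_sub_forget_le {r : ℤ} [NeZero q] {f h : (ℤ × ℤ → Fin q) → ℝ} (hh : Continuous h)
    (hs : Summable (osc f)) (hhs : Summable (osc h)) (D : Finset (ℤ × ℤ))
    (h0 : ∀ c ∈ D, IsCentre r c → osc h c = 0) (h1 : ∀ c, IsCentre r c → osc h c ≤ osc f c)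
    (σ : ℤ × ℤ → Fin q) :
    |h σ - h (forget r σ)| ≤ ∑' v, osc f v - ∑ v ∈ D, osc f v := by
  have hle : ∀ v, (if forget r σ v = σ v then 0 else osc h v) ≤
      osc f v - if v ∈ D then osc f v else 0 := fun v => by
    by_cases hc : IsCentre r v
    · by_cases hv : v ∈ D
      · simp [h0 v hv hc, hv]
      · rw [if_neg hv, sub_zero]
        split_ifs
        exacts [osc_nonneg _ _, h1 v hc]
    · rw [if_pos (by simp [forget, hc])]
      split_ifs
      · simp
      · simpa using osc_nonneg f v
  have hsum : HasSum (fun v => if v ∈ D then osc f v else 0) (∑ v ∈ D, osc f v) := by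
    rw [Finset.sum_congr rfl fun v hv => (if_pos hv : (if v ∈ D then osc f v else 0) = _).symm]
    exact hasSum_sum_of_ne_finset_zero fun v hv => if_neg hv
  refine (abs_sub_le_tsum_ite_osc hh hhs _ _).trans ?_
  rw [← hsum.tsum_eq, ← hs.tsum_sub hsum.summable]
  refine Summable.tsum_le_tsum hle (Summable.of_nonneg_of_le (fun v => ?_) (fun v => ?_) hhs)
    (hs.sub hsum.summable)
  · split_ifs; exacts [le_rfl, osc_nonneg _ _]
  · split_ifs; exacts [osc_nonneg _ _, le_rfl]

lemma tendsto_tsum_sub_sum {a : ℤ × ℤ → ℝ} (ha : Summable a) :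
    Filter.Tendsto (fun D : Finset (ℤ × ℤ) => ∑' v, a v - ∑ v ∈ D, a v) Filter.atTop (nhds 0) := by
  have := (tendsto_const_nhds (x := ∑' v, a v)).sub ha.hasSum
  rwa [sub_self] at this

lemma integral_comp_forget {r : ℤ} [NeZero q] {h : (ℤ × ℤ → Fin q) → ℝ} (hh : Continuous h)
    (μ : Measure (ℤ × ℤ → Fin q)) :
    ∫ σ, h (forget r σ) ∂μ = ∫ t, h (extend t) ∂(μ.map (restr (r := r))) := by
  have hc : Continuous fun t : Surv r → Fin q => h (extend t) := hh.comp continuous_extend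
  rw [integral_map continuous_restr.measurable.aemeasurable hc.measurable.aestronglyMeasurable]
  simp only [extend_restr]

/-- A Gibbs measure on the triangular lattice is determined by its decimation. -/
theorem IsGibbs.eq_of_map_restr_eq (hq : 7 ≤ q) {r : ℤ} {μ ν : Measure (ℤ × ℤ → Fin q)}
    (hμ : IsGibbs (triWeight q) μ) (hν : IsGibbs (triWeight q) ν)
    (h : μ.map (restr (r := r)) = ν.map (restr (r := r))) : μ = ν := by
  have : NeZero q := ⟨by omega⟩
  have := hμ.1
  have := hν.1
  refine measure_ext_of_summable_osc fun f hf hs => ?_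
  -- Averaging over the centres in `D` preserves both integrals. The forgetful version then has
  -- equal integrals by hypothesis, at the price of one tail for each measure.
  have key : ∀ D : Finset (ℤ × ℤ), |∫ σ, f σ ∂μ - ∫ σ, f σ ∂ν| ≤
      2 * (∑' v, osc f v - ∑ v ∈ D, osc f v) := by
    intro D
    obtain ⟨g, hg, h0, h1, h2, h3⟩ := exists_avg_centres hq (r := r) hf (D.filter (IsCentre r))
      fun c hc => (Finset.mem_filter.1 hc).2
    have hgs : Summable (osc g) := Summable.of_nonneg_of_le (osc_nonneg g)
      (fun v => (h2 v).trans (sum_ite_nbrs_le_localSum (osc_nonneg f) _ v)) (summable_localSum hs)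
    have hb := abs_sub_forget_le (r := r) hg hs hgs D
      (fun c hc hcc => h0 c (Finset.mem_filter.2 ⟨hc, hcc⟩)) h1
    have hint : ∀ ρ : Measure (ℤ × ℤ → Fin q), IsProbabilityMeasure ρ →
        |∫ σ, g σ ∂ρ - ∫ σ, g (forget r σ) ∂ρ| ≤ ∑' v, osc f v - ∑ v ∈ D, osc f v := by
      intro ρ hρ
      have hgc : Continuous fun σ => g (forget r σ) := hg.comp continuous_forget
      rw [← integral_sub (integrable_of_continuous hg) (integrable_of_continuous hgc)]
      simpa using norm_integral_le_of_norm_le_const (μ := ρ)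
        (f := fun σ => g σ - g (forget r σ)) (Filter.Eventually.of_forall hb)
    have e1 := hint μ inferInstance
    have e2 := hint ν inferInstance
    have e3 : ∫ σ, g (forget r σ) ∂μ = ∫ σ, g (forget r σ) ∂ν := by
      rw [integral_comp_forget hg, integral_comp_forget hg, h]
    rw [← (h3 μ hμ).1, ← (h3 ν hν).1]
    rw [← e3, abs_sub_comm] at e2
    have := abs_sub_le (∫ σ, g σ ∂μ) (∫ σ, g (forget r σ) ∂μ) (∫ σ, g σ ∂ν)
    linarith
  have hlim := (tendsto_tsum_sub_sum hs).const_mul 2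
  rw [mul_zero] at hlim
  exact sub_eq_zero.1 (abs_nonpos_iff.1 (ge_of_tendsto' hlim key))

/-- A covariance is unchanged when `k` is centred at its mean, from which it deviates by at most B.
-/
lemma abs_cov_le {V : Type*} [DecidableEq V] [Countable V] {μ : Measure (V → Fin q)}
    [IsProbabilityMeasure μ] {φ k : (V → Fin q) → ℝ} (hφ : Continuous φ) (hk : Continuous k)
    {ε B : ℝ} (h1 : ∀ σ, |φ σ| ≤ ε) (h2 : ∀ σ τ, |k σ - k τ| ≤ B) : |cov μ φ k| ≤ ε * B := by
  have i1 : Continuous fun σ => φ σ * k σ := hφ.mul hk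
  have e : cov μ φ k = ∫ σ, φ σ * (k σ - ∫ τ, k τ ∂μ) ∂μ := by
    simp only [mul_sub]
    rw [integral_sub (integrable_of_continuous i1)
      ((integrable_of_continuous hφ).mul_const _), integral_mul_const, cov]
  have h3 : ∀ σ, |k σ - ∫ τ, k τ ∂μ| ≤ B := fun σ => by
    have : k σ - ∫ τ, k τ ∂μ = ∫ τ, (k σ - k τ) ∂μ := by
      rw [integral_sub (integrable_const _) (integrable_of_continuous hk)]; simp
    rw [this]
    simpa using norm_integral_le_of_norm_le_const (μ := μ) (f := fun τ => k σ - k τ)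
      (Filter.Eventually.of_forall (h2 σ))
  rw [e]
  simpa using norm_integral_le_of_norm_le_const (μ := μ) (C := ε * B)
    (f := fun σ => φ σ * (k σ - ∫ τ, k τ ∂μ)) (Filter.Eventually.of_forall fun σ => by
      rw [Real.norm_eq_abs, abs_mul]
      exact mul_le_mul (h1 σ) (h3 σ) (abs_nonneg _) ((abs_nonneg _).trans (h1 σ)))

lemma cov_sub_left {V : Type*} [DecidableEq V] [Countable V] {μ : Measure (V → Fin q)}
    [IsProbabilityMeasure μ] {f g k : (V → Fin q) → ℝ} (hf : Continuous f) (hg : Continuous g)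
    (hk : Continuous k) : cov μ (fun σ => f σ - g σ) k = cov μ f k - cov μ g k := by
  have i1 : Continuous fun σ => f σ * k σ := hf.mul hk
  have i2 : Continuous fun σ => g σ * k σ := hg.mul hk
  simp only [cov, sub_mul]
  rw [integral_sub (integrable_of_continuous i1) (integrable_of_continuous i2),
    integral_sub (integrable_of_continuous hf) (integrable_of_continuous hg)]
  ring

section DoubleSum

variable {V : Type*} [PseudoMetricSpace V] {m : ℝ} {a b : V → ℝ}

lemma exp_neg_mul_dist_le_one (hm : 0 < m) (i j : V) : Real.exp (-m * dist i j) ≤ 1 := by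
  rw [Real.exp_le_one_iff]
  have := dist_nonneg (x := i) (y := j)
  nlinarith

lemma summable_exp_double (hm : 0 < m) (ha : ∀ i, 0 ≤ a i) (hb : ∀ i, 0 ≤ b i)
    (has : Summable a) (hbs : Summable b) :
    Summable fun p : V × V => a p.1 * Real.exp (-m * dist p.1 p.2) * b p.2 := by
  refine Summable.of_nonneg_of_le (fun p => mul_nonneg (mul_nonneg (ha _) (Real.exp_pos _).le)
    (hb _)) (fun p => ?_) (has.mul_of_nonneg hbs ha hb)
  exact mul_le_mul_of_nonneg_right (mul_le_of_le_one_right (ha _)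
    (exp_neg_mul_dist_le_one hm _ _)) (hb _)

lemma tsum_exp_double (hm : 0 < m) (ha : ∀ i, 0 ≤ a i) (hb : ∀ i, 0 ≤ b i)
    (has : Summable a) (hbs : Summable b) :
    ∑' i, ∑' j, a i * Real.exp (-m * dist i j) * b j =
      ∑' p : V × V, a p.1 * Real.exp (-m * dist p.1 p.2) * b p.2 :=
  (summable_exp_double hm ha hb has hbs).tsum_prod.symm

end DoubleSum

/-- Each offset has sup norm at most 1; this is the source of the factor exp(2m) below. -/
lemma dist_add_offsets_le {d d' : ℤ × ℤ} (hd : d ∈ offsets) (hd' : d' ∈ offsets) (i j : ℤ × ℤ) :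
    dist (i + d) (j + d') ≤ dist i j + 2 := by
  have h0 : ∀ d ∈ offsets, ‖d‖ ≤ 1 := by
    intro d hd
    have h : |d.1| ≤ 1 ∧ |d.2| ≤ 1 := by
      simp only [offsets, Finset.mem_insert, mem_nbrs, Prod.ext_iff, Prod.fst_zero,
        Prod.snd_zero] at hd
      constructor <;> rw [abs_le] <;> omega
    rw [Prod.norm_def, Int.norm_eq_abs, Int.norm_eq_abs]
    exact max_le (by exact_mod_cast h.1) (by exact_mod_cast h.2)
  have h1 : i + d - (j + d') = (i - j) + (d - d') := by abel
  rw [dist_eq_norm, dist_eq_norm, h1]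
  have h2 := norm_add_le (i - j) (d - d')
  have h3 := norm_sub_le d d'
  linarith [h0 d hd, h0 d' hd']

section Shift

variable {m : ℝ} {a b : ℤ × ℤ → ℝ}

lemma summable_exp_shift (hm : 0 < m) (ha : ∀ i, 0 ≤ a i) (hb : ∀ i, 0 ≤ b i)
    (has : Summable a) (hbs : Summable b) (d d' : ℤ × ℤ) :
    Summable fun p : (ℤ × ℤ) × (ℤ × ℤ) =>
      a (p.1 + d) * Real.exp (-m * dist p.1 p.2) * b (p.2 + d') :=
  summable_exp_double (a := fun i => a (i + d)) (b := fun i => b (i + d')) hm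
    (fun i => ha (i + d)) (fun i => hb (i + d'))
    ((Equiv.addRight d).summable_iff.2 has) ((Equiv.addRight d').summable_iff.2 hbs)

lemma tsum_exp_shift_le (hm : 0 < m) (ha : ∀ i, 0 ≤ a i) (hb : ∀ i, 0 ≤ b i)
    (has : Summable a) (hbs : Summable b) {d d' : ℤ × ℤ} (hd : d ∈ offsets) (hd' : d' ∈ offsets) :
    ∑' p : (ℤ × ℤ) × (ℤ × ℤ), a (p.1 + d) * Real.exp (-m * dist p.1 p.2) * b (p.2 + d') ≤
      Real.exp (2 * m) *
        ∑' p : (ℤ × ℤ) × (ℤ × ℤ), a p.1 * Real.exp (-m * dist p.1 p.2) * b p.2 := by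
  have hinj : Function.Injective fun p : (ℤ × ℤ) × (ℤ × ℤ) => (p.1 + d, p.2 + d') := fun p p' h =>
    Prod.ext (add_right_cancel (congrArg Prod.fst h)) (add_right_cancel (congrArg Prod.snd h))
  have hS := (summable_exp_double hm ha hb has hbs).mul_left (Real.exp (2 * m))
  rw [← tsum_mul_left]
  refine (summable_exp_shift hm ha hb has hbs d d').tsum_le_tsum_of_inj
    (fun p => (p.1 + d, p.2 + d')) hinj (fun p _ => mul_nonneg (Real.exp_pos _).le
      (mul_nonneg (mul_nonneg (ha _) (Real.exp_pos _).le) (hb _))) (fun p => ?_) hS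
  have h1 : Real.exp (-m * dist p.1 p.2) ≤
      Real.exp (2 * m) * Real.exp (-m * dist (p.1 + d) (p.2 + d')) := by
    rw [← Real.exp_add, Real.exp_le_exp]
    have := dist_add_offsets_le hd hd' p.1 p.2
    nlinarith
  have h2 := mul_le_mul_of_nonneg_right (mul_le_mul_of_nonneg_left h1 (ha (p.1 + d)))
    (hb (p.2 + d'))
  simp only
  linarith

end Shift

/-- Smearing the oscillations over neighbouring sites costs only a constant. -/
lemma tsum_exp_localSum_le {m : ℝ} (hm : 0 < m) {a b : ℤ × ℤ → ℝ} (ha : ∀ i, 0 ≤ a i)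
    (hb : ∀ i, 0 ≤ b i) (has : Summable a) (hbs : Summable b) :
    ∑' p : (ℤ × ℤ) × (ℤ × ℤ), localSum a p.1 * Real.exp (-m * dist p.1 p.2) * localSum b p.2 ≤
      offsets.card * offsets.card * Real.exp (2 * m) *
        ∑' p : (ℤ × ℤ) × (ℤ × ℤ), a p.1 * Real.exp (-m * dist p.1 p.2) * b p.2 := by
  have hS := summable_exp_double hm ha hb has hbs
  have e : ∀ p : (ℤ × ℤ) × (ℤ × ℤ),
      localSum a p.1 * Real.exp (-m * dist p.1 p.2) * localSum b p.2 =
      ∑ d ∈ offsets, ∑ d' ∈ offsets,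
        a (p.1 + d) * Real.exp (-m * dist p.1 p.2) * b (p.2 + d') := fun p => by
    rw [localSum, localSum, Finset.sum_mul, Finset.sum_mul]
    exact Finset.sum_congr rfl fun d _ => by rw [Finset.mul_sum]
  have hs1 := fun d d' => summable_exp_shift hm ha hb has hbs d d'
  have hle := fun d hd d' hd' => tsum_exp_shift_le hm ha hb has hbs (d := d) (d' := d') hd hd'
  simp only [e]
  rw [Summable.tsum_finsetSum fun d _ => summable_sum fun d' _ => hs1 d d']
  calc _ ≤ ∑ d ∈ offsets, ∑ d' ∈ offsets, Real.exp (2 * m) *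
        ∑' p : (ℤ × ℤ) × (ℤ × ℤ), a p.1 * Real.exp (-m * dist p.1 p.2) * b p.2 :=
        Finset.sum_le_sum fun d hd => by
          rw [Summable.tsum_finsetSum fun d' _ => hs1 d d']
          exact Finset.sum_le_sum fun d' hd' => hle d hd d' hd'
    _ = _ := by simp only [Finset.sum_const, nsmul_eq_mul]; ring

/-- Exponential decay of correlations is inherited from the decimated model. -/
theorem IsGibbs.expDecay_of_map_restr (hq : 7 ≤ q) {r : ℤ} {μ : Measure (ℤ × ℤ → Fin q)}
    (hμ : IsGibbs (triWeight q) μ) (h : ExpDecay (μ.map (restr (r := r)))) : ExpDecay μ := by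
  have : NeZero q := ⟨by omega⟩
  have := hμ.1
  obtain ⟨K, m, hm, hK⟩ := h
  refine ⟨1 + |K| * (offsets.card * offsets.card * Real.exp (2 * m)), m, hm,
    fun f g hf hg hfs hgs => ?_⟩
  change |cov μ f g| ≤ _
  rw [tsum_exp_double hm (osc_nonneg f) (osc_nonneg g) hfs hgs]
  set S := ∑' p : (ℤ × ℤ) × (ℤ × ℤ), osc f p.1 * Real.exp (-m * dist p.1 p.2) * osc g p.2 with hS
  have hlf := summable_localSum hfs
  have hlg := summable_localSum hgs
  have hlf0 : ∀ v, 0 ≤ localSum (osc f) v := fun v =>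
    (osc_nonneg f v).trans (le_localSum (osc_nonneg f) v)
  have hlg0 : ∀ v, 0 ≤ localSum (osc g) v := fun v =>
    (osc_nonneg g v).trans (le_localSum (osc_nonneg g) v)
  have hSs := summable_exp_double hm (osc_nonneg f) (osc_nonneg g) hfs hgs
  have hSnn : ∀ p : (ℤ × ℤ) × (ℤ × ℤ),
      0 ≤ osc f p.1 * Real.exp (-m * dist p.1 p.2) * osc g p.2 := fun p =>
    mul_nonneg (mul_nonneg (osc_nonneg _ _) (Real.exp_pos _).le) (osc_nonneg _ _)
  set εf : Finset (ℤ × ℤ) → ℝ := fun D => ∑' v, osc f v - ∑ v ∈ D, osc f v with hεf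
  set εg : Finset (ℤ × ℤ) → ℝ := fun D => ∑' v, osc g v - ∑ v ∈ D, osc g v with hεg
  have key : ∀ D : Finset (ℤ × ℤ), |cov μ f g| ≤
      (1 + |K| * (offsets.card * offsets.card * Real.exp (2 * m))) * S +
        (εf D * (∑' v, localSum (osc g) v) + εg D * ∑' v, localSum (osc f) v) := by
    intro D
    set D' := D.filter (IsCentre r)
    have hD' : ∀ c ∈ D', IsCentre r c := fun c hc => (Finset.mem_filter.1 hc).2
    obtain ⟨φ, hφ, φ0, φ1, φ2, φ3⟩ := exists_avg_centres hq (r := r) hf D' hD'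
    obtain ⟨γ, hγ, γ0, γ1, γ2, γ3⟩ := exists_avg_centres hq (r := r) hg D' hD'
    have φl : ∀ v, osc φ v ≤ localSum (osc f) v := fun v =>
      (φ2 v).trans (sum_ite_nbrs_le_localSum (osc_nonneg f) _ v)
    have γl : ∀ v, osc γ v ≤ localSum (osc g) v := fun v =>
      (γ2 v).trans (sum_ite_nbrs_le_localSum (osc_nonneg g) _ v)
    have φs : Summable (osc φ) := Summable.of_nonneg_of_le (osc_nonneg φ) φl hlf
    have γs : Summable (osc γ) := Summable.of_nonneg_of_le (osc_nonneg γ) γl hlg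
    have φb := abs_sub_forget_le (r := r) hφ hfs φs D
      (fun c hc hcc => φ0 c (Finset.mem_filter.2 ⟨hc, hcc⟩)) φ1
    have γb := abs_sub_forget_le (r := r) hγ hgs γs D
      (fun c hc hcc => γ0 c (Finset.mem_filter.2 ⟨hc, hcc⟩)) γ1
    have hφ' : Continuous fun σ => φ (forget r σ) := hφ.comp continuous_forget
    have hγ' : Continuous fun σ => γ (forget r σ) := hγ.comp continuous_forget
    -- The cost of averaging the centres in `f` is a sum of diagonal terms, part of `S` because the
    -- exponential weight at distance zero is 1.
    have h1 : |cov μ f g - cov μ φ g| ≤ S := by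
      refine ((φ3 μ hμ).2 g hg).trans ?_
      have hinj : Function.Injective fun v : ℤ × ℤ => (v, v) := fun v w h => congrArg Prod.fst h
      have hd := hSs.comp_injective hinj
      have hde : ∀ v, ((fun p : (ℤ × ℤ) × (ℤ × ℤ) =>
          osc f p.1 * Real.exp (-m * dist p.1 p.2) * osc g p.2) ∘ fun v => (v, v)) v =
          osc f v * osc g v := fun v => by simp
      calc ∑ c ∈ D', osc f c * osc g c ≤ ∑' v, osc f v * osc g v :=
            Summable.sum_le_tsum D' (fun v _ => mul_nonneg (osc_nonneg _ _) (osc_nonneg _ _))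
              (hd.congr hde)
        _ = ∑' v, ((fun p : (ℤ × ℤ) × (ℤ × ℤ) =>
          osc f p.1 * Real.exp (-m * dist p.1 p.2) * osc g p.2) ∘ fun v => (v, v)) v :=
            tsum_congr fun v => (hde v).symm
        _ ≤ S := hd.tsum_le_tsum_of_inj (fun v => (v, v)) hinj (fun p _ => hSnn p)
            (fun v => le_rfl) hSs
    -- Averaging the second factor is free, because φ no longer oscillates at the averaged centres.
    have h2 : cov μ φ g = cov μ φ γ := by
      have := (γ3 μ hμ).2 φ hφ
      rw [Finset.sum_eq_zero fun c hc => by rw [φ0 c hc, mul_zero]] at this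
      rw [cov_comm, cov_comm μ φ]
      exact sub_eq_zero.1 (abs_nonpos_iff.1 this)
    have h3 : |cov μ φ γ - cov μ (fun σ => φ (forget r σ)) γ| ≤
        εf D * ∑' v, localSum (osc g) v := by
      rw [← cov_sub_left hφ hφ' hγ]
      exact abs_cov_le (hφ.sub hφ') hγ φb fun σ τ =>
        (abs_sub_le_tsum_osc hγ γs τ σ).trans (Summable.tsum_le_tsum γl γs hlg)
    have h4 : |cov μ (fun σ => φ (forget r σ)) γ -
        cov μ (fun σ => φ (forget r σ)) fun σ => γ (forget r σ)| ≤
        εg D * ∑' v, localSum (osc f) v := by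
      rw [cov_comm, cov_comm μ _ fun σ => γ (forget r σ), ← cov_sub_left hγ hγ' hφ']
      exact abs_cov_le (hγ.sub hγ') hφ' γb fun σ τ =>
        (abs_sub_le_tsum_osc hφ φs _ _).trans (Summable.tsum_le_tsum φl φs hlf)
    have h5 : cov μ (fun σ => φ (forget r σ)) (fun σ => γ (forget r σ)) =
        cov (μ.map (restr (r := r))) (fun t => φ (extend t)) fun t => γ (extend t) := by
      simp only [cov]
      rw [integral_comp_forget hφ, integral_comp_forget hγ,
        integral_comp_forget (h := fun σ => φ σ * γ σ) (hφ.mul hγ)]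
    have hφe : ∀ j : Surv r, osc (fun t : Surv r → Fin q => φ (extend t)) j ≤
        localSum (osc f) j.1 := fun j => (osc_comp_extend_le hφ j).trans (φl j.1)
    have hγe : ∀ j : Surv r, osc (fun t : Surv r → Fin q => γ (extend t)) j ≤
        localSum (osc g) j.1 := fun j => (osc_comp_extend_le hγ j).trans (γl j.1)
    have hφes : Summable (osc fun t : Surv r → Fin q => φ (extend t)) :=
      Summable.of_nonneg_of_le (osc_nonneg _) hφe (hlf.comp_injective Subtype.val_injective)
    have hγes : Summable (osc fun t : Surv r → Fin q => γ (extend t)) :=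
      Summable.of_nonneg_of_le (osc_nonneg _) hγe (hlg.comp_injective Subtype.val_injective)
    -- The decay in the decimated model applies to observables whose oscillations are bounded by the
    -- smeared ones of `f` and `g`.
    have h6 : |cov (μ.map (restr (r := r))) (fun t => φ (extend t)) fun t => γ (extend t)| ≤
        |K| * (offsets.card * offsets.card * Real.exp (2 * m) * S) := by
      refine (hK (fun t => φ (extend t)) (fun t => γ (extend t)) (hφ.comp continuous_extend)
        (hγ.comp continuous_extend) hφes hγes).trans ?_
      rw [tsum_exp_double hm (osc_nonneg _) (osc_nonneg _) hφes hγes]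
      refine mul_le_mul (le_abs_self K) ?_ (tsum_nonneg fun p => mul_nonneg (mul_nonneg
        (osc_nonneg _ _) (Real.exp_pos _).le) (osc_nonneg _ _)) (abs_nonneg K)
      refine le_trans ?_ (tsum_exp_localSum_le hm (osc_nonneg f) (osc_nonneg g) hfs hgs)
      refine (summable_exp_double hm (osc_nonneg _) (osc_nonneg _) hφes hγes).tsum_le_tsum_of_inj
        (Prod.map Subtype.val Subtype.val)
        (Subtype.val_injective.prodMap Subtype.val_injective)
        (fun p _ => mul_nonneg (mul_nonneg (hlf0 _) (Real.exp_pos _).le) (hlg0 _))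
        (fun p => ?_) (summable_exp_double hm hlf0 hlg0 hlf hlg)
      exact mul_le_mul (mul_le_mul_of_nonneg_right (hφe p.1) (Real.exp_pos _).le) (hγe p.2)
        (osc_nonneg _ _) (mul_nonneg (hlf0 _) (Real.exp_pos _).le)
    rw [h2] at h1
    rw [h5] at h4
    have t1 := abs_sub_abs_le_abs_sub (cov μ f g) (cov μ φ γ)
    have t2 := abs_sub_abs_le_abs_sub (cov μ φ γ) (cov μ (fun σ => φ (forget r σ)) γ)
    have t3 := abs_sub_abs_le_abs_sub (cov μ (fun σ => φ (forget r σ)) γ)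
      (cov (μ.map (restr (r := r))) (fun t => φ (extend t)) fun t => γ (extend t))
    linarith
  have hlim := (((tendsto_tsum_sub_sum hfs).mul_const (∑' v, localSum (osc g) v)).add
    ((tendsto_tsum_sub_sum hgs).mul_const (∑' v, localSum (osc f) v))).const_add
      ((1 + |K| * (offsets.card * offsets.card * Real.exp (2 * m))) * S)
  rw [zero_mul, zero_mul, add_zero, add_zero] at hlim
  exact ge_of_tendsto' hlim key

end Decimation

end Potts

namespace Potts

set_option linter.unusedSectionVars false

/-! ### Hexagon factors and variation distances of normalized weights. -/

section Colours

variable {q : ℕ}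

/-- The weight of the colour `a` for a hexagon whose other five sites carry the colours `S`. -/
noncomputable def hexWeight (S : Finset (Fin q)) (a : Fin q) : ℝ := (q : ℝ) - (insert a S).card

lemma hexWeight_of_mem {S : Finset (Fin q)} {a : Fin q} (h : a ∈ S) :
    hexWeight S a = (q : ℝ) - S.card := by rw [hexWeight, Finset.insert_eq_of_mem h]

lemma hexWeight_of_notMem {S : Finset (Fin q)} {a : Fin q} (h : a ∉ S) :
    hexWeight S a = (q : ℝ) - S.card - 1 := by
  rw [hexWeight, Finset.card_insert_of_notMem h]; push_cast; ring

lemma hexWeight_eq_ite (S : Finset (Fin q)) (a : Fin q) :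
    hexWeight S a = (q : ℝ) - S.card - 1 + if a ∈ S then 1 else 0 := by
  split_ifs with h
  · rw [hexWeight_of_mem h]; ring
  · rw [hexWeight_of_notMem h]; ring

lemma hexWeight_pos (hq : 7 ≤ q) {S : Finset (Fin q)} (hS : S.card ≤ 5) (a : Fin q) :
    0 < hexWeight S a := by
  have h1 : (7 : ℝ) ≤ q := by exact_mod_cast hq
  have h2 : (S.card : ℝ) ≤ 5 := by exact_mod_cast hS
  rw [hexWeight_eq_ite]
  split_ifs <;> linarith

/-- The two values are q - |S| and q - |S| - 1, and their ratio is most extreme at |S| = 5. -/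
lemma hexWeight_ratio (hq : 7 ≤ q) {S : Finset (Fin q)} (hS : S.card ≤ 5) (a b : Fin q) :
    ((q : ℝ) - 6) * hexWeight S a ≤ ((q : ℝ) - 5) * hexWeight S b := by
  have h1 : (7 : ℝ) ≤ q := by exact_mod_cast hq
  have h2 : (S.card : ℝ) ≤ 5 := by exact_mod_cast hS
  rw [hexWeight_eq_ite, hexWeight_eq_ite]
  split_ifs <;> nlinarith

lemma hexWeight_le_of_notMem {S : Finset (Fin q)} {a : Fin q} (h : a ∉ S) (b : Fin q) :
    hexWeight S a ≤ hexWeight S b := by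
  rw [hexWeight_eq_ite, hexWeight_eq_ite, if_neg h]
  split_ifs <;> linarith

lemma card_of_card_compl_le {Q : Finset (Fin q)} {k : ℕ} (hQ : Qᶜ.card ≤ k) :
    (q : ℝ) - k ≤ Q.card := by
  have h1 := Finset.card_add_card_compl Q
  rw [Fintype.card_fin] at h1
  have : q ≤ Q.card + k := by omega
  have : (q : ℝ) ≤ Q.card + k := by exact_mod_cast this
  linarith

/-- Each summand is the excess over the worst ratio in `hexWeight_ratio`. If |S| = 5, at most four
colours are missing from `Q`, so some b in S survives and its excess alone suffices. If |S| ≤ 4,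
every summand is at least 5 - |S| and there are at least q - 4 of them. -/
lemma sum_hexWeight_sub (hq : 7 ≤ q) {S Q : Finset (Fin q)} (hS : S.card ≤ 5)
    (hQ : Qᶜ.card ≤ 4) (a : Fin q) :
    hexWeight S a ≤ ∑ b ∈ Q, (((q : ℝ) - 5) * hexWeight S b - ((q : ℝ) - 6) * hexWeight S a) := by
  have h1 : (7 : ℝ) ≤ q := by exact_mod_cast hq
  have hnn : ∀ b ∈ Q, 0 ≤ ((q : ℝ) - 5) * hexWeight S b - ((q : ℝ) - 6) * hexWeight S a :=
    fun b _ => sub_nonneg.2 (hexWeight_ratio hq hS a b)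
  by_cases hS5 : S.card = 5
  · obtain ⟨b, hbS, hbQ⟩ : ∃ b ∈ S, b ∈ Q := by
      by_contra! h
      have : S ⊆ Qᶜ := fun b hb => Finset.mem_compl.2 (h b hb)
      have := Finset.card_le_card this
      omega
    refine le_trans ?_ (Finset.single_le_sum hnn hbQ)
    rw [hexWeight_of_mem hbS, hexWeight_eq_ite S a, hS5]
    split_ifs <;> push_cast <;> nlinarith
  · have h2 : (S.card : ℝ) ≤ 4 := by
      have : S.card ≤ 4 := by omega
      exact_mod_cast this
    have h3 := card_of_card_compl_le hQ
    push_cast at h3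
    have h4 : ∀ b ∈ Q, ((q : ℝ) - S.card - ((q : ℝ) - 5)) ≤
        ((q : ℝ) - 5) * hexWeight S b - ((q : ℝ) - 6) * hexWeight S a := by
      intro b _
      rw [hexWeight_eq_ite S a, hexWeight_eq_ite S b]
      split_ifs <;> nlinarith
    refine le_trans ?_ (Finset.card_nsmul_le_sum Q _ _ h4)
    rw [nsmul_eq_mul, hexWeight_eq_ite S a]
    split_ifs <;> nlinarith

/-- With |S| = 5 every factor is at least q - 6, and one colour of S lies in `Q`, contributing the
extra 1; with |S| ≤ 4 every factor is at least q - 5. -/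
lemma sum_hexWeight_ge (hq : 7 ≤ q) {S Q : Finset (Fin q)} (hS : S.card ≤ 5)
    (hQ : Qᶜ.card ≤ 5) (hSQ : (S ∩ Qᶜ).card ≤ 4) :
    ((q : ℝ) - 5) * ((q : ℝ) - 6) + 1 ≤ ∑ b ∈ Q, hexWeight S b := by
  have h1 : (7 : ℝ) ≤ q := by exact_mod_cast hq
  have h3 := card_of_card_compl_le hQ
  push_cast at h3
  by_cases hS5 : S.card = 5
  · obtain ⟨b, hbS, hbQ⟩ : ∃ b ∈ S, b ∈ Q := by
      by_contra! h
      have : S ∩ Qᶜ = S := Finset.inter_eq_left.2 fun b hb => Finset.mem_compl.2 (h b hb)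
      rw [this] at hSQ
      omega
    have h4 : ∀ c ∈ Q, ((q : ℝ) - 6) + (if c = b then 1 else 0) ≤ hexWeight S c := by
      intro c _
      rw [hexWeight_eq_ite, hS5]
      by_cases hc : c = b
      · subst hc; rw [if_pos rfl, if_pos hbS]; push_cast; linarith
      · rw [if_neg hc]; split_ifs <;> push_cast <;> linarith
    refine le_trans ?_ (Finset.sum_le_sum h4)
    rw [Finset.sum_add_distrib, Finset.sum_const, Finset.sum_ite_eq' Q b, if_pos hbQ, nsmul_eq_mul]
    nlinarith
  · have h2 : (S.card : ℝ) ≤ 4 := by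
      have : S.card ≤ 4 := by omega
      exact_mod_cast this
    have h4 : ∀ c ∈ Q, (q : ℝ) - 5 ≤ hexWeight S c := by
      intro c _
      rw [hexWeight_eq_ite]
      split_ifs <;> linarith
    refine le_trans ?_ (Finset.card_nsmul_le_sum Q _ _ h4)
    rw [nsmul_eq_mul]
    nlinarith

/-- The normalization of a weight. -/
noncomputable def normalized (w : Fin q → ℝ) (a : Fin q) : ℝ := w a / ∑ b, w b

lemma sum_normalized (w : Fin q → ℝ) (A : Finset (Fin q)) :
    ∑ a ∈ A, normalized w a = (∑ a ∈ A, w a) / ∑ b, w b := by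
  simp only [normalized, Finset.sum_div]

lemma tvDist_comm (p p' : Fin q → ℝ) : tvDist p p' = tvDist p' p := by
  simp only [tvDist, abs_sub_comm]

/-- Passing to the complement of A reverses the sign of the difference, so a one-sided bound for all
events is enough. -/
lemma tvDist_normalized_le {w w' : Fin q → ℝ} {c : ℝ} (hw : 0 < ∑ a, w a) (hw' : 0 < ∑ a, w' a)
    (h : ∀ A : Finset (Fin q), (∑ a ∈ A, w a) / ∑ b, w b - (∑ a ∈ A, w' a) / ∑ b, w' b ≤ c) :
    tvDist (normalized w) (normalized w') ≤ c := by
  refine tvDist_le fun A => ?_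
  rw [sum_normalized, sum_normalized]
  refine abs_le'.2 ⟨h A, ?_⟩
  have h1 := h Aᶜ
  have e1 : (∑ a ∈ Aᶜ, w a) / ∑ b, w b = 1 - (∑ a ∈ A, w a) / ∑ b, w b := by
    rw [← Finset.sum_add_sum_compl A w] at hw ⊢; field_simp; ring
  have e2 : (∑ a ∈ Aᶜ, w' a) / ∑ b, w' b = 1 - (∑ a ∈ A, w' a) / ∑ b, w' b := by
    rw [← Finset.sum_add_sum_compl A w'] at hw' ⊢; field_simp; ring
  rw [e1, e2] at h1
  linarith

end Colours

/-! ### Next-to-nearest neighbours: the real inequalities. -/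

section NextNearest

variable {q : ℕ}

/-- Variation distance when the changed site takes two colours absent from the hexagon. -/
lemma nnn_real_of_absent {R X Y X₁ Y₁ R₁ G c : ℝ} (hG : 1 ≤ G) (hY : 0 ≤ Y) (hYX : Y ≤ X)
    (hR : 0 ≤ R)
    (hX₁ : X₁ ≤ X) (hY₁ : 0 ≤ Y₁) (hR₁ : 0 ≤ R₁)
    (hZ : 0 < R + G * X + (G - 1) * Y)
    (hZ' : 0 < R + (G - 1) * X + G * Y) (hc : 0 < c) (hcX : c * X ≤ (2 * G - 1) * X + R) :
    (R₁ + G * X₁ + (G - 1) * Y₁) / (R + G * X + (G - 1) * Y) -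
      (R₁ + (G - 1) * X₁ + G * Y₁) / (R + (G - 1) * X + G * Y) ≤ 1 / c := by
  set Z := R + G * X + (G - 1) * Y with hZdef
  set Z' := R + (G - 1) * X + G * Y with hZ'def
  have hZZ' : Z' ≤ Z := by rw [hZdef, hZ'def]; nlinarith
  -- The numerator increases in X₁ and decreases in R₁ and Y₁: the best event consists of the colour
  -- x alone.
  have hN : (R₁ + G * X₁ + (G - 1) * Y₁) * Z' - Z * (R₁ + (G - 1) * X₁ + G * Y₁) ≤
      X * (R + (2 * G - 1) * Y) := by
    have e : (R₁ + G * X₁ + (G - 1) * Y₁) * Z' - Z * (R₁ + (G - 1) * X₁ + G * Y₁) =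
        X₁ * (R + (2 * G - 1) * Y) - R₁ * (Z - Z') - Y₁ * (R + (2 * G - 1) * X) := by
      rw [hZdef, hZ'def]; ring
    rw [e]
    have h1 : 0 ≤ R + (2 * G - 1) * Y := by nlinarith
    have h2 : 0 ≤ R + (2 * G - 1) * X := by nlinarith
    have := mul_le_mul_of_nonneg_right hX₁ h1
    have := mul_nonneg hR₁ (sub_nonneg.2 hZZ')
    have := mul_nonneg hY₁ h2
    linarith
  rw [div_sub_div _ _ hZ.ne' hZ'.ne', div_le_div_iff₀ (mul_pos hZ hZ') hc, one_mul]
  have h1 : 0 ≤ R + (2 * G - 1) * Y := by nlinarith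
  calc _ ≤ X * (R + (2 * G - 1) * Y) * c := mul_le_mul_of_nonneg_right hN hc.le
    _ ≤ ((2 * G - 1) * X + R) * (R + (2 * G - 1) * Y) := by nlinarith
    _ ≤ Z * Z' := by
        -- Since Z - Z' = X - Y, the right side is G(G - 1)(X - Y)², so nothing is lost when X = Y.
        have e : Z * Z' - ((2 * G - 1) * X + R) * (R + (2 * G - 1) * Y) =
          (G - 1) * (X - Y) * ((Z - Z') + (G - 1) * (X - Y)) := by rw [hZdef, hZ'def]; ring
        have : 0 ≤ (G - 1) * (X - Y) := mul_nonneg (by linarith) (by linarith)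
        nlinarith

/-- Variation distance when the changed site takes a colour that is present on the hexagon and one
that is absent. -/
lemma nnn_real_of_present {Y β γ Y₁ β₁ γ₁ G c Γ : ℝ} (hG : 1 ≤ G)
    (hY₁ : 0 ≤ Y₁) (hβ₁ : 0 ≤ β₁) (hγ₁ : 0 ≤ γ₁) (hY : Y₁ ≤ Y) (hβ : β₁ ≤ β) (hγ : γ₁ ≤ γ)
    (hZ : 0 < G * Y + (G + 1) * β + G * γ)
    (hZ' : 0 < G * Y + G * β + (G - 1) * γ) (hc : 0 < c) (hcΓ : c ≤ 2 * G - 1 + Γ)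
    (h1 : Γ * Y ≤ (G - 1) * (β + γ)) (h2 : Γ ≤ G * (G - 1)) :
    (G * Y₁ + G * β₁ + (G - 1) * γ₁) / (G * Y + G * β + (G - 1) * γ) -
      (G * Y₁ + (G + 1) * β₁ + G * γ₁) / (G * Y + (G + 1) * β + G * γ) ≤ 1 / c := by
  set Z := G * Y + (G + 1) * β + G * γ with hZdef
  set Z' := G * Y + G * β + (G - 1) * γ with hZ'def
  have hY0 : 0 ≤ Y := hY₁.trans hY
  have hβ0 : 0 ≤ β := hβ₁.trans hβ
  have hγ0 : 0 ≤ γ := hγ₁.trans hγ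
  rw [div_sub_div _ _ hZ'.ne' hZ.ne', div_le_div_iff₀ (mul_pos hZ' hZ) hc, one_mul]
  have e : (G * Y₁ + G * β₁ + (G - 1) * γ₁) * Z - Z' * (G * Y₁ + (G + 1) * β₁ + G * γ₁) =
      Y₁ * G * (β + γ) + β₁ * (γ - G * Y) - γ₁ * (G * Y + β) := by
    rw [hZdef, hZ'def]; ring
  -- The best event contains the new colour and avoids the absent ones; whether it contains the
  -- colours already present depends on the sign of γ - GY, hence the maximum of two values.
  have hnum : (G * Y₁ + G * β₁ + (G - 1) * γ₁) * Z - Z' * (G * Y₁ + (G + 1) * β₁ + G * γ₁) ≤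
      max (G * Y * (β + γ)) (γ * (G * Y + β)) := by
    rw [e]
    have i1 : Y₁ * G * (β + γ) ≤ Y * G * (β + γ) :=
      mul_le_mul_of_nonneg_right (mul_le_mul_of_nonneg_right hY (by linarith)) (by linarith)
    have i2 : 0 ≤ γ₁ * (G * Y + β) := mul_nonneg hγ₁ (by nlinarith)
    rcases le_total γ (G * Y) with h | h
    · refine le_max_of_le_left ?_
      have : β₁ * (γ - G * Y) ≤ 0 := mul_nonpos_of_nonneg_of_nonpos hβ₁ (by linarith)
      linarith
    · refine le_max_of_le_right ?_
      have : β₁ * (γ - G * Y) ≤ β * (γ - G * Y) := mul_le_mul_of_nonneg_right hβ (by linarith)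
      linarith
  have hYM : 0 ≤ Y * (β + γ) := mul_nonneg hY0 (by linarith)
  have hb1 : G * Y * (β + γ) * c ≤ Z' * Z := by
    have j1 : G * Y * (β + γ) * c ≤ G * Y * (β + γ) * (2 * G - 1 + Γ) :=
      mul_le_mul_of_nonneg_left hcΓ (by nlinarith)
    have j2 : G * (Y + (β + γ)) ≤ Z := by rw [hZdef]; nlinarith
    have j3 : G * Y + (G - 1) * (β + γ) ≤ Z' := by rw [hZ'def]; nlinarith
    have j4 : (G * Y + (G - 1) * (β + γ)) * (G * (Y + (β + γ))) ≤ Z' * Z :=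
      mul_le_mul j3 j2 (mul_nonneg (by linarith) (by linarith)) hZ'.le
    have j5 : 0 ≤ (β + γ) * ((G - 1) * (β + γ) - Γ * Y) := mul_nonneg (by linarith) (by linarith)
    have j6 : (G * Y + (G - 1) * (β + γ)) * (G * (Y + (β + γ))) -
        G * Y * (β + γ) * (2 * G - 1 + Γ) =
        G * (G * (Y * Y) + (β + γ) * ((G - 1) * (β + γ) - Γ * Y)) := by ring
    have j7 : 0 ≤ G * (G * (Y * Y) + (β + γ) * ((G - 1) * (β + γ) - Γ * Y)) :=
      mul_nonneg (by linarith) (add_nonneg (mul_nonneg (by linarith) (mul_nonneg hY0 hY0)) j5)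
    linarith
  have hb2 : γ * (G * Y + β) * c ≤ Z' * Z := by
    have k0 : 0 ≤ γ * (G * Y + β) := mul_nonneg hγ0 (by nlinarith)
    have k1 := mul_le_mul_of_nonneg_left hcΓ k0
    have k2 : Z' * Z - γ * (G * Y + β) * (2 * G - 1 + Γ) =
        γ * (G * ((G - 1) * (β + γ) - Γ * Y) + β * (G * (G - 1) - Γ)) +
          (G * Y + G * β) * (G * Y + (G + 1) * β) := by rw [hZdef, hZ'def]; ring
    have k3 : 0 ≤ γ * (G * ((G - 1) * (β + γ) - Γ * Y) + β * (G * (G - 1) - Γ)) :=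
      mul_nonneg hγ0 (add_nonneg (mul_nonneg (by linarith) (by linarith))
        (mul_nonneg hβ0 (by linarith)))
    have k4 : 0 ≤ (G * Y + G * β) * (G * Y + (G + 1) * β) :=
      mul_nonneg (by nlinarith) (by nlinarith)
    linarith
  calc _ ≤ max (G * Y * (β + γ)) (γ * (G * Y + β)) * c :=
        mul_le_mul_of_nonneg_right hnum hc.le
    _ ≤ Z' * Z := by
        rcases max_choice (G * Y * (β + γ)) (γ * (G * Y + β)) with h | h <;> rw [h]
        exacts [hb1, hb2]

end NextNearest

end Potts

namespace Potts

set_option linter.unusedSectionVars false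

/-! ### Next-to-nearest neighbours: the upper bound. -/

section NextNearestColours

variable {q : ℕ}

lemma sum_eq_sum_sdiff_pair {x y : Fin q} (hxy : x ≠ y) (A : Finset (Fin q)) (f : Fin q → ℝ) :
    ∑ a ∈ A, f a = (∑ a ∈ A \ {x, y}, f a) + (if x ∈ A then f x else 0) +
      (if y ∈ A then f y else 0) := by
  rw [← Finset.sum_inter_add_sum_sdiff A {x, y} f, add_comm, add_assoc]
  congr 1
  rw [Finset.inter_comm, ← Finset.filter_mem_eq_inter, Finset.sum_filter, Finset.sum_pair hxy]

/-- In this form 2(q - 5) - 1 is the least share of the two affected colours, and the fraction is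
the least relative weight of all the others. -/
lemma cNNN_eq (hq : 7 ≤ q) : cNNN q = 1 / (2 * ((q : ℝ) - 5) - 1 +
    ((q : ℝ) - 6) ^ 2 * (((q : ℝ) - 5) * ((q : ℝ) - 6) + 1) / ((q : ℝ) - 5) ^ 2) := by
  have h1 : (7 : ℝ) ≤ q := by exact_mod_cast hq
  have hu : ((q : ℝ) - 5) ≠ 0 := by linarith
  rw [cNNN]
  have : 2 * ((q : ℝ) - 5) - 1 +
    ((q : ℝ) - 6) ^ 2 * (((q : ℝ) - 5) * ((q : ℝ) - 6) + 1) / ((q : ℝ) - 5) ^ 2 =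
    ((q : ℝ) ^ 4 - 21 * (q : ℝ) ^ 3 + 168 * (q : ℝ) ^ 2 - 608 * (q : ℝ) + 841) /
      ((q : ℝ) - 5) ^ 2 := by
    field_simp; ring
  rw [this, one_div_div]

lemma cNNN_nonneg (hq : 7 ≤ q) : 0 ≤ cNNN q := by
  have h1 : (7 : ℝ) ≤ q := by exact_mod_cast hq
  rw [cNNN_eq hq]
  have : 0 ≤ ((q : ℝ) - 6) ^ 2 * (((q : ℝ) - 5) * ((q : ℝ) - 6) + 1) / ((q : ℝ) - 5) ^ 2 :=
    div_nonneg (mul_nonneg (sq_nonneg _) (by nlinarith)) (sq_nonneg _)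
  exact one_div_nonneg.2 (by linarith)

variable (h : Fin q → ℝ) {N B : Finset (Fin q)}

lemma sum_weight_pos (hq : 7 ≤ q) (hN : N.card ≤ 4) {w : Fin q → ℝ} (h0 : ∀ a, 0 ≤ w a)
    (hpos : ∀ a ∉ N, 0 < w a) : 0 < ∑ a, w a := by
  obtain ⟨a, ha⟩ : ∃ a, a ∉ N := by
    by_contra! hh
    have := Finset.card_le_card (fun a _ => hh a : (Finset.univ : Finset (Fin q)) ⊆ N)
    rw [Finset.card_univ, Fintype.card_fin] at this
    omega
  exact Finset.sum_pos' (fun a _ => h0 a) ⟨a, Finset.mem_univ a, hpos a ha⟩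

/-- Only x and y change their factor, exchanging G and G - 1. The hypothesis `hr` reflects that `h`
is a product of two hexagon factors. -/
lemma tvDist_le_of_absent (hq : 7 ≤ q) (hB : B.card ≤ 4) (hN : N.card ≤ 3)
    (h0 : ∀ a, 0 ≤ h a) (hpos : ∀ a ∉ N, 0 < h a)
    (hr : ∀ a ∉ N, ∀ b, ((q : ℝ) - 6) ^ 2 * h b ≤ ((q : ℝ) - 5) ^ 2 * h a)
    {x y : Fin q} (hxy : x ≠ y) (hx : x ∉ B) (hy : y ∉ B) (hle : h y ≤ h x) :
    tvDist (normalized fun a => h a * hexWeight (insert x B) a)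
      (normalized fun a => h a * hexWeight (insert y B) a) ≤ cNNN q := by
  have h1 : (7 : ℝ) ≤ q := by exact_mod_cast hq
  have h2 : (B.card : ℝ) ≤ 4 := by exact_mod_cast hB
  have cx : (insert x B).card = B.card + 1 := Finset.card_insert_of_notMem hx
  have cy : (insert y B).card = B.card + 1 := Finset.card_insert_of_notMem hy
  have px : ∀ a, 0 < hexWeight (insert x B) a := hexWeight_pos hq (by omega)
  have py : ∀ a, 0 < hexWeight (insert y B) a := hexWeight_pos hq (by omega)
  have Zx : 0 < ∑ a, h a * hexWeight (insert x B) a :=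
    sum_weight_pos hq (by omega) (fun a => mul_nonneg (h0 a) (px a).le)
      (fun a ha => mul_pos (hpos a ha) (px a))
  have Zy : 0 < ∑ a, h a * hexWeight (insert y B) a :=
    sum_weight_pos hq (by omega) (fun a => mul_nonneg (h0 a) (py a).le)
      (fun a ha => mul_pos (hpos a ha) (py a))
  set G : ℝ := (q : ℝ) - B.card - 1 with hG
  have wxx : hexWeight (insert x B) x = G := by
    rw [hexWeight_of_mem (Finset.mem_insert_self _ _), cx, hG]; push_cast; ring
  have wyy : hexWeight (insert y B) y = G := by
    rw [hexWeight_of_mem (Finset.mem_insert_self _ _), cy, hG]; push_cast; ring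
  have wxy : hexWeight (insert x B) y = G - 1 := by
    rw [hexWeight_of_notMem (by simp [hxy.symm, hy]), cx, hG]; push_cast; ring
  have wyx : hexWeight (insert y B) x = G - 1 := by
    rw [hexWeight_of_notMem (by simp [hxy, hx]), cy, hG]; push_cast; ring
  have wR : ∀ A : Finset (Fin q), ∑ a ∈ A \ {x, y}, h a * hexWeight (insert y B) a =
      ∑ a ∈ A \ {x, y}, h a * hexWeight (insert x B) a := by
    intro A
    refine Finset.sum_congr rfl fun a ha => ?_
    simp only [Finset.mem_sdiff, Finset.mem_insert, Finset.mem_singleton, not_or] at ha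
    rw [hexWeight_eq_ite, hexWeight_eq_ite, cx, cy]
    simp [ha.2.1, ha.2.2]
  have hsum : ∀ A : Finset (Fin q), ∑ a ∈ A, h a * hexWeight (insert x B) a =
      (∑ a ∈ A \ {x, y}, h a * hexWeight (insert x B) a) + G * (if x ∈ A then h x else 0) +
        (G - 1) * (if y ∈ A then h y else 0) := by
    intro A
    rw [sum_eq_sum_sdiff_pair hxy, wxx, wxy]
    congr 1
    · congr 1; split_ifs <;> ring
    · split_ifs <;> ring
  have hsum' : ∀ A : Finset (Fin q), ∑ a ∈ A, h a * hexWeight (insert y B) a =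
      (∑ a ∈ A \ {x, y}, h a * hexWeight (insert x B) a) + (G - 1) * (if x ∈ A then h x else 0) +
        G * (if y ∈ A then h y else 0) := by
    intro A
    rw [sum_eq_sum_sdiff_pair hxy, wyx, wyy, wR]
    congr 1
    · congr 1; split_ifs <;> ring
    · split_ifs <;> ring
  have hu : (0 : ℝ) < (q : ℝ) - 5 := by linarith
  have hv : (0 : ℝ) < (q : ℝ) - 6 := by linarith
  have hG1 : (q : ℝ) - 5 ≤ G := by rw [hG]; linarith
  -- Allowed colours other than x and y have `h` at least ((q - 6)/(q - 5))² times `h x`. At most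
  -- five colours are excluded, and y is not in `insert x B`, so `sum_hexWeight_ge` applies.
  have hR : ((q : ℝ) - 6) ^ 2 * (((q : ℝ) - 5) * ((q : ℝ) - 6) + 1) / ((q : ℝ) - 5) ^ 2 * h x ≤
      ∑ a ∈ Finset.univ \ {x, y}, h a * hexWeight (insert x B) a := by
    have hc3 : (N ∪ {x, y}).card ≤ 5 := by
      have := Finset.card_union_le N {x, y}
      have := Finset.card_le_two (a := x) (b := y)
      omega
    have e1 : ((q : ℝ) - 5) * ((q : ℝ) - 6) + 1 ≤
        ∑ a ∈ (N ∪ {x, y})ᶜ, hexWeight (insert x B) a := by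
      refine sum_hexWeight_ge hq (by omega) (by rwa [compl_compl]) ?_
      rw [compl_compl]
      have : insert x B ∩ (N ∪ {x, y}) ⊆ insert x N := by
        intro a ha
        simp only [Finset.mem_inter, Finset.mem_insert, Finset.mem_union,
          Finset.mem_singleton] at ha ⊢
        rcases ha with ⟨h1 | h1, h2 | h2 | h2⟩
        · exact Or.inl h1
        · exact Or.inl h1
        · exact Or.inl h1
        · exact Or.inr h2
        · exact Or.inl h2
        · exact absurd (h2 ▸ h1) hy
      have := Finset.card_le_card this
      have := Finset.card_insert_le x N
      omega
    have e2 : ∑ a ∈ (N ∪ {x, y})ᶜ, h a * hexWeight (insert x B) a ≤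
        ∑ a ∈ Finset.univ \ {x, y}, h a * hexWeight (insert x B) a := by
      refine Finset.sum_le_sum_of_subset_of_nonneg ?_ fun a _ _ => mul_nonneg (h0 a) (px a).le
      intro a ha
      simp only [Finset.mem_compl, Finset.mem_union, not_or] at ha
      simpa using ha.2
    refine le_trans ?_ e2
    rw [div_mul_eq_mul_div, div_le_iff₀ (by positivity), Finset.sum_mul]
    calc _ = ((q : ℝ) - 6) ^ 2 * h x * (((q : ℝ) - 5) * ((q : ℝ) - 6) + 1) := by ring
      _ ≤ ((q : ℝ) - 6) ^ 2 * h x * ∑ a ∈ (N ∪ {x, y})ᶜ, hexWeight (insert x B) a :=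
        mul_le_mul_of_nonneg_left e1 (mul_nonneg (by positivity) (h0 x))
      _ ≤ _ := by
        rw [Finset.mul_sum]
        refine Finset.sum_le_sum fun a ha => ?_
        simp only [Finset.mem_compl, Finset.mem_union, not_or] at ha
        have := mul_le_mul_of_nonneg_right (hr a ha.1 x) (px a).le
        linarith
  rw [cNNN_eq hq]
  have hc0 : 0 < 2 * ((q : ℝ) - 5) - 1 +
      ((q : ℝ) - 6) ^ 2 * (((q : ℝ) - 5) * ((q : ℝ) - 6) + 1) / ((q : ℝ) - 5) ^ 2 := by
    have : 0 < ((q : ℝ) - 6) ^ 2 * (((q : ℝ) - 5) * ((q : ℝ) - 6) + 1) / ((q : ℝ) - 5) ^ 2 := by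
      positivity
    linarith
  have hRnn : ∀ A : Finset (Fin q), 0 ≤ ∑ a ∈ A \ {x, y}, h a * hexWeight (insert x B) a :=
    fun A => Finset.sum_nonneg fun a _ => mul_nonneg (h0 a) (px a).le
  refine tvDist_normalized_le Zx Zy fun A => ?_
  rw [hsum Finset.univ] at Zx
  rw [hsum' Finset.univ] at Zy
  rw [hsum A, hsum' A, hsum Finset.univ, hsum' Finset.univ]
  simp only [Finset.mem_univ, if_true] at Zx Zy ⊢
  refine nnn_real_of_absent (by linarith) (h0 y) hle (hRnn _) ?_ ?_ (hRnn A) Zx Zy hc0 ?_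
  · split_ifs
    exacts [le_rfl, h0 x]
  · split_ifs
    exacts [h0 y, le_rfl]
  · have := mul_le_mul_of_nonneg_right (show 2 * ((q : ℝ) - 5) - 1 ≤ 2 * G - 1 by linarith) (h0 x)
    linarith

/-- Adding the new colour y lowers the factor of every colour except y by one, so the colours split
into y, those in `B` and the rest. -/
lemma tvDist_le_of_present (hq : 7 ≤ q) (hB : B.card ≤ 4) (hN : N.card ≤ 3)
    (h0 : ∀ a, 0 ≤ h a) (hpos : ∀ a ∉ N, 0 < h a)
    (hr : ∀ a ∉ N, ∀ b, ((q : ℝ) - 6) ^ 2 * h b ≤ ((q : ℝ) - 5) ^ 2 * h a)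
    {x y : Fin q} (hx : x ∈ B) (hy : y ∉ B) :
    tvDist (normalized fun a => h a * hexWeight (insert x B) a)
      (normalized fun a => h a * hexWeight (insert y B) a) ≤ cNNN q := by
  have h1 : (7 : ℝ) ≤ q := by exact_mod_cast hq
  have h2 : (B.card : ℝ) ≤ 4 := by exact_mod_cast hB
  have cy : (insert y B).card = B.card + 1 := Finset.card_insert_of_notMem hy
  rw [Finset.insert_eq_of_mem hx]
  have px : ∀ a, 0 < hexWeight B a := hexWeight_pos hq (by omega)
  have py : ∀ a, 0 < hexWeight (insert y B) a := hexWeight_pos hq (by omega)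
  have Zx : 0 < ∑ a, h a * hexWeight B a :=
    sum_weight_pos hq (by omega) (fun a => mul_nonneg (h0 a) (px a).le)
      (fun a ha => mul_pos (hpos a ha) (px a))
  have Zy : 0 < ∑ a, h a * hexWeight (insert y B) a :=
    sum_weight_pos hq (by omega) (fun a => mul_nonneg (h0 a) (py a).le)
      (fun a ha => mul_pos (hpos a ha) (py a))
  set G : ℝ := (q : ℝ) - B.card - 1 with hG
  have hsplit : ∀ (A : Finset (Fin q)) (f : Fin q → ℝ), ∑ a ∈ A, f a =
      ∑ a ∈ A ∩ {y}, f a + ∑ a ∈ A ∩ B, f a + ∑ a ∈ A \ insert y B, f a := by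
    intro A f
    rw [← Finset.sum_union, ← Finset.inter_union_distrib_left, ← Finset.insert_eq,
      Finset.sum_inter_add_sum_sdiff]
    rw [Finset.disjoint_left]
    intro a ha hb
    simp only [Finset.mem_inter, Finset.mem_singleton] at ha hb
    exact hy (ha.2 ▸ hb.2)
  have hsum : ∀ A : Finset (Fin q), ∑ a ∈ A, h a * hexWeight B a =
      G * ∑ a ∈ A ∩ {y}, h a + (G + 1) * ∑ a ∈ A ∩ B, h a + G * ∑ a ∈ A \ insert y B, h a := by
    intro A
    rw [hsplit A, Finset.mul_sum, Finset.mul_sum, Finset.mul_sum]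
    congr 1
    · congr 1
      · refine Finset.sum_congr rfl fun a ha => ?_
        simp only [Finset.mem_inter, Finset.mem_singleton] at ha
        rw [ha.2, hexWeight_of_notMem hy]; ring
      · refine Finset.sum_congr rfl fun a ha => ?_
        rw [hexWeight_of_mem (Finset.mem_inter.1 ha).2]; ring
    · refine Finset.sum_congr rfl fun a ha => ?_
      simp only [Finset.mem_sdiff, Finset.mem_insert, not_or] at ha
      rw [hexWeight_of_notMem ha.2.2]; ring
  have hsum' : ∀ A : Finset (Fin q), ∑ a ∈ A, h a * hexWeight (insert y B) a =
      G * ∑ a ∈ A ∩ {y}, h a + G * ∑ a ∈ A ∩ B, h a + (G - 1) * ∑ a ∈ A \ insert y B, h a := by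
    intro A
    rw [hsplit A, Finset.mul_sum, Finset.mul_sum, Finset.mul_sum]
    congr 1
    · congr 1
      · refine Finset.sum_congr rfl fun a ha => ?_
        simp only [Finset.mem_inter, Finset.mem_singleton] at ha
        rw [ha.2, hexWeight_of_mem (Finset.mem_insert_self _ _), cy]; push_cast; ring
      · refine Finset.sum_congr rfl fun a ha => ?_
        rw [hexWeight_of_mem (Finset.mem_insert_of_mem (Finset.mem_inter.1 ha).2), cy]
        push_cast; ring
    · refine Finset.sum_congr rfl fun a ha => ?_
      rw [hexWeight_of_notMem (Finset.mem_sdiff.1 ha).2, cy]; push_cast; ring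
  have hu : (0 : ℝ) < (q : ℝ) - 5 := by linarith
  have hv : (0 : ℝ) < (q : ℝ) - 6 := by linarith
  have hG1 : (q : ℝ) - 5 ≤ G := by rw [hG]; linarith
  have hM : ((q : ℝ) - 6) ^ 2 * ((q : ℝ) - 4) / ((q : ℝ) - 5) ^ 2 * h y ≤
      ∑ a ∈ Finset.univ ∩ B, h a + ∑ a ∈ Finset.univ \ insert y B, h a := by
    have hc : (insert y N).card ≤ 4 := (Finset.card_insert_le y N).trans (by omega)
    have e0 := hsplit Finset.univ h
    have e1 : ∑ a ∈ (insert y N)ᶜ, h a ≤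
        ∑ a ∈ Finset.univ ∩ B, h a + ∑ a ∈ Finset.univ \ insert y B, h a := by
      have : ∑ a ∈ (insert y N)ᶜ, h a ≤ ∑ a ∈ {y}ᶜ, h a := by
        refine Finset.sum_le_sum_of_subset_of_nonneg ?_ fun a _ _ => h0 a
        intro a ha
        simp only [Finset.mem_compl, Finset.mem_insert, not_or] at ha
        simpa using ha.1
      have e2 := Finset.sum_add_sum_compl {y} h
      rw [Finset.univ_inter] at e0
      linarith
    have e2 := card_of_card_compl_le (k := 4) (Q := (insert y N)ᶜ) (by rwa [compl_compl])
    push_cast at e2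
    refine le_trans ?_ e1
    rw [div_mul_eq_mul_div, div_le_iff₀ (by positivity), Finset.sum_mul]
    refine le_trans ?_ (Finset.card_nsmul_le_sum _ _ (((q : ℝ) - 6) ^ 2 * h y) fun a ha => ?_)
    · rw [nsmul_eq_mul]
      have := mul_le_mul_of_nonneg_right e2 (mul_nonneg (sq_nonneg ((q : ℝ) - 6)) (h0 y))
      linarith
    · simp only [Finset.mem_compl, Finset.mem_insert, not_or] at ha
      have := hr a ha.2 y
      linarith
  rw [cNNN_eq hq, tvDist_comm]
  set Γ : ℝ := ((q : ℝ) - 6) ^ 2 * (((q : ℝ) - 5) * ((q : ℝ) - 6) + 1) / ((q : ℝ) - 5) ^ 2 with hΓ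
  have hΓ0 : 0 ≤ Γ := by positivity
  have hnn : ∀ A : Finset (Fin q), 0 ≤ ∑ a ∈ A, h a := fun A => Finset.sum_nonneg fun a _ => h0 a
  have hmono : ∀ A C : Finset (Fin q), A ⊆ C → ∑ a ∈ A, h a ≤ ∑ a ∈ C, h a := fun A C hAC =>
    Finset.sum_le_sum_of_subset_of_nonneg hAC fun a _ _ => h0 a
  refine tvDist_normalized_le Zy Zx fun A => ?_
  rw [hsum Finset.univ] at Zx
  rw [hsum' Finset.univ] at Zy
  rw [hsum A, hsum' A, hsum Finset.univ, hsum' Finset.univ]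
  have hy1 : ∑ a ∈ Finset.univ ∩ {y}, h a = h y := by simp
  refine nnn_real_of_present (Γ := Γ) (by linarith) (hnn _) (hnn _) (hnn _)
    (hmono _ _ (Finset.inter_subset_inter_right (Finset.subset_univ _)))
    (hmono _ _ (Finset.inter_subset_inter_right (Finset.subset_univ _)))
    (hmono _ _ (Finset.sdiff_subset_sdiff (Finset.subset_univ _) le_rfl)) Zx Zy
    (by linarith) (by linarith) ?_ ?_
  · rw [hy1]
    -- The slack is proportional to q - 7; here q ≥ 7 is really used.
    have e1 : Γ * h y ≤ ((q : ℝ) - 6) *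
        (((q : ℝ) - 6) ^ 2 * ((q : ℝ) - 4) / ((q : ℝ) - 5) ^ 2 * h y) := by
      have : ((q : ℝ) - 6) * (((q : ℝ) - 6) ^ 2 * ((q : ℝ) - 4) / ((q : ℝ) - 5) ^ 2 * h y) -
          Γ * h y = ((q : ℝ) - 6) ^ 2 * ((q : ℝ) - 7) / ((q : ℝ) - 5) ^ 2 * h y := by
        rw [hΓ]; field_simp; ring
      have h3 : 0 ≤ ((q : ℝ) - 6) ^ 2 * ((q : ℝ) - 7) / ((q : ℝ) - 5) ^ 2 * h y :=
        mul_nonneg (div_nonneg (mul_nonneg (by positivity) (by linarith)) (by positivity)) (h0 y)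
      linarith
    refine e1.trans (mul_le_mul (by linarith) hM ?_ (by linarith))
    exact mul_nonneg (div_nonneg (mul_nonneg (by positivity) (by linarith)) (by positivity)) (h0 y)
  · have e1 : Γ ≤ ((q : ℝ) - 5) * ((q : ℝ) - 6) := by
      rw [hΓ, div_le_iff₀ (by positivity)]
      have e : ((q : ℝ) - 5) * ((q : ℝ) - 6) * ((q : ℝ) - 5) ^ 2 -
          ((q : ℝ) - 6) ^ 2 * (((q : ℝ) - 5) * ((q : ℝ) - 6) + 1) = ((q : ℝ) - 6) *
          (2 * ((q : ℝ) - 6) ^ 2 + 2 * ((q : ℝ) - 6) + 1) := by ring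
      have : 0 ≤ ((q : ℝ) - 6) * (2 * ((q : ℝ) - 6) ^ 2 + 2 * ((q : ℝ) - 6) + 1) := by positivity
      linarith
    refine e1.trans (mul_le_mul hG1 (by linarith) hv.le (by linarith))

/-- Changing the colour of one next-to-nearest neighbour. -/
theorem tvDist_nextNearest_le (hq : 7 ≤ q) (hB : B.card ≤ 4) (hN : N.card ≤ 3)
    {S S' : Finset (Fin q)} (hS : S.card ≤ 5) (hS' : S'.card ≤ 5) (x y : Fin q) :
    tvDist (normalized fun a =>
        (if a ∈ N then 0 else hexWeight S a * hexWeight S' a) * hexWeight (insert x B) a)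
      (normalized fun a =>
        (if a ∈ N then 0 else hexWeight S a * hexWeight S' a) * hexWeight (insert y B) a) ≤
      cNNN q := by
  have h1 : (7 : ℝ) ≤ q := by exact_mod_cast hq
  have hp : ∀ a, 0 < hexWeight S a * hexWeight S' a := fun a =>
    mul_pos (hexWeight_pos hq hS a) (hexWeight_pos hq hS' a)
  set h : Fin q → ℝ := fun a => if a ∈ N then 0 else hexWeight S a * hexWeight S' a with hh
  have h0 : ∀ a, 0 ≤ h a := fun a => by
    simp only [hh]; split_ifs
    exacts [le_rfl, (hp a).le]
  have hpos : ∀ a ∉ N, 0 < h a := fun a ha => by simp only [hh, if_neg ha]; exact hp a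
  have hr : ∀ a ∉ N, ∀ b, ((q : ℝ) - 6) ^ 2 * h b ≤ ((q : ℝ) - 5) ^ 2 * h a := by
    intro a ha b
    by_cases hb : b ∈ N
    · simp only [hh, if_pos hb, mul_zero]; exact mul_nonneg (sq_nonneg _) (h0 a)
    · simp only [hh, if_neg hb, if_neg ha]
      have := mul_le_mul (hexWeight_ratio hq hS b a) (hexWeight_ratio hq hS' b a)
        (mul_nonneg (by linarith) (hexWeight_pos hq hS' b).le)
        (mul_nonneg (by linarith) (hexWeight_pos hq hS a).le)
      linarith
  change tvDist (normalized fun a => h a * hexWeight (insert x B) a)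
      (normalized fun a => h a * hexWeight (insert y B) a) ≤ cNNN q
  by_cases hx : x ∈ B <;> by_cases hy : y ∈ B
  · have := cNNN_nonneg hq
    rw [Finset.insert_eq_of_mem hx, Finset.insert_eq_of_mem hy]
    exact tvDist_le fun A => by simpa using this
  · exact tvDist_le_of_present h hq hB hN h0 hpos hr hx hy
  · rw [tvDist_comm]
    exact tvDist_le_of_present h hq hB hN h0 hpos hr hy hx
  · rcases eq_or_ne x y with rfl | hxy
    · have := cNNN_nonneg hq
      exact tvDist_le fun A => by simpa using this
    · rcases le_total (h y) (h x) with hle | hle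
      · exact tvDist_le_of_absent h hq hB hN h0 hpos hr hxy hx hy hle
      · rw [tvDist_comm]
        exact tvDist_le_of_absent h hq hB hN h0 hpos hr hxy.symm hy hx hle

end NextNearestColours

end Potts

namespace Potts

set_option linter.unusedSectionVars false

/-! ### Nearest neighbours: the real inequalities. -/

section NearestReal

/-- `nnRatio (q - 5)` is the minimal ratio between the total weight of the unaffected colours and
the weight of an affected one when a nearest neighbour is changed. -/
noncomputable def nnRatio (u : ℝ) : ℝ := (u - 1) ^ 2 * (u ^ 2 + 2) / u ^ 3

variable {u : ℝ}

lemma nnRatio_pos (hu : 2 ≤ u) : 0 < nnRatio u := by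
  have : 0 < u - 1 := by linarith
  have : 0 < u := by linarith
  unfold nnRatio; positivity

lemma nnRatio_le_self (hu : 2 ≤ u) : nnRatio u ≤ u := by
  -- After shifting to z = u - 2 ≥ 0 the difference has a numerator with nonnegative coefficients;
  -- the inequalities below use the same device.
  obtain ⟨z, rfl⟩ : ∃ z, u = z + 2 := ⟨u - 2, by ring⟩
  have hz : 0 ≤ z := by linarith
  rw [← sub_nonneg, nnRatio]
  have : z + 2 - (z + 2 - 1) ^ 2 * ((z + 2) ^ 2 + 2) / (z + 2) ^ 3 =
      (10 + 16 * z + 9 * z ^ 2 + 2 * z ^ 3) / (z + 2) ^ 3 := by field_simp; ring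
  rw [this]; positivity

lemma nnRatio_le_two (hu : 2 ≤ u) : nnRatio u ≤ (u - 1) * (u ^ 2 + 1) / u ^ 2 := by
  obtain ⟨z, rfl⟩ : ∃ z, u = z + 2 := ⟨u - 2, by ring⟩
  have hz : 0 ≤ z := by linarith
  rw [← sub_nonneg, nnRatio]
  have : (z + 2 - 1) * ((z + 2) ^ 2 + 1) / (z + 2) ^ 2 -
      (z + 2 - 1) ^ 2 * ((z + 2) ^ 2 + 2) / (z + 2) ^ 3 =
      (4 + 7 * z + 4 * z ^ 2 + z ^ 3) / (z + 2) ^ 3 := by field_simp; ring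
  rw [this]; positivity

/-- The number (2u² - 1)/u⁴ is 1 - (1 - 1/u²)², the largest cross-ratio defect, reached when two
hexagons respond. -/
lemma nnRatio_mul_le_one (hu : 2 ≤ u) :
    (1 + nnRatio u) * ((2 * u ^ 2 - 1) / u ^ 4) ≤ 1 := by
  obtain ⟨z, rfl⟩ : ∃ z, u = z + 2 := ⟨u - 2, by ring⟩
  have hz : 0 ≤ z := by linarith
  rw [← sub_nonneg, nnRatio]
  have : 1 - (1 + (z + 2 - 1) ^ 2 * ((z + 2) ^ 2 + 2) / (z + 2) ^ 3) *
      ((2 * (z + 2) ^ 2 - 1) / (z + 2) ^ 4) = (30 + 140 * z + 273 * z ^ 2 + 287 * z ^ 3 +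
        175 * z ^ 4 + 62 * z ^ 5 + 12 * z ^ 6 + z ^ 7) / (z + 2) ^ 7 := by field_simp; ring
  rw [this]; positivity

lemma nnRatio_mul_le_two (hu : 2 ≤ u) :
    (nnRatio u + 2) * ((2 * u ^ 2 - 1) / u ^ 4) ≤ 2 := by
  obtain ⟨z, rfl⟩ : ∃ z, u = z + 2 := ⟨u - 2, by ring⟩
  have hz : 0 ≤ z := by linarith
  rw [← sub_nonneg, nnRatio]
  have : 2 - ((z + 2 - 1) ^ 2 * ((z + 2) ^ 2 + 2) / (z + 2) ^ 3 + 2) *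
      ((2 * (z + 2) ^ 2 - 1) / (z + 2) ^ 4) = (102 + 440 * z + 791 * z ^ 2 + 768 * z ^ 3 +
        435 * z ^ 4 + 144 * z ^ 5 + 26 * z ^ 6 + 2 * z ^ 7) / (z + 2) ^ 7 := by field_simp; ring
  rw [this]; positivity

/-- The requirement of `tvDist_le_of_same` when exactly one hexagon responds: defect 1/u², improved
total ratio from two factors, individual ratio ((u - 1)/u)². -/
lemma nnRatio_le_one_shift (hu : 2 ≤ u) :
    nnRatio u ≤ (u - 1) * (u ^ 2 + 1) / u ^ 2 * (1 - (1 + nnRatio u) * (1 / u ^ 2)) +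
      (1 + nnRatio u) * (1 / u ^ 2) * ((u - 1) / u) ^ 2 := by
  obtain ⟨z, rfl⟩ : ∃ z, u = z + 2 := ⟨u - 2, by ring⟩
  have hz : 0 ≤ z := by linarith
  rw [← sub_nonneg, nnRatio]
  have : (z + 2 - 1) * ((z + 2) ^ 2 + 1) / (z + 2) ^ 2 *
        (1 - (1 + (z + 2 - 1) ^ 2 * ((z + 2) ^ 2 + 2) / (z + 2) ^ 3) * (1 / (z + 2) ^ 2)) +
      (1 + (z + 2 - 1) ^ 2 * ((z + 2) ^ 2 + 2) / (z + 2) ^ 3) * (1 / (z + 2) ^ 2) *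
        ((z + 2 - 1) / (z + 2)) ^ 2 - (z + 2 - 1) ^ 2 * ((z + 2) ^ 2 + 2) / (z + 2) ^ 3 =
      (8 + 30 * z + 48 * z ^ 2 + 43 * z ^ 3 + 23 * z ^ 4 + 7 * z ^ 5 + z ^ 6) / (z + 2) ^ 7 := by
    field_simp; ring
  rw [this]; positivity

/-- The same requirement when both hexagons respond: only one factor then lowers the ratios, to u in
total and (u - 1)/u individually. -/
lemma nnRatio_le_two_shifts (hu : 2 ≤ u) :
    nnRatio u ≤ u * (1 - (1 + nnRatio u) * ((2 * u ^ 2 - 1) / u ^ 4)) +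
      (1 + nnRatio u) * ((2 * u ^ 2 - 1) / u ^ 4) * ((u - 1) / u) := by
  obtain ⟨z, rfl⟩ : ∃ z, u = z + 2 := ⟨u - 2, by ring⟩
  have hz : 0 ≤ z := by linarith
  rw [← sub_nonneg, nnRatio]
  have : (z + 2) * (1 - (1 + (z + 2 - 1) ^ 2 * ((z + 2) ^ 2 + 2) / (z + 2) ^ 3) *
        ((2 * (z + 2) ^ 2 - 1) / (z + 2) ^ 4)) +
      (1 + (z + 2 - 1) ^ 2 * ((z + 2) ^ 2 + 2) / (z + 2) ^ 3) *
        ((2 * (z + 2) ^ 2 - 1) / (z + 2) ^ 4) * ((z + 2 - 1) / (z + 2)) -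
      (z + 2 - 1) ^ 2 * ((z + 2) ^ 2 + 2) / (z + 2) ^ 3 =
      (26 + 94 * z + 149 * z ^ 2 + 140 * z ^ 3 + 87 * z ^ 4 + 36 * z ^ 5 + 9 * z ^ 6 + z ^ 7) /
        (z + 2) ^ 8 := by
    field_simp; ring
  rw [this]; positivity

/-- A lower bound for the relative excess when the two hexagons respond in opposite ways. -/
noncomputable def nnExcess (u : ℝ) : ℝ := (u ^ 2 - u + 2) / (u ^ 3 + u)

lemma nnExcess_pos (hu : 2 ≤ u) : 0 < nnExcess u := by
  have : 0 < u := by linarith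
  exact div_pos (by nlinarith) (by positivity)

lemma nnExcess_le_one (hu : 2 ≤ u) : nnExcess u ≤ 1 := by
  obtain ⟨z, rfl⟩ : ∃ z, u = z + 2 := ⟨u - 2, by ring⟩
  have hz : 0 ≤ z := by linarith
  rw [nnExcess, div_le_one (by positivity), ← sub_nonneg]
  have : (z + 2) ^ 3 + (z + 2) - ((z + 2) ^ 2 - (z + 2) + 2) =
      6 + 10 * z + 5 * z ^ 2 + z ^ 3 := by ring
  rw [this]; positivity

/-- This fixes the choice of `nnExcess`: the two-factor ratio exceeds T, and the surplus is exactly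
this fraction of the unaffected weight. -/
lemma one_sub_nnExcess_mul (hu : 2 ≤ u) :
    (1 - nnExcess u) * ((u - 1) * (u ^ 2 + 1) / u ^ 2) = nnRatio u := by
  have : 0 < u := by linarith
  rw [nnExcess, nnRatio]; field_simp; ring

/-- Needed at the corner of `gap_nonneg_of_opposite` where both slacks are minimal; `nnExcess_edge`
serves the two mixed corners. -/
lemma nnExcess_corner (hu : 2 ≤ u) :
    (1 + nnRatio u) ^ 2 * (1 / u ^ 2) ≤
      2 * (1 + nnRatio u) * nnExcess u - nnExcess u ^ 2 * (2 - 1 / u ^ 2) := by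
  obtain ⟨z, rfl⟩ : ∃ z, u = z + 2 := ⟨u - 2, by ring⟩
  have hz : 0 ≤ z := by linarith
  rw [← sub_nonneg, nnRatio, nnExcess]
  have : 2 * (1 + (z + 2 - 1) ^ 2 * ((z + 2) ^ 2 + 2) / (z + 2) ^ 3) *
        (((z + 2) ^ 2 - (z + 2) + 2) / ((z + 2) ^ 3 + (z + 2))) -
        (((z + 2) ^ 2 - (z + 2) + 2) / ((z + 2) ^ 3 + (z + 2))) ^ 2 * (2 - 1 / (z + 2) ^ 2) -
        (1 + (z + 2 - 1) ^ 2 * ((z + 2) ^ 2 + 2) / (z + 2) ^ 3) ^ 2 * (1 / (z + 2) ^ 2) =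
      (2268 + 13968 * z + 39276 * z ^ 2 + 66980 * z ^ 3 + 77431 * z ^ 4 + 64070 * z ^ 5 +
        38956 * z ^ 6 + 17546 * z ^ 7 + 5811 * z ^ 8 + 1380 * z ^ 9 + 223 * z ^ 10 + 22 * z ^ 11 +
        z ^ 12) / ((z + 2) ^ 8 * ((z + 2) ^ 2 + 1) ^ 2) := by
    field_simp; ring
  rw [this]; positivity

lemma nnExcess_edge (hu : 2 ≤ u) :
    (1 + nnRatio u) ^ 2 * ((2 * u ^ 2 - 1) / u ^ 4) ≤
      1 + nnRatio u + nnExcess u * nnRatio u - nnExcess u * (1 - 1 / u ^ 2) ^ 2 := by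
  obtain ⟨z, rfl⟩ : ∃ z, u = z + 2 := ⟨u - 2, by ring⟩
  have hz : 0 ≤ z := by linarith
  rw [← sub_nonneg, nnRatio, nnExcess]
  have : 1 + (z + 2 - 1) ^ 2 * ((z + 2) ^ 2 + 2) / (z + 2) ^ 3 +
        ((z + 2) ^ 2 - (z + 2) + 2) / ((z + 2) ^ 3 + (z + 2)) *
          ((z + 2 - 1) ^ 2 * ((z + 2) ^ 2 + 2) / (z + 2) ^ 3) -
        ((z + 2) ^ 2 - (z + 2) + 2) / ((z + 2) ^ 3 + (z + 2)) * (1 - 1 / (z + 2) ^ 2) ^ 2 -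
        (1 + (z + 2 - 1) ^ 2 * ((z + 2) ^ 2 + 2) / (z + 2) ^ 3) ^ 2 *
          ((2 * (z + 2) ^ 2 - 1) / (z + 2) ^ 4) =
      (2484 + 18720 * z + 64152 * z ^ 2 + 132492 * z ^ 3 + 184213 * z ^ 4 + 182348 * z ^ 5 +
        132433 * z ^ 6 + 71583 * z ^ 7 + 28854 * z ^ 8 + 8584 * z ^ 9 + 1836 * z ^ 10 +
        268 * z ^ 11 + 24 * z ^ 12 + z ^ 13) / ((z + 2) ^ 10 * ((z + 2) ^ 2 + 1)) := by
    field_simp; ring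
  rw [this]; positivity

lemma linear_nonneg {a b l r s : ℝ} (hl : l ≤ s) (hr : s ≤ r) (h1 : 0 ≤ a * l + b)
    (h2 : 0 ≤ a * r + b) : 0 ≤ a * s + b := by
  rcases le_total 0 a with h | h
  · have := mul_le_mul_of_nonneg_left hl h; linarith
  · have := mul_le_mul_of_nonpos_left hr h; linarith

/-- The quantity whose sign decides the nearest-neighbour estimate. -/
def gap (T α β α' β' s s' : ℝ) : ℝ :=
  (1 + T) * (s * β' + s' * α) - s * s' - (1 + T) ^ 2 * (α * β' - α' * β)

/-- The form is affine in each of s and s' separately, so its minimum over a rectangle is at a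
corner. -/
lemma gap_nonneg_of_corners {T α β α' β' s s' l r l' r' : ℝ} (hl : l ≤ s) (hr : s ≤ r)
    (hl' : l' ≤ s') (hr' : s' ≤ r') (h1 : 0 ≤ gap T α β α' β' l l')
    (h2 : 0 ≤ gap T α β α' β' l r') (h3 : 0 ≤ gap T α β α' β' r l')
    (h4 : 0 ≤ gap T α β α' β' r r') : 0 ≤ gap T α β α' β' s s' := by
  have e : ∀ t t', gap T α β α' β' t t' = ((1 + T) * β' - t') * t +
      ((1 + T) * (t' * α) - (1 + T) ^ 2 * (α * β' - α' * β)) := fun t t' => by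
    unfold gap; ring
  have e' : ∀ t t', gap T α β α' β' t t' = ((1 + T) * α - t) * t' +
      ((1 + T) * (t * β') - (1 + T) ^ 2 * (α * β' - α' * β)) := fun t t' => by
    unfold gap; ring
  have k : ∀ t, 0 ≤ gap T α β α' β' t l' → 0 ≤ gap T α β α' β' t r' →
      0 ≤ gap T α β α' β' t s' := by
    intro t ht1 ht2
    rw [e'] at *
    exact linear_nonneg hl' hr' ht1 ht2
  have k1 := k l h1 h2
  have k2 := k r h3 h4
  rw [e] at *
  exact linear_nonneg hl hr k1 k2

/-- Clearing denominators and replacing Y and X by the slacks α + β - TY and α' + β' - TX turns the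
bound into nonnegativity of `gap`. -/
lemma sub_div_le_of_gap {T α β α' β' X Y : ℝ} (hT : 0 < T) (hY : 0 < Y + α + β)
    (hX : 0 < X + α' + β')
    (h : 0 ≤ gap T α β α' β' (α + β - T * Y) (α' + β' - T * X)) :
    (Y + α) / (Y + α + β) - α' / (X + α' + β') ≤ 1 / (1 + T) := by
  rw [div_sub_div _ _ hY.ne' hX.ne', div_le_div_iff₀ (mul_pos hY hX) (by linarith)]
  have e : T * gap T α β α' β' (α + β - T * Y) (α' + β' - T * X) = T ^ 2 *
      (1 * ((Y + α + β) * (X + α' + β')) -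
        ((Y + α) * (X + α' + β') - (Y + α + β) * α') * (1 + T)) := by
    unfold gap; ring
  have h1 := mul_nonneg hT.le h
  rw [e] at h1
  exact sub_nonneg.1 (nonneg_of_mul_nonneg_right h1 (by positivity))

lemma gap_total_total (T α β α' β' : ℝ) : gap T α β α' β' (α + β) (α' + β') =
    T * (2 * (α * β') + (α * α' + β * β') - (T + 2) * (α * β' - α' * β)) := by
  unfold gap; ring

/-- Both hexagons respond in the same way. -/
lemma gap_nonneg_of_le {T α β α' β' s s' ε : ℝ} (hT : 0 < T) (hα : 0 ≤ α) (hβ : 0 ≤ β)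
    (hα' : 0 ≤ α') (hβ' : 0 ≤ β') (hs : 0 ≤ s) (hsM : s ≤ α + β) (hs' : 0 ≤ s')
    (hsM' : s' ≤ α' + β') (hε1 : (1 + T) * ε ≤ 1) (hε2 : (T + 2) * ε ≤ 2)
    (hΔ : (1 - ε) * (α * β') ≤ α' * β) (h : α * ((1 + T) * ε * β') ≤ α * s') :
    0 ≤ gap T α β α' β' s s' := by
  have hΔ' : α * β' - α' * β ≤ ε * (α * β') := by linarith
  have hP : 0 ≤ α * β' := mul_nonneg hα hβ'
  -- With s = 0 the first set has no slack, and s' must pay for the cross-ratio defect; hypothesis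
  -- `h` says exactly this.
  have h0 : 0 ≤ gap T α β α' β' 0 s' := by
    have e : gap T α β α' β' 0 s' =
        (1 + T) * (α * s' - (1 + T) * (α * β' - α' * β)) := by unfold gap; ring
    rw [e]
    have := mul_le_mul_of_nonneg_left hΔ' (by linarith : (0 : ℝ) ≤ 1 + T)
    exact mul_nonneg (by linarith) (by linarith)
  have h1 : 0 ≤ gap T α β α' β' (α + β) 0 := by
    have e : gap T α β α' β' (α + β) 0 =
        (1 + T) * (α * β' + β * β' - (1 + T) * (α * β' - α' * β)) := by unfold gap; ring
    rw [e]
    have i1 := mul_le_mul_of_nonneg_left hΔ' (by linarith : (0 : ℝ) ≤ 1 + T)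
    have i2 := mul_le_mul_of_nonneg_right hε1 hP
    have := mul_nonneg hβ hβ'
    exact mul_nonneg (by linarith) (by linarith)
  have h2 : 0 ≤ gap T α β α' β' (α + β) (α' + β') := by
    rw [gap_total_total]
    have i1 := mul_le_mul_of_nonneg_left hΔ' (by linarith : (0 : ℝ) ≤ T + 2)
    have i2 := mul_le_mul_of_nonneg_right hε2 hP
    have := mul_nonneg hβ hβ'
    have := mul_nonneg hα hα'
    exact mul_nonneg hT.le (by linarith)
  have e' : ∀ t', gap T α β α' β' (α + β) t' = ((1 + T) * α - (α + β)) * t' +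
      ((1 + T) * ((α + β) * β') - (1 + T) ^ 2 * (α * β' - α' * β)) := fun t' => by
    unfold gap; ring
  have h3 : 0 ≤ gap T α β α' β' (α + β) s' := by
    rw [e'] at *
    exact linear_nonneg hs' hsM' h1 h2
  have e : ∀ t, gap T α β α' β' t s' = ((1 + T) * β' - s') * t +
      ((1 + T) * (s' * α) - (1 + T) ^ 2 * (α * β' - α' * β)) := fun t => by
    unfold gap; ring
  rw [e] at *
  exact linear_nonneg hs hsM h0 h3

/-- The two hexagons respond in opposite ways. -/
lemma gap_nonneg_of_opposite (hu : 2 ≤ u) {α β α' β' s s' : ℝ} (hα : 0 ≤ α) (hβ : 0 ≤ β)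
    (hα' : 0 ≤ α') (hβ' : 0 ≤ β') (hs : nnExcess u * (α + β) ≤ s) (hsM : s ≤ α + β)
    (hs' : nnExcess u * (α' + β') ≤ s') (hsM' : s' ≤ α' + β')
    (hΔ : (1 - 1 / u ^ 2) ^ 2 * (α * β') ≤ α' * β) :
    0 ≤ gap (nnRatio u) α β α' β' s s' := by
  have hT := nnRatio_pos hu
  have hσ0 := nnExcess_pos hu
  have hσ1 := nnExcess_le_one hu
  have hcorner := nnExcess_corner hu
  have hedge := nnExcess_edge hu
  have hN2 := nnRatio_mul_le_two hu
  set T := nnRatio u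
  set σ := nnExcess u
  have hP : 0 ≤ α * β' := mul_nonneg hα hβ'
  have hη0 : 0 ≤ 1 - 1 / u ^ 2 := by
    rw [sub_nonneg, div_le_one (by positivity)]; nlinarith
  have hη1 : 1 - 1 / u ^ 2 ≤ 1 := by
    have : 0 ≤ 1 / u ^ 2 := by positivity
    linarith
  have hη2 : (2 * u ^ 2 - 1) / u ^ 4 = 1 - (1 - 1 / u ^ 2) ^ 2 := by field_simp; ring
  have hη3 : 1 / u ^ 2 = 1 - (1 - 1 / u ^ 2) := by ring
  have hη4 : 2 - 1 / u ^ 2 = 1 + (1 - 1 / u ^ 2) := by ring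
  rw [hη2] at hedge hN2
  rw [hη4] at hcorner
  rw [show (1 + T) ^ 2 * (1 / u ^ 2) = (1 + T) ^ 2 * (1 - (1 - 1 / u ^ 2)) by ring] at hcorner
  set η := 1 - 1 / u ^ 2
  have hΔ' : α * β' - α' * β ≤ (1 - η ^ 2) * (α * β') := by linarith
  -- Arithmetic-geometric mean: (αα')(ββ') = (αβ')(α'β), which is at least η²(αβ')² by the
  -- cross-ratio hypothesis.
  have hX : 2 * η * (α * β') ≤ α * α' + β * β' := by
    have h0 : 0 ≤ α * α' + β * β' := add_nonneg (mul_nonneg hα hα') (mul_nonneg hβ hβ')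
    refine le_of_sq_le_sq ?_ h0
    have := mul_le_mul_of_nonneg_right hΔ hP
    nlinarith [sq_nonneg (α * α' - β * β')]
  have hαα := mul_nonneg hα hα'
  have hββ := mul_nonneg hβ hβ'
  have hη21 : 0 ≤ 1 - η ^ 2 := by nlinarith
  refine gap_nonneg_of_corners hs hsM hs' hsM' ?_ ?_ ?_ ?_
  · have e : gap T α β α' β' (σ * (α + β)) (σ * (α' + β')) =
        σ * (1 + T - σ) * (2 * (α * β') + (α * α' + β * β')) -
          ((1 + T) ^ 2 - σ ^ 2) * (α * β' - α' * β) := by unfold gap; ring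
    have i1 := mul_le_mul_of_nonneg_left hX (mul_nonneg hσ0.le (by linarith : 0 ≤ 1 + T - σ))
    have i2 := mul_le_mul_of_nonneg_left hΔ' (by nlinarith : 0 ≤ (1 + T) ^ 2 - σ ^ 2)
    have i3 := mul_le_mul_of_nonneg_left hcorner (mul_nonneg hP (by linarith : 0 ≤ 1 + η))
    rw [e]
    linarith
  · have e : gap T α β α' β' (σ * (α + β)) (α' + β') =
        (1 + T + T * σ - σ) * (α * β') + (1 + T - σ) * (α * α') + T * σ * (β * β') -
          ((1 + T) ^ 2 - σ) * (α * β' - α' * β) := by unfold gap; ring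
    have i2 := mul_le_mul_of_nonneg_left hΔ' (by nlinarith : 0 ≤ (1 + T) ^ 2 - σ)
    have i3 := mul_le_mul_of_nonneg_left hedge hP
    have i4 := mul_nonneg (by linarith : 0 ≤ 1 + T - σ) hαα
    have i5 := mul_nonneg (mul_nonneg hT.le hσ0.le) hββ
    rw [e]
    linarith
  · have e : gap T α β α' β' (α + β) (σ * (α' + β')) =
        (1 + T + T * σ - σ) * (α * β') + (1 + T - σ) * (β * β') + T * σ * (α * α') -
          ((1 + T) ^ 2 - σ) * (α * β' - α' * β) := by unfold gap; ring
    have i2 := mul_le_mul_of_nonneg_left hΔ' (by nlinarith : 0 ≤ (1 + T) ^ 2 - σ)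
    have i3 := mul_le_mul_of_nonneg_left hedge hP
    have i4 := mul_nonneg (by linarith : 0 ≤ 1 + T - σ) hββ
    have i5 := mul_nonneg (mul_nonneg hT.le hσ0.le) hαα
    rw [e]
    linarith
  · rw [gap_total_total]
    have i1 := mul_le_mul_of_nonneg_left hΔ' (by linarith : (0 : ℝ) ≤ T + 2)
    have i2 := mul_le_mul_of_nonneg_right hN2 hP
    exact mul_nonneg hT.le (by linarith)

end NearestReal

end Potts

namespace Potts

set_option linter.unusedSectionVars false

/-! ### Lower bounds for the unaffected colours and cross ratios. -/

section NearestColours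

variable {q : ℕ} {Q : Finset (Fin q)}

lemma cNN_eq (hq : 7 ≤ q) : cNN q = 1 / (1 + nnRatio ((q : ℝ) - 5)) := by
  have h1 : (7 : ℝ) ≤ q := by exact_mod_cast hq
  have hu : ((q : ℝ) - 5) ≠ 0 := by linarith
  have : 1 + nnRatio ((q : ℝ) - 5) =
    ((q : ℝ) ^ 4 - 21 * (q : ℝ) ^ 3 + 168 * (q : ℝ) ^ 2 - 609 * (q : ℝ) + 847) /
      ((q : ℝ) - 5) ^ 3 := by
    rw [nnRatio]; field_simp; ring
  rw [this, one_div_div, cNN]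

section Sums

variable {u γ₁ γ₂ γ₃ : ℝ} {g₁ g₂ g₃ : Fin q → ℝ}

/-- At least u + 1 terms of size (u - 1)γ/u plus a total excess γ/u give ((u - 1)(u + 1) + 1)/u = u
times γ. -/
lemma sum_ge_of_excess (hu : 0 < u) (hQ : u + 1 ≤ Q.card) (hγ : 0 ≤ (u - 1) * γ₁)
    (h : γ₁ ≤ ∑ b ∈ Q, (u * g₁ b - (u - 1) * γ₁)) : u * γ₁ ≤ ∑ b ∈ Q, g₁ b := by
  rw [Finset.sum_sub_distrib, Finset.sum_const, nsmul_eq_mul, ← Finset.mul_sum] at h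
  have := mul_le_mul_of_nonneg_right hQ hγ
  refine le_of_mul_le_mul_left (a := u) ?_ hu
  nlinarith

lemma sum_mul_ge_of_excess (hu : 1 ≤ u) (hQ : u + 1 ≤ Q.card) (hγ₁ : 0 ≤ γ₁) (hγ₂ : 0 ≤ γ₂)
    (h1 : γ₁ ≤ ∑ b ∈ Q, (u * g₁ b - (u - 1) * γ₁)) (h2 : γ₂ ≤ ∑ b ∈ Q, (u * g₂ b - (u - 1) * γ₂))
    (n1 : ∀ b ∈ Q, 0 ≤ u * g₁ b - (u - 1) * γ₁) (n2 : ∀ b ∈ Q, 0 ≤ u * g₂ b - (u - 1) * γ₂) :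
    (u - 1) * (u ^ 2 + 1) / u ^ 2 * (γ₁ * γ₂) ≤ ∑ b ∈ Q, g₁ b * g₂ b := by
  have hv : 0 ≤ u - 1 := by linarith
  have h12 := mul_nonneg hγ₁ hγ₂
  have key : ∑ b ∈ Q, ((u - 1) ^ 2 * (γ₁ * γ₂) + (u - 1) * γ₂ * (u * g₁ b - (u - 1) * γ₁) +
      (u - 1) * γ₁ * (u * g₂ b - (u - 1) * γ₂)) ≤ ∑ b ∈ Q, u ^ 2 * (g₁ b * g₂ b) := by
    refine Finset.sum_le_sum fun b hb => ?_
    have := mul_nonneg (n1 b hb) (n2 b hb)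
    linarith
  rw [Finset.sum_add_distrib, Finset.sum_add_distrib, Finset.sum_const, nsmul_eq_mul,
    ← Finset.mul_sum, ← Finset.mul_sum, ← Finset.mul_sum] at key
  have k1 := mul_le_mul_of_nonneg_left h1 (mul_nonneg hv hγ₂)
  have k2 := mul_le_mul_of_nonneg_left h2 (mul_nonneg hv hγ₁)
  have k3 := mul_le_mul_of_nonneg_right hQ (mul_nonneg (sq_nonneg (u - 1)) h12)
  rw [div_mul_eq_mul_div, div_le_iff₀ (by positivity)]
  linarith

lemma sum_mul_mul_ge_of_excess (hu : 1 ≤ u) (hQ : u + 1 ≤ Q.card) (hγ₁ : 0 ≤ γ₁) (hγ₂ : 0 ≤ γ₂)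
    (hγ₃ : 0 ≤ γ₃)
    (h1 : γ₁ ≤ ∑ b ∈ Q, (u * g₁ b - (u - 1) * γ₁)) (h2 : γ₂ ≤ ∑ b ∈ Q, (u * g₂ b - (u - 1) * γ₂))
    (h3 : γ₃ ≤ ∑ b ∈ Q, (u * g₃ b - (u - 1) * γ₃))
    (n1 : ∀ b ∈ Q, 0 ≤ u * g₁ b - (u - 1) * γ₁) (n2 : ∀ b ∈ Q, 0 ≤ u * g₂ b - (u - 1) * γ₂)
    (n3 : ∀ b ∈ Q, 0 ≤ u * g₃ b - (u - 1) * γ₃) :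
    nnRatio u * (γ₁ * (γ₂ * γ₃)) ≤ ∑ b ∈ Q, g₁ b * (g₂ b * g₃ b) := by
  have hv : 0 ≤ u - 1 := by linarith
  have h12 := mul_nonneg hγ₁ hγ₂
  have h13 := mul_nonneg hγ₁ hγ₃
  have h23 := mul_nonneg hγ₂ hγ₃
  have h123 := mul_nonneg hγ₁ h23
  -- Each factor times u is (u - 1)γ plus a nonnegative excess. The product is expanded to first
  -- order, dropping products of excesses; the coefficient (u - 1)³(u + 1) + 3(u - 1)² is the
  -- numerator of `nnRatio`.
  have key : ∑ b ∈ Q, ((u - 1) ^ 3 * (γ₁ * (γ₂ * γ₃)) +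
      (u - 1) ^ 2 * (γ₂ * γ₃) * (u * g₁ b - (u - 1) * γ₁) +
      (u - 1) ^ 2 * (γ₁ * γ₃) * (u * g₂ b - (u - 1) * γ₂) +
      (u - 1) ^ 2 * (γ₁ * γ₂) * (u * g₃ b - (u - 1) * γ₃)) ≤
      ∑ b ∈ Q, u ^ 3 * (g₁ b * (g₂ b * g₃ b)) := by
    refine Finset.sum_le_sum fun b hb => ?_
    have m12 := mul_nonneg (n1 b hb) (n2 b hb)
    have m13 := mul_nonneg (n1 b hb) (n3 b hb)
    have m23 := mul_nonneg (n2 b hb) (n3 b hb)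
    have m123 := mul_nonneg m12 (n3 b hb)
    have p12 := mul_nonneg m12 (mul_nonneg hv hγ₃)
    have p13 := mul_nonneg m13 (mul_nonneg hv hγ₂)
    have p23 := mul_nonneg m23 (mul_nonneg hv hγ₁)
    linarith
  rw [Finset.sum_add_distrib, Finset.sum_add_distrib, Finset.sum_add_distrib, Finset.sum_const,
    nsmul_eq_mul, ← Finset.mul_sum, ← Finset.mul_sum, ← Finset.mul_sum, ← Finset.mul_sum] at key
  have hv2 := sq_nonneg (u - 1)
  have k1 := mul_le_mul_of_nonneg_left h1 (mul_nonneg hv2 h23)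
  have k2 := mul_le_mul_of_nonneg_left h2 (mul_nonneg hv2 h13)
  have k3 := mul_le_mul_of_nonneg_left h3 (mul_nonneg hv2 h12)
  have k4 := mul_le_mul_of_nonneg_right hQ (mul_nonneg (pow_nonneg hv 3) h123)
  rw [nnRatio, div_mul_eq_mul_div, div_le_iff₀ (by positivity)]
  linarith

end Sums

/-- The responses of a hexagon to two colours of one of its sites have a cross ratio close to
one. -/
lemma hexWeight_cross (hq : 7 ≤ q) {B : Finset (Fin q)} (hB : B.card ≤ 4) {x y a b : Fin q}
    (hax : a ≠ x) (hay : a ≠ y) (hbx : b ≠ x) (hby : b ≠ y) :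
    (1 - 1 / ((q : ℝ) - 5) ^ 2) * (hexWeight (insert x B) a * hexWeight (insert y B) b) ≤
      hexWeight (insert x B) b * hexWeight (insert y B) a := by
  have h1 : (7 : ℝ) ≤ q := by exact_mod_cast hq
  have h2 : (B.card : ℝ) ≤ 4 := by exact_mod_cast hB
  have hu : (0 : ℝ) < ((q : ℝ) - 5) ^ 2 := pow_pos (by linarith) 2
  rw [one_sub_div hu.ne', div_mul_eq_mul_div, div_le_iff₀ hu]
  simp only [hexWeight_eq_ite, Finset.mem_insert, hax, hay, hbx, hby, false_or,
    Finset.card_insert_eq_ite]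
  -- The critical ratio is (G + 1)(G - 1)/G² with G = q - |B| - 1 = u + m ≥ u.
  obtain ⟨m, hm⟩ : ∃ m : ℝ, (B.card : ℝ) = 4 - m := ⟨4 - B.card, by ring⟩
  obtain ⟨u, hu'⟩ : ∃ u : ℝ, (q : ℝ) = u + 5 := ⟨q - 5, by ring⟩
  have hm0 : 0 ≤ m := by linarith
  have hu2 : 2 ≤ u := by linarith
  have hum := mul_nonneg hm0 (by linarith : 0 ≤ u)
  have hmm := mul_nonneg hm0 hm0
  split_ifs <;> push_cast <;> rw [hm, hu'] <;> ring_nf <;> nlinarith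

end NearestColours

end Potts

namespace Potts

set_option linter.unusedSectionVars false

/-! ### Nearest neighbours: from weights to variation distance. -/

section NearestVariation

variable {q : ℕ} {Q : Finset (Fin q)} {w w' : Fin q → ℝ} {x y : Fin q}

/-- The best event contains y, allowed only before the change, and avoids x, allowed only after it;
what remains is a choice of unaffected colours. -/
lemma tvDist_le_of_gap {T : ℝ} (hT : 0 < T) (hw : ∀ a, 0 ≤ w a) (hw' : ∀ a, 0 ≤ w' a)
    (hx : x ∉ Q) (hy : y ∉ Q) (h0 : ∀ a ∉ Q, a ≠ y → w a = 0) (h0' : ∀ a ∉ Q, a ≠ x → w' a = 0)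
    (hQ : 0 < ∑ a ∈ Q, w a) (hQ' : 0 < ∑ a ∈ Q, w' a)
    (h : ∀ A : Finset (Fin q), 0 ≤ gap T (∑ a ∈ Q ∩ A, w a) (∑ a ∈ Q \ A, w a)
      (∑ a ∈ Q ∩ A, w' a) (∑ a ∈ Q \ A, w' a) (∑ a ∈ Q, w a - T * w y)
      (∑ a ∈ Q, w' a - T * w' x)) :
    tvDist (normalized w) (normalized w') ≤ 1 / (1 + T) := by
  have key : ∀ (f : Fin q → ℝ) (z : Fin q), z ∉ Q → (∀ a ∉ Q, a ≠ z → f a = 0) →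
      ∀ A : Finset (Fin q), ∑ a ∈ A, f a = (∑ a ∈ Q ∩ A, f a) + if z ∈ A then f z else 0 := by
    intro f z hz hf A
    rw [← Finset.sum_inter_add_sum_sdiff A Q f, Finset.inter_comm]
    congr 1
    have : ∀ a ∈ A \ Q, f a = if a = z then f z else 0 := by
      intro a ha
      split_ifs with h1
      · rw [h1]
      · exact hf a (Finset.mem_sdiff.1 ha).2 h1
    rw [Finset.sum_congr rfl this, Finset.sum_ite_eq']
    simp [hz]
  have hZ : ∑ a, w a = w y + ∑ a ∈ Q, w a := by
    rw [key w y hy h0 Finset.univ]; simp [add_comm]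
  have hZ' : ∑ a, w' a = w' x + ∑ a ∈ Q, w' a := by
    rw [key w' x hx h0' Finset.univ]; simp [add_comm]
  refine tvDist_normalized_le (by rw [hZ]; linarith [hw y]) (by rw [hZ']; linarith [hw' x])
    fun A => ?_
  have hA := h A
  rw [hZ, hZ', key w y hy h0, key w' x hx h0']
  have e := Finset.sum_inter_add_sum_sdiff Q A w
  have e' := Finset.sum_inter_add_sum_sdiff Q A w'
  rw [← e, ← e'] at hA
  rw [← e] at hQ
  rw [← e'] at hQ'
  rw [← e, ← e', ← add_assoc, ← add_assoc]
  have hp : 0 < w y + ∑ a ∈ Q ∩ A, w a + ∑ a ∈ Q \ A, w a := by linarith [hw y]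
  have hp' : 0 < w' x + ∑ a ∈ Q ∩ A, w' a + ∑ a ∈ Q \ A, w' a := by linarith [hw' x]
  refine le_trans (sub_le_sub ?_ ?_) (sub_div_le_of_gap hT hp hp' hA)
  · refine div_le_div_of_nonneg_right ?_ hp.le
    split_ifs <;> linarith [hw y]
  · refine div_le_div_of_nonneg_right ?_ hp'.le
    split_ifs <;> linarith [hw' x]

lemma mul_sum_mul_sum_le {c : ℝ} (h : ∀ a ∈ Q, ∀ b ∈ Q, c * (w a * w' b) ≤ w b * w' a)
    (A : Finset (Fin q)) :
    c * ((∑ a ∈ Q ∩ A, w a) * ∑ a ∈ Q \ A, w' a) ≤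
      (∑ a ∈ Q ∩ A, w' a) * ∑ a ∈ Q \ A, w a := by
  rw [Finset.sum_mul_sum, Finset.sum_mul_sum, Finset.mul_sum]
  refine Finset.sum_le_sum fun a ha => ?_
  rw [Finset.mul_sum]
  refine Finset.sum_le_sum fun b hb => ?_
  have := h a (Finset.mem_inter.1 ha).1 b (Finset.mem_sdiff.1 hb).1
  linarith

variable {u : ℝ}

lemma tvDist_le_of_same (hu : 2 ≤ u) (hw : ∀ a, 0 ≤ w a) (hw' : ∀ a, 0 ≤ w' a)
    (hx : x ∉ Q) (hy : y ∉ Q) (h0 : ∀ a ∉ Q, a ≠ y → w a = 0) (h0' : ∀ a ∉ Q, a ≠ x → w' a = 0)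
    (hQ : 0 < ∑ a ∈ Q, w a) (hQ' : 0 < ∑ a ∈ Q, w' a) {ε L ℓ : ℝ} (hε : 0 ≤ ε)
    (hεu : ε ≤ (2 * u ^ 2 - 1) / u ^ 4) (hL : nnRatio u ≤ L)
    (hLℓ : nnRatio u ≤ L * (1 - (1 + nnRatio u) * ε) + (1 + nnRatio u) * ε * ℓ)
    (hM : nnRatio u * w y ≤ ∑ a ∈ Q, w a) (hM' : L * w' x ≤ ∑ a ∈ Q, w' a)
    (hℓ : ∀ a ∈ Q, ℓ * w' x ≤ w' a)
    (h : ∀ a ∈ Q, ∀ b ∈ Q, (1 - ε) * (w a * w' b) ≤ w b * w' a) :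
    tvDist (normalized w) (normalized w') ≤ 1 / (1 + nnRatio u) := by
  have hT := nnRatio_pos hu
  have hN1 := nnRatio_mul_le_one hu
  have hN2 := nnRatio_mul_le_two hu
  set T := nnRatio u
  have hε1 : (1 + T) * ε ≤ 1 :=
    (mul_le_mul_of_nonneg_left hεu (by linarith)).trans hN1
  have hε2 : (T + 2) * ε ≤ 2 :=
    (mul_le_mul_of_nonneg_left hεu (by linarith)).trans hN2
  refine tvDist_le_of_gap hT hw hw' hx hy h0 h0' hQ hQ' fun A => ?_
  have e := Finset.sum_inter_add_sum_sdiff Q A w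
  have e' := Finset.sum_inter_add_sum_sdiff Q A w'
  have nn : ∀ P : Finset (Fin q), 0 ≤ ∑ a ∈ P, w a := fun P => Finset.sum_nonneg fun a _ => hw a
  have nn' : ∀ P : Finset (Fin q), 0 ≤ ∑ a ∈ P, w' a := fun P => Finset.sum_nonneg fun a _ => hw' a
  have hxT := mul_le_mul_of_nonneg_right hL (hw' x)
  have hTx := mul_nonneg hT.le (hw' x)
  have hTy := mul_nonneg hT.le (hw y)
  refine gap_nonneg_of_le hT (nn _) (nn _) (nn' _) (nn' _) (by linarith) (by linarith)
    (by linarith) (by linarith) hε1 hε2 (mul_sum_mul_sum_le h A) ?_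
  -- If the event contains an unaffected colour, its weight is at least ℓ times that of x, which
  -- makes the complementary weight small enough; otherwise the condition is void.
  rcases (Q ∩ A).eq_empty_or_nonempty with hA | ⟨a, ha⟩
  · rw [hA]; simp
  · refine mul_le_mul_of_nonneg_left ?_ (nn _)
    have h1 : ℓ * w' x ≤ ∑ a ∈ Q ∩ A, w' a :=
      (hℓ a (Finset.mem_inter.1 ha).1).trans
        (Finset.single_le_sum (fun b _ => hw' b) ha)
    have h2 := mul_le_mul_of_nonneg_left h1 (mul_nonneg (by linarith : 0 ≤ 1 + T) hε)
    have h3 := mul_le_mul_of_nonneg_left hM' (by linarith : 0 ≤ 1 - (1 + T) * ε)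
    have h4 := mul_le_mul_of_nonneg_right hLℓ (hw' x)
    have h5 : ∑ a ∈ Q \ A, w' a = ∑ a ∈ Q, w' a - ∑ a ∈ Q ∩ A, w' a := by linarith
    rw [h5]
    linarith

/-- The cross ratio may have two defects here, but both affected weights obey the better two-factor
ratio, leaving slack on both sides. -/
lemma tvDist_le_of_opposite (hu : 2 ≤ u) (hw : ∀ a, 0 ≤ w a) (hw' : ∀ a, 0 ≤ w' a)
    (hx : x ∉ Q) (hy : y ∉ Q) (h0 : ∀ a ∉ Q, a ≠ y → w a = 0) (h0' : ∀ a ∉ Q, a ≠ x → w' a = 0)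
    (hQ : 0 < ∑ a ∈ Q, w a) (hQ' : 0 < ∑ a ∈ Q, w' a)
    (hM : (u - 1) * (u ^ 2 + 1) / u ^ 2 * w y ≤ ∑ a ∈ Q, w a)
    (hM' : (u - 1) * (u ^ 2 + 1) / u ^ 2 * w' x ≤ ∑ a ∈ Q, w' a)
    (h : ∀ a ∈ Q, ∀ b ∈ Q, (1 - 1 / u ^ 2) ^ 2 * (w a * w' b) ≤ w b * w' a) :
    tvDist (normalized w) (normalized w') ≤ 1 / (1 + nnRatio u) := by
  have hT := nnRatio_pos hu
  have hσ := one_sub_nnExcess_mul hu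
  have hσ1 := nnExcess_le_one hu
  refine tvDist_le_of_gap hT hw hw' hx hy h0 h0' hQ hQ' fun A => ?_
  have e := Finset.sum_inter_add_sum_sdiff Q A w
  have e' := Finset.sum_inter_add_sum_sdiff Q A w'
  have nn : ∀ P : Finset (Fin q), 0 ≤ ∑ a ∈ P, w a := fun P => Finset.sum_nonneg fun a _ => hw a
  have nn' : ∀ P : Finset (Fin q), 0 ≤ ∑ a ∈ P, w' a := fun P => Finset.sum_nonneg fun a _ => hw' a
  have hTx := mul_nonneg hT.le (hw' x)
  have hTy := mul_nonneg hT.le (hw y)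
  have k1 := mul_le_mul_of_nonneg_left hM (by linarith : 0 ≤ 1 - nnExcess u)
  have k2 := mul_le_mul_of_nonneg_left hM' (by linarith : 0 ≤ 1 - nnExcess u)
  rw [← mul_assoc, hσ] at k1 k2
  refine gap_nonneg_of_opposite hu (nn _) (nn _) (nn' _) (nn' _) ?_ (by linarith) ?_ (by linarith)
    (mul_sum_mul_sum_le h A)
  · rw [e]; linarith
  · rw [e']; linarith

end NearestVariation

/-! ### The weights seen when a nearest neighbour changes. -/

section NearestColours

variable {q : ℕ}

/-- The weight of the colours of a site, its three neighbours having colours `t₁`, `t₂` and `x`. -/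
noncomputable def nnWeight (t₁ t₂ : Fin q) (S B₀ B₂ : Finset (Fin q)) (x a : Fin q) : ℝ :=
  if a = t₁ ∨ a = t₂ ∨ a = x then 0
  else hexWeight S a * (hexWeight (insert x B₀) a * hexWeight (insert x B₂) a)

variable {t₁ t₂ x y : Fin q} {S B₀ B₂ : Finset (Fin q)}

lemma hexWeight_insert_eq {B : Finset (Fin q)} (h : x ∈ B ↔ y ∈ B) {b : Fin q} (hx : b ≠ x)
    (hy : b ≠ y) : hexWeight (insert x B) b = hexWeight (insert y B) b := by
  simp only [hexWeight_eq_ite, Finset.mem_insert, hx, hy, false_or, Finset.card_insert_eq_ite, h]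

lemma card_insert_le_five {B : Finset (Fin q)} (hB : B.card ≤ 4) (z : Fin q) :
    (insert z B).card ≤ 5 := (Finset.card_insert_le z B).trans (by omega)

lemma nnWeight_nonneg (hq : 7 ≤ q) (hS : S.card ≤ 5) (h0 : B₀.card ≤ 4) (h2 : B₂.card ≤ 4)
    (x a : Fin q) : 0 ≤ nnWeight t₁ t₂ S B₀ B₂ x a := by
  unfold nnWeight
  split_ifs
  · exact le_rfl
  · exact (mul_pos (hexWeight_pos hq hS a) (mul_pos
      (hexWeight_pos hq (card_insert_le_five h0 x) a)
      (hexWeight_pos hq (card_insert_le_five h2 x) a))).le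

lemma nnWeight_le (hq : 7 ≤ q) (hS : S.card ≤ 5) (h0 : B₀.card ≤ 4) (h2 : B₂.card ≤ 4)
    (x a : Fin q) : nnWeight t₁ t₂ S B₀ B₂ x a ≤
      hexWeight S a * (hexWeight (insert x B₀) a * hexWeight (insert x B₂) a) := by
  unfold nnWeight
  split_ifs
  · exact (mul_pos (hexWeight_pos hq hS a) (mul_pos
      (hexWeight_pos hq (card_insert_le_five h0 x) a)
      (hexWeight_pos hq (card_insert_le_five h2 x) a))).le
  · exact le_rfl

/-- The colours that are not affected by the change from `x` to `y`. -/
def unaffected (t₁ t₂ x y : Fin q) : Finset (Fin q) := {t₁, t₂, x, y}ᶜ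

lemma mem_unaffected {a : Fin q} :
    a ∈ unaffected t₁ t₂ x y ↔ a ≠ t₁ ∧ a ≠ t₂ ∧ a ≠ x ∧ a ≠ y := by
  simp [unaffected]

lemma card_compl_unaffected : (unaffected t₁ t₂ x y)ᶜ.card ≤ 4 := by
  rw [unaffected, compl_compl]; exact Finset.card_le_four

lemma nnWeight_of_mem {a : Fin q} (ha : a ∈ unaffected t₁ t₂ x y) {z : Fin q}
    (hz : z = x ∨ z = y) : nnWeight t₁ t₂ S B₀ B₂ z a =
      hexWeight S a * (hexWeight (insert z B₀) a * hexWeight (insert z B₂) a) := by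
  rw [mem_unaffected] at ha
  rw [nnWeight, if_neg]
  rcases hz with rfl | rfl <;> tauto

section Lower

variable (hq : 7 ≤ q) (hS : S.card ≤ 5) (h0 : B₀.card ≤ 4) (h2 : B₂.card ≤ 4)
include hq hS h0 h2

lemma sum_nnWeight (P : Finset (Fin q)) (hP : P ⊆ unaffected t₁ t₂ x y) {z : Fin q}
    (hz : z = x ∨ z = y) : ∑ a ∈ P, nnWeight t₁ t₂ S B₀ B₂ z a = ∑ a ∈ P,
      hexWeight S a * (hexWeight (insert z B₀) a * hexWeight (insert z B₂) a) :=
  Finset.sum_congr rfl fun _ ha => nnWeight_of_mem (hP ha) hz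

/-- At most four colours are affected, so all three hexagon factors have enough total excess over
their values at `c`. -/
lemma nnRatio_mul_nnWeight_le {z : Fin q} (hz : z = x ∨ z = y) (c : Fin q) :
    nnRatio ((q : ℝ) - 5) * nnWeight t₁ t₂ S B₀ B₂ z c ≤
      ∑ a ∈ unaffected t₁ t₂ x y, nnWeight t₁ t₂ S B₀ B₂ z a := by
  have h1 : (7 : ℝ) ≤ q := by exact_mod_cast hq
  have c0 := card_insert_le_five h0 z
  have c2 := card_insert_le_five h2 z
  have hQ := card_compl_unaffected (t₁ := t₁) (t₂ := t₂) (x := x) (y := y)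
  have hc := card_of_card_compl_le hQ
  push_cast at hc
  rw [sum_nnWeight hq hS h0 h2 _ le_rfl hz]
  refine (mul_le_mul_of_nonneg_left (nnWeight_le hq hS h0 h2 z c)
    (nnRatio_pos (by linarith)).le).trans ?_
  have e : (q : ℝ) - 6 = (q : ℝ) - 5 - 1 := by ring
  have s : ∀ {R : Finset (Fin q)}, R.card ≤ 5 → _ := fun hR => sum_hexWeight_sub hq hR hQ c
  have r : ∀ {R : Finset (Fin q)}, R.card ≤ 5 → ∀ b ∈ unaffected t₁ t₂ x y,
      0 ≤ ((q : ℝ) - 5) * hexWeight R b - ((q : ℝ) - 6) * hexWeight R c := fun hR b _ =>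
    sub_nonneg.2 (hexWeight_ratio hq hR c b)
  rw [e] at s r
  exact sum_mul_mul_ge_of_excess (by linarith) (by linarith) (hexWeight_pos hq hS c).le
    (hexWeight_pos hq c0 c).le (hexWeight_pos hq c2 c).le (s hS) (s c0) (s c2) (r hS) (r c0) (r c2)

/-- A colour absent from a hexagon has the smallest factor there, so that hexagon costs nothing and
only the other two enter the ratio. -/
lemma two_mul_nnWeight_le₂ {z : Fin q} (hz : z = x ∨ z = y) {c : Fin q} (hc : c ∉ insert z B₂) :
    ((q : ℝ) - 5 - 1) * (((q : ℝ) - 5) ^ 2 + 1) / ((q : ℝ) - 5) ^ 2 *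
      nnWeight t₁ t₂ S B₀ B₂ z c ≤
      ∑ a ∈ unaffected t₁ t₂ x y, nnWeight t₁ t₂ S B₀ B₂ z a := by
  have h1 : (7 : ℝ) ≤ q := by exact_mod_cast hq
  have c0 := card_insert_le_five h0 z
  have c2 := card_insert_le_five h2 z
  have hQ := card_compl_unaffected (t₁ := t₁) (t₂ := t₂) (x := x) (y := y)
  have hc' := card_of_card_compl_le hQ
  push_cast at hc'
  rw [sum_nnWeight hq hS h0 h2 _ le_rfl hz]
  have hL : 0 ≤ ((q : ℝ) - 5 - 1) * (((q : ℝ) - 5) ^ 2 + 1) / ((q : ℝ) - 5) ^ 2 :=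
    div_nonneg (mul_nonneg (by linarith) (by positivity)) (by positivity)
  refine (mul_le_mul_of_nonneg_left (nnWeight_le hq hS h0 h2 z c) hL).trans ?_
  have e : (q : ℝ) - 6 = (q : ℝ) - 5 - 1 := by ring
  have s : ∀ {R : Finset (Fin q)}, R.card ≤ 5 → _ := fun hR => sum_hexWeight_sub hq hR hQ c
  have r : ∀ {R : Finset (Fin q)}, R.card ≤ 5 → ∀ b ∈ unaffected t₁ t₂ x y,
      0 ≤ ((q : ℝ) - 5) * hexWeight R b - ((q : ℝ) - 6) * hexWeight R c := fun hR b _ =>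
    sub_nonneg.2 (hexWeight_ratio hq hR c b)
  rw [e] at s r
  have k := sum_mul_ge_of_excess (by linarith) (by linarith) (hexWeight_pos hq hS c).le
    (hexWeight_pos hq c0 c).le (s hS) (s c0) (r hS) (r c0)
  have k2 := mul_le_mul_of_nonneg_right k (hexWeight_pos hq c2 c).le
  rw [Finset.sum_mul] at k2
  calc _ = _ := by ring
    _ ≤ _ := k2
    _ ≤ _ := Finset.sum_le_sum fun b _ => by
      have := mul_le_mul_of_nonneg_left (hexWeight_le_of_notMem hc b)
        (mul_pos (hexWeight_pos hq hS b) (hexWeight_pos hq c0 b)).le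
      linarith

lemma nnWeight_swap (z a : Fin q) : nnWeight t₁ t₂ S B₀ B₂ z a = nnWeight t₁ t₂ S B₂ B₀ z a := by
  simp only [nnWeight, mul_comm (hexWeight (insert z B₀) a)]

lemma two_mul_nnWeight_le₀ {z : Fin q} (hz : z = x ∨ z = y) {c : Fin q} (hc : c ∉ insert z B₀) :
    ((q : ℝ) - 5 - 1) * (((q : ℝ) - 5) ^ 2 + 1) / ((q : ℝ) - 5) ^ 2 *
      nnWeight t₁ t₂ S B₀ B₂ z c ≤
      ∑ a ∈ unaffected t₁ t₂ x y, nnWeight t₁ t₂ S B₀ B₂ z a := by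
  simp only [nnWeight_swap hq hS h0 h2]
  exact two_mul_nnWeight_le₂ hq hS h2 h0 hz hc

lemma one_mul_nnWeight_le {z : Fin q} (hz : z = x ∨ z = y) {c : Fin q} (hc0 : c ∉ insert z B₀)
    (hc2 : c ∉ insert z B₂) : ((q : ℝ) - 5) * nnWeight t₁ t₂ S B₀ B₂ z c ≤
      ∑ a ∈ unaffected t₁ t₂ x y, nnWeight t₁ t₂ S B₀ B₂ z a := by
  have h1 : (7 : ℝ) ≤ q := by exact_mod_cast hq
  have c0 := card_insert_le_five h0 z
  have c2 := card_insert_le_five h2 z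
  have hQ := card_compl_unaffected (t₁ := t₁) (t₂ := t₂) (x := x) (y := y)
  have hc' := card_of_card_compl_le hQ
  push_cast at hc'
  rw [sum_nnWeight hq hS h0 h2 _ le_rfl hz]
  refine (mul_le_mul_of_nonneg_left (nnWeight_le hq hS h0 h2 z c) (by linarith)).trans ?_
  have e : (q : ℝ) - 6 = (q : ℝ) - 5 - 1 := by ring
  have s := sum_hexWeight_sub hq hS hQ c
  rw [e] at s
  have k := sum_ge_of_excess (by linarith) (by linarith)
    (mul_nonneg (by linarith) (hexWeight_pos hq hS c).le) s
  have p0 := hexWeight_pos hq c0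
  have p2 := hexWeight_pos hq c2
  have k2 := mul_le_mul_of_nonneg_right k (mul_pos (p0 c) (p2 c)).le
  rw [Finset.sum_mul] at k2
  calc _ = _ := by ring
    _ ≤ _ := k2
    _ ≤ _ := Finset.sum_le_sum fun b _ => mul_le_mul_of_nonneg_left
      (mul_le_mul (hexWeight_le_of_notMem hc0 b) (hexWeight_le_of_notMem hc2 b) (p2 c).le (p0 b).le)
      (hexWeight_pos hq hS b).le

end Lower

end NearestColours

end Potts

namespace Potts

set_option linter.unusedSectionVars false

/-! ### Nearest neighbours: the upper bound by cases. -/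

section NearestColours

variable {q : ℕ} {t₁ t₂ x y : Fin q} {S B₀ B₂ : Finset (Fin q)}

lemma cNN_pos (hq : 7 ≤ q) : 0 < cNN q := by
  have h1 : (7 : ℝ) ≤ q := by exact_mod_cast hq
  have := nnRatio_pos (u := (q : ℝ) - 5) (by linarith)
  rw [cNN_eq hq]
  positivity

variable (hq : 7 ≤ q) (hS : S.card ≤ 5) (h0 : B₀.card ≤ 4) (h2 : B₂.card ≤ 4)
include hq hS h0 h2

lemma sum_nnWeight_pos {z : Fin q} (hz : z = x ∨ z = y) :
    0 < ∑ a ∈ unaffected t₁ t₂ x y, nnWeight t₁ t₂ S B₀ B₂ z a := by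
  rw [sum_nnWeight hq hS h0 h2 _ le_rfl hz]
  refine Finset.sum_pos (fun a _ => mul_pos (hexWeight_pos hq hS a) (mul_pos
      (hexWeight_pos hq (card_insert_le_five h0 z) a)
      (hexWeight_pos hq (card_insert_le_five h2 z) a))) ?_
  rw [← Finset.card_pos]
  have h1 := Finset.card_add_card_compl (unaffected t₁ t₂ x y)
  have h2 := card_compl_unaffected (t₁ := t₁) (t₂ := t₂) (x := x) (y := y)
  rw [Fintype.card_fin] at h1
  omega

lemma nnWeight_eq_zero {z z' : Fin q} (h : z = x ∧ z' = y ∨ z = y ∧ z' = x) :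
    ∀ a ∉ unaffected t₁ t₂ x y, a ≠ z' → nnWeight t₁ t₂ S B₀ B₂ z a = 0 := by
  intro a ha hz
  rw [mem_unaffected] at ha
  rw [nnWeight, if_pos]
  rcases h with ⟨rfl, rfl⟩ | ⟨rfl, rfl⟩ <;> tauto

lemma nnWeight_cross {c₀ c₂ : ℝ} (hc₂ : 0 ≤ c₂)
    (k0 : ∀ a ∈ unaffected t₁ t₂ x y, ∀ b ∈ unaffected t₁ t₂ x y,
      c₀ * (hexWeight (insert x B₀) a * hexWeight (insert y B₀) b) ≤
      hexWeight (insert x B₀) b * hexWeight (insert y B₀) a)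
    (k2 : ∀ a ∈ unaffected t₁ t₂ x y, ∀ b ∈ unaffected t₁ t₂ x y,
      c₂ * (hexWeight (insert x B₂) a * hexWeight (insert y B₂) b) ≤
      hexWeight (insert x B₂) b * hexWeight (insert y B₂) a) :
    ∀ a ∈ unaffected t₁ t₂ x y, ∀ b ∈ unaffected t₁ t₂ x y,
      c₀ * c₂ * (nnWeight t₁ t₂ S B₀ B₂ x a * nnWeight t₁ t₂ S B₀ B₂ y b) ≤
        nnWeight t₁ t₂ S B₀ B₂ x b * nnWeight t₁ t₂ S B₀ B₂ y a := by
  intro a ha b hb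
  rw [nnWeight_of_mem ha (Or.inl rfl), nnWeight_of_mem hb (Or.inl rfl),
    nnWeight_of_mem ha (Or.inr rfl), nnWeight_of_mem hb (Or.inr rfl)]
  have p : ∀ z c, 0 < hexWeight (insert z B₀) c := fun z =>
    hexWeight_pos hq (card_insert_le_five h0 z)
  have p' : ∀ z c, 0 < hexWeight (insert z B₂) c := fun z =>
    hexWeight_pos hq (card_insert_le_five h2 z)
  have pS := mul_pos (hexWeight_pos hq hS a) (hexWeight_pos hq hS b)
  have k := mul_le_mul (k0 a ha b hb) (k2 a ha b hb)
    (mul_nonneg hc₂ (mul_pos (p' x a) (p' y b)).le) (mul_pos (p x b) (p y a)).le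
  have := mul_le_mul_of_nonneg_left k pS.le
  linarith

/-- A hexagon responds on the unaffected colours only if exactly one of x, y is among its other
colours; the hypotheses make that colour y. -/
lemma tvDist_nnWeight_le_of_same (hxy : x ≠ y) (hB0 : x ∈ B₀ → y ∈ B₀) (hB2 : x ∈ B₂ → y ∈ B₂) :
    tvDist (normalized (nnWeight t₁ t₂ S B₀ B₂ x)) (normalized (nnWeight t₁ t₂ S B₀ B₂ y)) ≤
      cNN q := by
  have h1 : (7 : ℝ) ≤ q := by exact_mod_cast hq
  have hu : (2 : ℝ) ≤ (q : ℝ) - 5 := by linarith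
  have hu2 : (0 : ℝ) < ((q : ℝ) - 5) ^ 2 := by positivity
  have c0 := card_insert_le_five h0 y
  have c2 := card_insert_le_five h2 y
  have hx : x ∉ unaffected t₁ t₂ x y := fun h => (mem_unaffected.1 h).2.2.1 rfl
  have hy : y ∉ unaffected t₁ t₂ x y := fun h => (mem_unaffected.1 h).2.2.2 rfl
  have hη0 : 0 ≤ 1 - 1 / ((q : ℝ) - 5) ^ 2 := by
    rw [sub_nonneg, div_le_one hu2]; nlinarith
  have eq_cross : ∀ {B : Finset (Fin q)}, (x ∈ B ↔ y ∈ B) →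
      ∀ a ∈ unaffected t₁ t₂ x y, ∀ b ∈ unaffected t₁ t₂ x y,
      1 * (hexWeight (insert x B) a * hexWeight (insert y B) b) ≤
      hexWeight (insert x B) b * hexWeight (insert y B) a := by
    intro B hB a ha b hb
    rw [mem_unaffected] at ha hb
    rw [hexWeight_insert_eq hB ha.2.2.1 ha.2.2.2, hexWeight_insert_eq hB hb.2.2.1 hb.2.2.2]
    linarith
  have ne_cross : ∀ {B : Finset (Fin q)}, B.card ≤ 4 →
      ∀ a ∈ unaffected t₁ t₂ x y, ∀ b ∈ unaffected t₁ t₂ x y,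
      (1 - 1 / ((q : ℝ) - 5) ^ 2) * (hexWeight (insert x B) a * hexWeight (insert y B) b) ≤
      hexWeight (insert x B) b * hexWeight (insert y B) a := by
    intro B hB a ha b hb
    rw [mem_unaffected] at ha hb
    exact hexWeight_cross hq hB ha.2.2.1 ha.2.2.2 hb.2.2.1 hb.2.2.2
  have ratio : ∀ {R : Finset (Fin q)}, R.card ≤ 5 → ∀ a,
      ((q : ℝ) - 5 - 1) / ((q : ℝ) - 5) * hexWeight R x ≤ hexWeight R a := by
    intro R hR a
    rw [div_mul_eq_mul_div, div_le_iff₀ (by linarith)]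
    have := hexWeight_ratio hq hR x a
    linarith
  have hρ : 0 ≤ ((q : ℝ) - 5 - 1) / ((q : ℝ) - 5) := div_nonneg (by linarith) (by linarith)
  have pS := hexWeight_pos hq hS
  have p0 := hexWeight_pos hq c0
  have p2 := hexWeight_pos hq c2
  have n0 := fun a => mul_nonneg hρ (p0 a).le
  have n2 := fun a => mul_nonneg hρ (p2 a).le
  have main := fun (ε L ℓ : ℝ) => tvDist_le_of_same (Q := unaffected t₁ t₂ x y) (x := x) (y := y)
    (ε := ε) (L := L) (ℓ := ℓ) hu
    (nnWeight_nonneg (t₁ := t₁) (t₂ := t₂) hq hS h0 h2 x)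
    (nnWeight_nonneg (t₁ := t₁) (t₂ := t₂) hq hS h0 h2 y) hx hy
    (nnWeight_eq_zero hq hS h0 h2 (Or.inl ⟨rfl, rfl⟩))
    (nnWeight_eq_zero hq hS h0 h2 (Or.inr ⟨rfl, rfl⟩))
    (sum_nnWeight_pos hq hS h0 h2 (Or.inl rfl)) (sum_nnWeight_pos hq hS h0 h2 (Or.inr rfl))
  have hM := nnRatio_mul_nnWeight_le (t₁ := t₁) (t₂ := t₂) hq hS h0 h2
    (Or.inl rfl : x = x ∨ x = y) y
  have hM' := nnRatio_mul_nnWeight_le (t₁ := t₁) (t₂ := t₂) hq hS h0 h2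
    (Or.inr rfl : y = x ∨ y = y) x
  have hle := nnWeight_le (t₁ := t₁) (t₂ := t₂) hq hS h0 h2 y x
  rw [cNN_eq hq]
  have hε0 : 0 ≤ 1 / ((q : ℝ) - 5) ^ 2 := by positivity
  have hε2 : (2 * ((q : ℝ) - 5) ^ 2 - 1) / ((q : ℝ) - 5) ^ 4 =
      1 / ((q : ℝ) - 5) ^ 2 * (1 + (1 - 1 / ((q : ℝ) - 5) ^ 2)) := by
    have : ((q : ℝ) - 5) ≠ 0 := by linarith
    field_simp; ring
  -- With k responding hexagons the defect ε is 1 - (1 - 1/u²)^k. In each of them x remains absent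
  -- after the change and has the least factor, so L uses only 3 - k factors. For k > 0, ℓ = ((u -
  -- 1)/u)^(3 - k); for k = 0 the value ℓ = 0 suffices because ε = 0.
  by_cases e0 : x ∈ B₀ ↔ y ∈ B₀ <;> by_cases e2 : x ∈ B₂ ↔ y ∈ B₂
  · refine main 0 (nnRatio ((q : ℝ) - 5)) 0 le_rfl ?_ le_rfl (by simp) hM hM'
      ?_ ?_
    · rw [hε2]; exact mul_nonneg hε0 (by linarith)
    · intro a _
      rw [zero_mul]
      exact nnWeight_nonneg hq hS h0 h2 y a
    · have := nnWeight_cross hq hS h0 h2 zero_le_one (eq_cross e0) (eq_cross e2)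
      simpa using this
  · have hx2 : x ∉ insert y B₂ := by rw [Finset.mem_insert]; tauto
    refine main _ _ _ hε0 ?_ (nnRatio_le_two hu) (nnRatio_le_one_shift hu) hM
      (two_mul_nnWeight_le₂ hq hS h0 h2 (Or.inr rfl) hx2) ?_ ?_
    · rw [hε2]; exact le_mul_of_one_le_right hε0 (by linarith)
    · intro a ha
      rw [nnWeight_of_mem ha (Or.inr rfl)]
      refine (mul_le_mul_of_nonneg_left hle (sq_nonneg _)).trans ?_
      have := mul_le_mul (ratio hS a) (mul_le_mul (ratio c0 a) (hexWeight_le_of_notMem hx2 a)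
        (p2 x).le (p0 a).le) (mul_nonneg (n0 x) (p2 x).le) (pS a).le
      linarith
    · have := nnWeight_cross (S := S) hq hS h0 h2 hη0 (eq_cross e0) (ne_cross h2)
      simpa using this
  · have hx0 : x ∉ insert y B₀ := by rw [Finset.mem_insert]; tauto
    refine main _ _ _ hε0 ?_ (nnRatio_le_two hu) (nnRatio_le_one_shift hu) hM
      (two_mul_nnWeight_le₀ hq hS h0 h2 (Or.inr rfl) hx0) ?_ ?_
    · rw [hε2]; exact le_mul_of_one_le_right hε0 (by linarith)
    · intro a ha
      rw [nnWeight_of_mem ha (Or.inr rfl)]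
      refine (mul_le_mul_of_nonneg_left hle (sq_nonneg _)).trans ?_
      have := mul_le_mul (ratio hS a) (mul_le_mul (hexWeight_le_of_notMem hx0 a) (ratio c2 a)
        (n2 x) (p0 a).le) (mul_nonneg (p0 x).le (n2 x)) (pS a).le
      linarith
    · have := nnWeight_cross (S := S) hq hS h0 h2 zero_le_one (ne_cross h0) (eq_cross e2)
      simpa using this
  · have hx0 : x ∉ insert y B₀ := by rw [Finset.mem_insert]; tauto
    have hx2 : x ∉ insert y B₂ := by rw [Finset.mem_insert]; tauto
    refine main _ _ _ ?_ le_rfl (nnRatio_le_self hu) (nnRatio_le_two_shifts hu) hM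
      (one_mul_nnWeight_le hq hS h0 h2 (Or.inr rfl) hx0 hx2) ?_ ?_
    · rw [hε2]; exact mul_nonneg hε0 (by linarith)
    · intro a ha
      rw [nnWeight_of_mem ha (Or.inr rfl)]
      refine (mul_le_mul_of_nonneg_left hle hρ).trans ?_
      have := mul_le_mul (ratio hS a) (mul_le_mul (hexWeight_le_of_notMem hx0 a)
        (hexWeight_le_of_notMem hx2 a) (p2 x).le (p0 a).le) (mul_pos (p0 x) (p2 x)).le (pS a).le
      linarith
    · have := nnWeight_cross (S := S) hq hS h0 h2 hη0 (ne_cross h0) (ne_cross h2)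
      have e : 1 - (2 * ((q : ℝ) - 5) ^ 2 - 1) / ((q : ℝ) - 5) ^ 4 =
          (1 - 1 / ((q : ℝ) - 5) ^ 2) * (1 - 1 / ((q : ℝ) - 5) ^ 2) := by
        rw [hε2]; ring
      rwa [e]

/-- Before the change y is absent from the second hexagon, and after it x is absent from the first,
so each affected colour has a minimal factor somewhere. -/
lemma tvDist_nnWeight_le_of_opposite (hxy : x ≠ y) (hx0 : x ∉ B₀) (hy2 : y ∉ B₂) :
    tvDist (normalized (nnWeight t₁ t₂ S B₀ B₂ x)) (normalized (nnWeight t₁ t₂ S B₀ B₂ y)) ≤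
      cNN q := by
  have h1 : (7 : ℝ) ≤ q := by exact_mod_cast hq
  have hu : (2 : ℝ) ≤ (q : ℝ) - 5 := by linarith
  have hu2 : (0 : ℝ) < ((q : ℝ) - 5) ^ 2 := by positivity
  have hη0 : 0 ≤ 1 - 1 / ((q : ℝ) - 5) ^ 2 := by
    rw [sub_nonneg, div_le_one hu2]; nlinarith
  have hx : x ∉ unaffected t₁ t₂ x y := fun h => (mem_unaffected.1 h).2.2.1 rfl
  have hy : y ∉ unaffected t₁ t₂ x y := fun h => (mem_unaffected.1 h).2.2.2 rfl
  have ne_cross : ∀ {B : Finset (Fin q)}, B.card ≤ 4 →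
      ∀ a ∈ unaffected t₁ t₂ x y, ∀ b ∈ unaffected t₁ t₂ x y,
      (1 - 1 / ((q : ℝ) - 5) ^ 2) * (hexWeight (insert x B) a * hexWeight (insert y B) b) ≤
      hexWeight (insert x B) b * hexWeight (insert y B) a := by
    intro B hB a ha b hb
    rw [mem_unaffected] at ha hb
    exact hexWeight_cross hq hB ha.2.2.1 ha.2.2.2 hb.2.2.1 hb.2.2.2
  rw [cNN_eq hq]
  refine tvDist_le_of_opposite (Q := unaffected t₁ t₂ x y) (x := x) (y := y) hu
    (nnWeight_nonneg hq hS h0 h2 x) (nnWeight_nonneg hq hS h0 h2 y) hx hy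
    (nnWeight_eq_zero hq hS h0 h2 (Or.inl ⟨rfl, rfl⟩))
    (nnWeight_eq_zero hq hS h0 h2 (Or.inr ⟨rfl, rfl⟩))
    (sum_nnWeight_pos hq hS h0 h2 (Or.inl rfl)) (sum_nnWeight_pos hq hS h0 h2 (Or.inr rfl))
    (two_mul_nnWeight_le₂ hq hS h0 h2 (Or.inl rfl) (by simp [hxy.symm, hy2]))
    (two_mul_nnWeight_le₀ hq hS h0 h2 (Or.inr rfl) (by simp [hxy, hx0])) ?_
  rw [sq (1 - _)]
  exact nnWeight_cross hq hS h0 h2 hη0 (ne_cross h0) (ne_cross h2)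

/-- Changing the colour of one nearest neighbour. -/
theorem tvDist_nearest_le (x y : Fin q) :
    tvDist (normalized (nnWeight t₁ t₂ S B₀ B₂ x)) (normalized (nnWeight t₁ t₂ S B₀ B₂ y)) ≤
      cNN q := by
  rcases eq_or_ne x y with rfl | hxy
  · exact tvDist_le fun A => by simpa using (cNN_pos hq).le
  by_cases hx0 : x ∈ B₀ → y ∈ B₀
  · by_cases hx2 : x ∈ B₂ → y ∈ B₂
    · exact tvDist_nnWeight_le_of_same hq hS h0 h2 hxy hx0 hx2
    · rw [Classical.not_imp] at hx2
      by_cases hy0 : y ∈ B₀ → x ∈ B₀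
      · rw [tvDist_comm]
        exact tvDist_nnWeight_le_of_same hq hS h0 h2 hxy.symm hy0 fun h => absurd h hx2.2
      · rw [Classical.not_imp] at hy0
        exact tvDist_nnWeight_le_of_opposite hq hS h0 h2 hxy hy0.2 hx2.2
  · rw [Classical.not_imp] at hx0
    rw [tvDist_comm]
    by_cases hy2 : y ∈ B₂ → x ∈ B₂
    · exact tvDist_nnWeight_le_of_same hq hS h0 h2 hxy.symm (fun h => absurd h hx0.2) hy2
    · rw [Classical.not_imp] at hy2
      exact tvDist_nnWeight_le_of_opposite hq hS h0 h2 hxy.symm hx0.2 hy2.2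

end NearestColours

end Potts

namespace Potts

set_option linter.unusedSectionVars false

/-! ### The local geometry of the hexagonal lattice. -/

section Frames

variable {r : ℤ}

/-- The neighbourhood of a site `i` of the hexagonal lattice: `c k` are the centres of the three
hexagons at `i`, `n k` its nearest neighbours, and the hexagon around `c k` consists of
`i`, `n k`, `n (k + 1)` and the three sites `m k l`. -/
structure Frame (i : Surv r) where
  c : Fin 3 → ℤ × ℤ
  n : Fin 3 → Surv r
  m : Fin 3 → Fin 3 → Surv r
  c_inj : ∀ k k', c k = c k' → k = k'
  mem_centres_iff : ∀ x, x ∈ centres r {i} ↔ ∃ k, x = c k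
  nn_iff : ∀ y, NN i y ↔ ∃ k, y = n k
  hex_iff : ∀ k (y : Surv r), y.1 ∈ nbrs (c k) ↔ y = i ∨ y = n k ∨ y = n (k + 1) ∨ ∃ l, y = m k l
  n_inj : ∀ k k', n k = n k' → k = k'
  m_inj : ∀ k l k' l', m k l = m k' l' → k = k' ∧ l = l'
  n_ne_m : ∀ k k' l, n k ≠ m k' l
  n_ne : ∀ k, n k ≠ i
  m_ne : ∀ k l, m k l ≠ i
  dist_n : ∀ k, dist i (n k) ≤ 2
  dist_m : ∀ k l, dist i (m k l) ≤ 2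

/-- The site at a given displacement. -/
def site (i : Surv r) (a b : ℤ) (h : ¬ IsCentre r (i.1.1 + a, i.1.2 + b)) : Surv r :=
  ⟨(i.1.1 + a, i.1.2 + b), h⟩

@[simp] lemma site_fst (i : Surv r) (a b : ℤ) (h : ¬ IsCentre r (i.1.1 + a, i.1.2 + b)) :
    (site i a b h).1.1 = i.1.1 + a := rfl

@[simp] lemma site_snd (i : Surv r) (a b : ℤ) (h : ¬ IsCentre r (i.1.1 + a, i.1.2 + b)) :
    (site i a b h).1.2 = i.1.2 + b := rfl

lemma surv_eq_iff {x y : Surv r} : x = y ↔ x.1.1 = y.1.1 ∧ x.1.2 = y.1.2 := by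
  rw [Subtype.ext_iff, Prod.ext_iff]

lemma dist_site_le {i : Surv r} {a b : ℤ} {h : ¬ IsCentre r (i.1.1 + a, i.1.2 + b)}
    (ha : |a| ≤ 2) (hb : |b| ≤ 2) : dist i (site i a b h) ≤ 2 := by
  rw [Subtype.dist_eq, Prod.dist_eq, Int.dist_eq, Int.dist_eq]
  simp only [site]
  push_cast
  have ha' : |(a : ℝ)| ≤ 2 := by exact_mod_cast ha
  have hb' : |(b : ℝ)| ≤ 2 := by exact_mod_cast hb
  refine max_le ?_ ?_
  · rw [sub_add_cancel_left, abs_neg]; exact ha'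
  · rw [sub_add_cancel_left, abs_neg]; exact hb'

set_option maxHeartbeats 4000000 in
lemma exists_frame (i : Surv r) : Nonempty (Frame i) := by
  -- The sign e tells on which of the two surviving sublattices i lies; their neighbourhoods are
  -- point reflections of each other, so all displacements carry the factor e.
  obtain ⟨e, he, hd⟩ : ∃ e : ℤ, (e = 1 ∨ e = -1) ∧ 3 ∣ i.1.1 - i.1.2 - r - e := by
    have := i.2
    unfold IsCentre at this
    rcases (by omega : 3 ∣ i.1.1 - i.1.2 - r - 1 ∨ 3 ∣ i.1.1 - i.1.2 - r - (-1)) with h | h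
    exacts [⟨1, Or.inl rfl, h⟩, ⟨-1, Or.inr rfl, h⟩]
  have hs : ∀ a b : ℤ, ¬ 3 ∣ 1 + a - b → ¬ IsCentre r (i.1.1 + e * a, i.1.2 + e * b) := by
    intro a b hab
    unfold IsCentre
    rcases he with rfl | rfl <;> omega
  refine ⟨{
    c := ![(i.1.1, i.1.2 + e), (i.1.1 - e, i.1.2), (i.1.1 + e, i.1.2 - e)]
    n := ![site i (e * 1) (e * 0) (hs _ _ (by norm_num)),
      site i (e * -1) (e * 1) (hs _ _ (by norm_num)), site i (e * 0) (e * -1) (hs _ _ (by norm_num))]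
    m := ![![site i (e * 1) (e * 1) (hs _ _ (by norm_num)),
        site i (e * 0) (e * 2) (hs _ _ (by norm_num)),
        site i (e * -1) (e * 2) (hs _ _ (by norm_num))],
      ![site i (e * -2) (e * 0) (hs _ _ (by norm_num)),
        site i (e * -1) (e * -1) (hs _ _ (by norm_num)),
        site i (e * -2) (e * 1) (hs _ _ (by norm_num))],
      ![site i (e * 2) (e * -1) (hs _ _ (by norm_num)),
        site i (e * 1) (e * -2) (hs _ _ (by norm_num)),
        site i (e * 2) (e * -2) (hs _ _ (by norm_num))]]
    c_inj := ?_
    mem_centres_iff := ?_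
    nn_iff := ?_
    hex_iff := ?_
    n_inj := ?_
    m_inj := ?_
    n_ne_m := ?_
    n_ne := ?_
    m_ne := ?_
    dist_n := ?_
    dist_m := ?_ }⟩
  · rcases he with rfl | rfl <;> simp [Fin.forall_fin_succ] <;> omega
  · intro x
    have := i.2
    simp only [mem_centres, Finset.mem_singleton, exists_eq_left, mem_nbrs, IsCentre,
      Fin.exists_fin_succ, Prod.ext_iff] at this ⊢
    rcases he with rfl | rfl <;> simp <;> omega
  · intro y
    have h1 := i.2
    have h2 := y.2
    simp only [NN, mem_nbrs, IsCentre, Fin.exists_fin_succ, surv_eq_iff] at *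
    rcases he with rfl | rfl <;> simp <;> omega
  · intro k y
    have h1 := i.2
    have h2 := y.2
    simp only [mem_nbrs, IsCentre, Fin.exists_fin_succ, surv_eq_iff] at *
    fin_cases k <;> rcases he with rfl | rfl <;> simp <;> omega
  · rcases he with rfl | rfl <;> simp [Fin.forall_fin_succ, surv_eq_iff]
  · rcases he with rfl | rfl <;> simp [Fin.forall_fin_succ, surv_eq_iff]
  · rcases he with rfl | rfl <;> simp [Fin.forall_fin_succ, surv_eq_iff]
  · rcases he with rfl | rfl <;> simp [Fin.forall_fin_succ, surv_eq_iff]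
  · rcases he with rfl | rfl <;> simp [Fin.forall_fin_succ, surv_eq_iff]
  · rcases he with rfl | rfl <;> simp [Fin.forall_fin_succ] <;>
      refine ⟨?_, ?_, ?_⟩ <;> exact dist_site_le (by norm_num) (by norm_num)
  · rcases he with rfl | rfl <;> simp [Fin.forall_fin_succ] <;>
      refine ⟨⟨?_, ?_, ?_⟩, ⟨?_, ?_, ?_⟩, ?_, ?_, ?_⟩ <;>
      exact dist_site_le (by norm_num) (by norm_num)

end Frames

end Potts

namespace Potts

set_option linter.unusedSectionVars false

/-! ### Single-site kernels in a frame and upper bounds for the coefficients. -/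

section FrameWeight

variable {r : ℤ} {q : ℕ} {i : Surv r}

namespace Frame

/-- The same frame with the hexagons in a different cyclic order. -/
def rotate (F : Frame i) (s : Fin 3) : Frame i where
  c k := F.c (k + s)
  n k := F.n (k + s)
  m k := F.m (k + s)
  c_inj k k' h := add_right_cancel (F.c_inj _ _ h)
  mem_centres_iff x := by
    rw [F.mem_centres_iff]
    exact ⟨fun ⟨k, hk⟩ => ⟨k - s, by simpa using hk⟩, fun ⟨k, hk⟩ => ⟨k + s, hk⟩⟩
  nn_iff y := by
    rw [F.nn_iff]
    exact ⟨fun ⟨k, hk⟩ => ⟨k - s, by simpa using hk⟩, fun ⟨k, hk⟩ => ⟨k + s, hk⟩⟩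
  hex_iff k y := by rw [F.hex_iff, add_right_comm]
  n_inj k k' h := add_right_cancel (F.n_inj _ _ h)
  m_inj k l k' l' h := ⟨add_right_cancel (F.m_inj _ _ _ _ h).1, (F.m_inj _ _ _ _ h).2⟩
  n_ne_m k k' l := F.n_ne_m _ _ l
  n_ne k := F.n_ne _
  m_ne k := F.m_ne _
  dist_n k := F.dist_n _
  dist_m k := F.dist_m _

/-- The same frame with the remaining sites of the hexagons in a different cyclic order. -/
def shift (F : Frame i) (s : Fin 3) : Frame i where
  c := F.c
  n := F.n
  m k l := F.m k (l + s)
  c_inj := F.c_inj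
  mem_centres_iff := F.mem_centres_iff
  nn_iff := F.nn_iff
  hex_iff k y := by
    rw [F.hex_iff]
    have : (∃ l, y = F.m k l) ↔ ∃ l, y = F.m k (l + s) :=
      ⟨fun ⟨l, hl⟩ => ⟨l - s, by simpa using hl⟩, fun ⟨l, hl⟩ => ⟨l + s, hl⟩⟩
    rw [this]
  n_inj := F.n_inj
  m_inj k l k' l' h := ⟨(F.m_inj _ _ _ _ h).1, add_right_cancel (F.m_inj _ _ _ _ h).2⟩
  n_ne_m k k' l := F.n_ne_m _ _ _
  n_ne := F.n_ne
  m_ne k l := F.m_ne _ _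
  dist_n := F.dist_n
  dist_m k l := F.dist_m _ _

/-- The colours of the sites other than `i` on the `k`-th hexagon at `i`. -/
def hex (F : Frame i) (t : Surv r → Fin q) (k : Fin 3) : Finset (Fin q) :=
  {t (F.n k), t (F.n (k + 1)), t (F.m k 0), t (F.m k 1), t (F.m k 2)}

/-- The weight of the colour `a` at the site `i`. -/
noncomputable def weight (F : Frame i) (t : Surv r → Fin q) (a : Fin q) : ℝ :=
  if ∃ k, a = t (F.n k) then 0 else ∏ k, hexWeight (F.hex t k) a

lemma card_hex_le (F : Frame i) (t : Surv r → Fin q) (k : Fin 3) : (F.hex t k).card ≤ 5 :=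
  Finset.card_le_five

lemma hexColours_update (F : Frame i) (t : Surv r → Fin q) (a : Fin q) (k : Fin 3) :
    hexColours (F.c k) (Function.update t i a) = insert a (F.hex t k) := by
  ext b
  simp only [mem_hexColours, F.hex_iff, hex, Finset.mem_insert, Finset.mem_singleton]
  constructor
  · rintro ⟨y, rfl | rfl | rfl | ⟨l, rfl⟩, rfl⟩
    · simp
    · simp [Function.update_of_ne (F.n_ne _)]
    · simp [Function.update_of_ne (F.n_ne _)]
    · rw [Function.update_of_ne (F.m_ne _ _)]
      fin_cases l <;> simp
  · rintro (rfl | rfl | rfl | rfl | rfl | rfl)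
    · exact ⟨i, Or.inl rfl, by simp⟩
    · exact ⟨F.n k, Or.inr (Or.inl rfl), Function.update_of_ne (F.n_ne _) _ _⟩
    · exact ⟨F.n (k + 1), Or.inr (Or.inr (Or.inl rfl)), Function.update_of_ne (F.n_ne _) _ _⟩
    · exact ⟨F.m k 0, Or.inr (Or.inr (Or.inr ⟨0, rfl⟩)), Function.update_of_ne (F.m_ne _ _) _ _⟩
    · exact ⟨F.m k 1, Or.inr (Or.inr (Or.inr ⟨1, rfl⟩)), Function.update_of_ne (F.m_ne _ _) _ _⟩
    · exact ⟨F.m k 2, Or.inr (Or.inr (Or.inr ⟨2, rfl⟩)), Function.update_of_ne (F.m_ne _ _) _ _⟩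

lemma decWeight_update (F : Frame i) (t : Surv r → Fin q) (a : Fin q) :
    decWeight q r {i} (Function.update t i a) = F.weight t a := by
  have hc : centres r {i} = Finset.univ.image F.c := by
    ext x; rw [F.mem_centres_iff]; simp [eq_comm]
  rw [decWeight, hc, Finset.prod_image fun k _ k' _ h => F.c_inj k k' h]
  simp only [F.hexColours_update]
  rw [weight]
  split_ifs with h
  · obtain ⟨k, rfl⟩ := h
    rw [exclusion, if_neg, mul_zero]
    intro h
    refine h i (Finset.mem_singleton_self i) (F.n k) ((F.nn_iff _).2 ⟨k, rfl⟩) ?_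
    rw [Function.update_self, Function.update_of_ne (F.n_ne _)]
  · rw [exclusion, if_pos, mul_one]
    · rfl
    · intro x hx y hxy he
      rw [Finset.mem_singleton] at hx
      subst hx
      obtain ⟨k, rfl⟩ := (F.nn_iff _).1 hxy
      rw [Function.update_self, Function.update_of_ne (F.n_ne _)] at he
      exact h ⟨k, he⟩

lemma siteKernel_eq (F : Frame i) (t : Surv r → Fin q) :
    siteKernel (decWeight q r) i t = normalized (F.weight t) := by
  funext a
  rw [Potts.siteKernel_eq, normalized]
  simp only [F.decWeight_update]

/-- The neighbour n 0 lies on hexagons 0 and 2 but not on hexagon 1, because hexagon k contains n k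
and n (k + 1), with indices mod 3. -/
lemma weight_eq_nnWeight (F : Frame i) (t : Surv r → Fin q) :
    F.weight t = nnWeight (t (F.n 1)) (t (F.n 2)) (F.hex t 1)
      {t (F.n 1), t (F.m 0 0), t (F.m 0 1), t (F.m 0 2)}
      {t (F.n 2), t (F.m 2 0), t (F.m 2 1), t (F.m 2 2)} (t (F.n 0)) := by
  funext a
  have e : (∃ k, a = t (F.n k)) ↔ a = t (F.n 1) ∨ a = t (F.n 2) ∨ a = t (F.n 0) := by
    simp [Fin.exists_fin_succ]; tauto
  have e0 : F.hex t 0 = insert (t (F.n 0)) {t (F.n 1), t (F.m 0 0), t (F.m 0 1), t (F.m 0 2)} := rfl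
  have e2 : F.hex t 2 =
      insert (t (F.n 0)) {t (F.n 2), t (F.m 2 0), t (F.m 2 1), t (F.m 2 2)} := by
    rw [Finset.insert_comm]; rfl
  rw [weight, nnWeight]
  refine if_congr e rfl ?_
  rw [Fin.prod_univ_three, e0, e2]
  ring

lemma weight_eq_nnnWeight (F : Frame i) (t : Surv r → Fin q) :
    F.weight t = fun a => (if a ∈ ({t (F.n 0), t (F.n 1), t (F.n 2)} : Finset (Fin q)) then 0
      else hexWeight (F.hex t 1) a * hexWeight (F.hex t 2) a) *
      hexWeight (insert (t (F.m 0 0)) {t (F.n 0), t (F.n 1), t (F.m 0 1), t (F.m 0 2)}) a := by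
  funext a
  have e : (∃ k, a = t (F.n k)) ↔ a ∈ ({t (F.n 0), t (F.n 1), t (F.n 2)} : Finset (Fin q)) := by
    simp only [Finset.mem_insert, Finset.mem_singleton]
    simp [Fin.exists_fin_succ]
  have e0 : F.hex t 0 =
      insert (t (F.m 0 0)) {t (F.n 0), t (F.n 1), t (F.m 0 1), t (F.m 0 2)} := by
    rw [Finset.insert_comm, Finset.insert_comm (t (F.m 0 0))]; rfl
  rw [weight, ite_mul, zero_mul]
  refine if_congr e rfl ?_
  rw [Fin.prod_univ_three, e0]
  ring

lemma nnn_iff (F : Frame i) (y : Surv r) : NNN i y ↔ ∃ k l, y = F.m k l := by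
  constructor
  · rintro ⟨h1, h2, c, hc, hi, hy⟩
    have hcc : c ∈ centres r {i} :=
      mem_centres.2 ⟨hc, i, Finset.mem_singleton_self i, nbrs_symm.1 hi⟩
    obtain ⟨k, rfl⟩ := (F.mem_centres_iff c).1 hcc
    rcases (F.hex_iff k y).1 hy with h | h | h | ⟨l, h⟩
    · exact absurd h.symm h1
    · exact absurd ((F.nn_iff y).2 ⟨k, h⟩) h2
    · exact absurd ((F.nn_iff y).2 ⟨k + 1, h⟩) h2
    · exact ⟨k, l, h⟩
  · rintro ⟨k, l, rfl⟩
    have hc := (F.mem_centres_iff (F.c k)).2 ⟨k, rfl⟩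
    refine ⟨(F.m_ne k l).symm, fun h => ?_, F.c k, isCentre_of_mem_centres hc, ?_, ?_⟩
    · obtain ⟨k', h'⟩ := (F.nn_iff _).1 h
      exact F.n_ne_m k' k l h'.symm
    · exact (F.hex_iff k i).2 (Or.inl rfl)
    · exact (F.hex_iff k _).2 (Or.inr (Or.inr (Or.inr ⟨l, rfl⟩)))

lemma ncard_nn (F : Frame i) : {j | NN i j}.ncard = 3 := by
  have : {j | NN i j} = Set.range F.n := by
    ext y; simp [F.nn_iff, eq_comm]
  rw [this, ← Set.image_univ, Set.ncard_image_of_injective _ fun k k' h => F.n_inj k k' h,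
    Set.ncard_univ, Nat.card_eq_fintype_card, Fintype.card_fin]

lemma ncard_nnn (F : Frame i) : {j | NNN i j}.ncard = 9 := by
  have : {j | NNN i j} = Set.range fun p : Fin 3 × Fin 3 => F.m p.1 p.2 := by
    ext y; simp [F.nnn_iff, eq_comm]
  rw [this, ← Set.image_univ, Set.ncard_image_of_injective, Set.ncard_univ,
    Nat.card_eq_fintype_card]
  · simp
  · intro p p' h
    exact Prod.ext (F.m_inj _ _ _ _ h).1 (F.m_inj _ _ _ _ h).2

end Frame

/-- Rotating the frame makes the index of the changed neighbour irrelevant, so only one position has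
to be estimated. -/
lemma exists_frame_nn {j : Surv r} (h : NN i j) : ∃ F : Frame i, F.n 0 = j := by
  obtain ⟨F⟩ := exists_frame i
  obtain ⟨k, rfl⟩ := (F.nn_iff j).1 h
  exact ⟨F.rotate k, by simp [Frame.rotate]⟩

lemma exists_frame_nnn {j : Surv r} (h : NNN i j) : ∃ F : Frame i, F.m 0 0 = j := by
  obtain ⟨F⟩ := exists_frame i
  obtain ⟨k, l, rfl⟩ := (F.nnn_iff j).1 h
  exact ⟨(F.rotate k).shift l, by simp [Frame.rotate, Frame.shift]⟩

lemma dist_le_of_nn {j : Surv r} (h : NN i j) : dist i j ≤ 2 := by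
  obtain ⟨F⟩ := exists_frame i
  obtain ⟨k, rfl⟩ := (F.nn_iff j).1 h
  exact F.dist_n k

lemma dist_le_of_nnn {j : Surv r} (h : NNN i j) : dist i j ≤ 2 := by
  obtain ⟨F⟩ := exists_frame i
  obtain ⟨k, l, rfl⟩ := (F.nnn_iff j).1 h
  exact F.dist_m k l

/-- The upper bound for nearest neighbours. -/
lemma dobrushinCoeff_le_of_nn (hq : 7 ≤ q) {j : Surv r} (h : NN i j) :
    dobrushinCoeff (decWeight q r) i j ≤ cNN q := by
  obtain ⟨F, rfl⟩ := exists_frame_nn h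
  refine dobrushinCoeff_le (cNN_pos hq).le fun σ τ hστ => ?_
  rw [F.siteKernel_eq, F.siteKernel_eq, F.weight_eq_nnWeight, F.weight_eq_nnWeight]
  have n1 : ∀ k, k ≠ 0 → σ (F.n k) = τ (F.n k) := fun k hk =>
    hστ _ fun h => hk (F.n_inj _ _ h)
  have m1 : ∀ k l, σ (F.m k l) = τ (F.m k l) := fun k l => hστ _ fun h => F.n_ne_m _ _ _ h.symm
  have h1 : F.hex σ 1 = F.hex τ 1 := by
    simp only [Frame.hex, m1, n1 1 (by decide), n1 (1 + 1) (by decide)]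
  simp only [m1, n1 1 (by decide), n1 2 (by decide), h1]
  exact tvDist_nearest_le hq (F.card_hex_le _ _) Finset.card_le_four Finset.card_le_four _ _

/-- The upper bound for next-to-nearest neighbours. -/
lemma dobrushinCoeff_le_of_nnn (hq : 7 ≤ q) {j : Surv r} (h : NNN i j) :
    dobrushinCoeff (decWeight q r) i j ≤ cNNN q := by
  obtain ⟨F, rfl⟩ := exists_frame_nnn h
  refine dobrushinCoeff_le (cNNN_nonneg hq) fun σ τ hστ => ?_
  rw [F.siteKernel_eq, F.siteKernel_eq, F.weight_eq_nnnWeight, F.weight_eq_nnnWeight]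
  have n1 : ∀ k, σ (F.n k) = τ (F.n k) := fun k => hστ _ (F.n_ne_m _ _ _)
  have m1 : ∀ k l, (k, l) ≠ (0, 0) → σ (F.m k l) = τ (F.m k l) := fun k l hkl => hστ _ fun h =>
    hkl (Prod.ext (F.m_inj _ _ _ _ h).1 (F.m_inj _ _ _ _ h).2)
  have h1 : ∀ k, k ≠ 0 → F.hex σ k = F.hex τ k := by
    intro k hk
    have : ∀ l, σ (F.m k l) = τ (F.m k l) := fun l => m1 k l (by simp [hk])
    simp only [Frame.hex, this, n1]
  simp only [n1, h1 1 (by decide), h1 2 (by decide), m1 0 1 (by decide), m1 0 2 (by decide)]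
  exact tvDist_nextNearest_le hq Finset.card_le_four Finset.card_le_three (F.card_hex_le _ _)
    (F.card_hex_le _ _) _ _

lemma dobrushinCoeff_of_far {j : Surv r} (h1 : ¬ NN i j) (h2 : ¬ NNN i j) :
    dobrushinCoeff (decWeight q r) i j = 0 := by
  obtain ⟨F⟩ := exists_frame i
  refine dobrushinCoeff_eq_zero fun σ τ hστ => ?_
  have n1 : ∀ k, σ (F.n k) = τ (F.n k) := fun k =>
    hστ _ fun h => h1 ((F.nn_iff j).2 ⟨k, h.symm⟩)
  have m1 : ∀ k l, σ (F.m k l) = τ (F.m k l) := fun k l =>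
    hστ _ fun h => h2 ((F.nnn_iff j).2 ⟨k, l, h.symm⟩)
  rw [F.siteKernel_eq, F.siteKernel_eq]
  congr 1
  funext a
  simp only [Frame.weight, Frame.hex, n1, m1]

end FrameWeight

end Potts

namespace Potts

set_option linter.unusedSectionVars false

/-! ### Boundary conditions attaining the bounds. -/

section Extremal

variable {r : ℤ} {p : ℕ} {i : Surv r}

lemma hexWeight_map_castAdd (S : Finset (Fin 7)) (a : Fin 7) :
    hexWeight (S.map (Fin.castAddEmb p)) (Fin.castAdd p a) =
      (p : ℝ) + 7 - ((insert a S).card : ℝ) := by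
  have : insert (Fin.castAdd p a) (S.map (Fin.castAddEmb p)) =
      (insert a S).map (Fin.castAddEmb p) := by
    rw [Finset.map_insert]; rfl
  rw [hexWeight, this, Finset.card_map]
  push_cast; ring

lemma hexWeight_map_natAdd (S : Finset (Fin 7)) (b : Fin p) :
    hexWeight (S.map (Fin.castAddEmb p)) (Fin.natAdd 7 b) = (p : ℝ) + 6 - (S.card : ℝ) := by
  rw [hexWeight_of_notMem, Finset.card_map]
  · push_cast; ring
  · simp only [Finset.mem_map, not_exists, not_and]
    intro a _ h
    have := congrArg Fin.val h
    simp at this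
    omega

namespace Frame

/-- The boundary condition with prescribed colours at the neighbours of `i`. -/
noncomputable def config (F : Frame i) (p : ℕ) (nv : Fin 3 → Fin 7) (mv : Fin 3 → Fin 3 → Fin 7) :
    Surv r → Fin (7 + p) :=
  Function.extend (Sum.elim F.n fun s : Fin 3 × Fin 3 => F.m s.1 s.2)
    (Sum.elim (fun k => Fin.castAdd p (nv k)) fun s => Fin.castAdd p (mv s.1 s.2))
    fun _ => Fin.castAdd p 0

variable (F : Frame i) (nv nv' : Fin 3 → Fin 7) (mv mv' : Fin 3 → Fin 3 → Fin 7)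

lemma injective_sites :
    Function.Injective (Sum.elim F.n fun s : Fin 3 × Fin 3 => F.m s.1 s.2) := by
  rintro (k | s) (k' | s') h
  · rw [F.n_inj k k' h]
  · exact absurd h (F.n_ne_m _ _ _)
  · exact absurd h.symm (F.n_ne_m _ _ _)
  · rw [Prod.ext (F.m_inj _ _ _ _ h).1 (F.m_inj _ _ _ _ h).2]

@[simp] lemma config_n (k : Fin 3) : F.config p nv mv (F.n k) = Fin.castAdd p (nv k) :=
  F.injective_sites.extend_apply _ _ (Sum.inl k)

@[simp] lemma config_m (k l : Fin 3) : F.config p nv mv (F.m k l) = Fin.castAdd p (mv k l) :=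
  F.injective_sites.extend_apply _ _ (Sum.inr (k, l))

lemma config_congr {j : Surv r} (hn : ∀ k, F.n k ≠ j → nv k = nv' k)
    (hm : ∀ k l, F.m k l ≠ j → mv k l = mv' k l) {y : Surv r} (hy : y ≠ j) :
    F.config p nv mv y = F.config p nv' mv' y := by
  by_cases h : ∃ s, Sum.elim F.n (fun s : Fin 3 × Fin 3 => F.m s.1 s.2) s = y
  · obtain ⟨k | ⟨k, l⟩, rfl⟩ := h
    · exact (F.config_n _ _ k).trans (by rw [hn k hy]; exact (F.config_n _ _ k).symm)
    · exact (F.config_m _ _ k l).trans (by rw [hm k l hy]; exact (F.config_m _ _ k l).symm)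
  · rw [config, config, Function.extend_apply' _ _ _ h, Function.extend_apply' _ _ _ h]

/-- The colours on the `k`-th hexagon. -/
def hexSeven (nv : Fin 3 → Fin 7) (mv : Fin 3 → Fin 3 → Fin 7) (k : Fin 3) : Finset (Fin 7) :=
  {nv k, nv (k + 1), mv k 0, mv k 1, mv k 2}

lemma hex_config (k : Fin 3) :
    F.hex (F.config p nv mv) k = (hexSeven nv mv k).map (Fin.castAddEmb p) := by
  simp only [hex, hexSeven, config_n, config_m, Finset.map_insert, Finset.map_singleton]
  rfl

lemma weight_config_castAdd (a : Fin 7) : F.weight (F.config p nv mv) (Fin.castAdd p a) =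
    if ∃ k, a = nv k then 0 else ∏ k, ((p : ℝ) + 7 - ((insert a (hexSeven nv mv k)).card : ℝ)) := by
  rw [weight]
  simp only [hex_config, config_n, hexWeight_map_castAdd, Fin.castAdd_inj]

lemma weight_config_natAdd (b : Fin p) : F.weight (F.config p nv mv) (Fin.natAdd 7 b) =
    ∏ k, ((p : ℝ) + 6 - ((hexSeven nv mv k).card : ℝ)) := by
  rw [weight, if_neg]
  · simp only [hex_config, hexWeight_map_natAdd]
  · rintro ⟨k, h⟩
    have := congrArg Fin.val h
    simp at this
    omega

/-- The p colours beyond the first seven occur on no hexagon and have equal weights, so finite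
checks in `Fin 7` settle all q = 7 + p. -/
lemma sum_weight_config : ∑ a, F.weight (F.config p nv mv) a =
    (∑ a : Fin 7, if ∃ k, a = nv k then 0 else
      ∏ k, ((p : ℝ) + 7 - ((insert a (hexSeven nv mv k)).card : ℝ))) +
    p * ∏ k, ((p : ℝ) + 6 - ((hexSeven nv mv k).card : ℝ)) := by
  rw [Fin.sum_univ_add]
  simp only [weight_config_castAdd, weight_config_natAdd, Finset.sum_const, Finset.card_univ,
    Fintype.card_fin, nsmul_eq_mul]

end Frame

/-- Every hexagon shows five distinct colours, and colour 3 lies on all three, so its weight is the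
maximal (q - 5)³. The colours 4, 5 and 6 lie on one hexagon each, and 0, 1, 2 are excluded. Giving
colour 3 to n 0 forbids it, so the probability of the event {3} drops to zero. -/
lemma cNN_le_dobrushinCoeff (F : Frame i) :
    cNN (7 + p) ≤ dobrushinCoeff (decWeight (7 + p) r) i (F.n 0) := by
  have hp : (0 : ℝ) ≤ p := Nat.cast_nonneg p
  set mv : Fin 3 → Fin 3 → Fin 7 := ![![3, 2, 4], ![3, 0, 5], ![3, 1, 6]] with hmv
  set nv : Fin 3 → Fin 7 := ![0, 1, 2] with hnv
  set nv' : Fin 3 → Fin 7 := ![3, 1, 2] with hnv'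
  have hagree : ∀ y, y ≠ F.n 0 → F.config p nv mv y = F.config p nv' mv y := by
    intro y hy
    refine F.config_congr nv nv' mv mv (fun k hk => ?_) (fun _ _ _ => rfl) hy
    fin_cases k
    exacts [absurd rfl hk, rfl, rfl]
  have hcard : ∀ a k, (insert a (Frame.hexSeven nv mv k)).card =
      ![![5, 5, 5], ![5, 5, 5], ![5, 5, 5], ![5, 5, 5], ![5, 6, 6], ![6, 5, 6], ![6, 6, 5]] a k := by
    decide
  have hcard' : ∀ k, (Frame.hexSeven nv mv k).card = 5 := by decide
  have hn : ∀ a : Fin 7, (∃ k, a = nv k) ↔ a = 0 ∨ a = 1 ∨ a = 2 := by decide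
  have hZ : ∑ a, F.weight (F.config p nv mv) a =
      (p + 2) ^ 3 + 3 * ((p + 2) * (p + 1) ^ 2) + p * (p + 1) ^ 3 := by
    rw [F.sum_weight_config]
    simp only [hcard, hcard', hn]
    simp [Fin.sum_univ_seven, Fin.prod_univ_three]
    ring
  have h3 : F.weight (F.config p nv mv) (Fin.castAdd p 3) = (p + 2) ^ 3 := by
    rw [F.weight_config_castAdd]
    simp only [hcard, hn]
    simp [Fin.prod_univ_three]
    ring
  have h3' : F.weight (F.config p nv' mv) (Fin.castAdd p 3) = 0 := by
    rw [F.weight_config_castAdd, if_pos ⟨0, rfl⟩]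
  have hle := (decWeight_regular (by omega : 7 ≤ 7 + p) r).tvDist_le_dobrushinCoeff (i := i) hagree
  refine le_trans ?_ hle
  refine le_trans ?_ (le_tvDist _ _ {Fin.castAdd p 3})
  rw [Finset.sum_singleton, Finset.sum_singleton, F.siteKernel_eq, F.siteKernel_eq, normalized,
    normalized, h3', zero_div, sub_zero, h3, hZ, abs_of_nonneg (by positivity), cNN]
  refine le_of_eq ?_
  push_cast
  congr 1 <;> ring

/-- Colours 3 and 4 both lie on hexagons 1 and 2, and the changed site on hexagon 0 goes from 3 to
4. This exchanges the weights of the two colours and keeps the normalization, so colour 3 loses (p +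
2)²/Z. -/
lemma cNNN_le_dobrushinCoeff (F : Frame i) :
    cNNN (7 + p) ≤ dobrushinCoeff (decWeight (7 + p) r) i (F.m 0 0) := by
  have hp : (0 : ℝ) ≤ p := Nat.cast_nonneg p
  set nv : Fin 3 → Fin 7 := ![0, 1, 2] with hnv
  set mv : Fin 3 → Fin 3 → Fin 7 := ![![3, 2, 5], ![3, 4, 0], ![3, 4, 1]] with hmv
  set mv' : Fin 3 → Fin 3 → Fin 7 := ![![4, 2, 5], ![3, 4, 0], ![3, 4, 1]] with hmv'
  have hagree : ∀ y, y ≠ F.m 0 0 → F.config p nv mv y = F.config p nv mv' y := by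
    intro y hy
    refine F.config_congr nv nv mv mv' (fun _ _ => rfl) (fun k l hkl => ?_) hy
    have : ∀ k l, (k, l) ≠ (0, 0) → mv k l = mv' k l := by decide
    exact this k l fun h => hkl (by rw [Prod.mk.injEq] at h; rw [h.1, h.2])
  have hcard : ∀ a k, (insert a (Frame.hexSeven nv mv k)).card =
      ![![5, 5, 5], ![5, 5, 5], ![5, 5, 5], ![5, 5, 5], ![6, 5, 5], ![5, 6, 6], ![6, 6, 6]] a k := by
    decide
  have hcard' : ∀ k, (Frame.hexSeven nv mv k).card = 5 := by decide
  have kcard : ∀ a k, (insert a (Frame.hexSeven nv mv' k)).card =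
      ![![5, 5, 5], ![5, 5, 5], ![5, 5, 5], ![6, 5, 5], ![5, 5, 5], ![5, 6, 6], ![6, 6, 6]] a k := by
    decide
  have kcard' : ∀ k, (Frame.hexSeven nv mv' k).card = 5 := by decide
  have hn : ∀ a : Fin 7, (∃ k, a = nv k) ↔ a = 0 ∨ a = 1 ∨ a = 2 := by decide
  have hZ : ∑ a, F.weight (F.config p nv mv) a =
      (p + 2) ^ 3 + (p + 2) ^ 2 * (p + 1) + (p + 2) * (p + 1) ^ 2 + (p + 1) * (p + 1) ^ 3 := by
    rw [F.sum_weight_config]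
    simp only [hcard, hcard', hn]
    simp [Fin.sum_univ_seven, Fin.prod_univ_three]
    ring
  have hZ' : ∑ a, F.weight (F.config p nv mv') a =
      (p + 2) ^ 3 + (p + 2) ^ 2 * (p + 1) + (p + 2) * (p + 1) ^ 2 + (p + 1) * (p + 1) ^ 3 := by
    rw [F.sum_weight_config]
    simp only [kcard, kcard', hn]
    simp [Fin.sum_univ_seven, Fin.prod_univ_three]
    ring
  have h3 : F.weight (F.config p nv mv) (Fin.castAdd p 3) = (p + 2) ^ 3 := by
    rw [F.weight_config_castAdd]
    simp only [hcard, hn]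
    simp [Fin.prod_univ_three]
    ring
  have h3' : F.weight (F.config p nv mv') (Fin.castAdd p 3) = (p + 2) ^ 2 * (p + 1) := by
    rw [F.weight_config_castAdd]
    simp only [kcard, hn]
    simp [Fin.prod_univ_three]
    ring
  have hle := (decWeight_regular (by omega : 7 ≤ 7 + p) r).tvDist_le_dobrushinCoeff (i := i) hagree
  refine le_trans ?_ hle
  refine le_trans ?_ (le_tvDist _ _ {Fin.castAdd p 3})
  rw [Finset.sum_singleton, Finset.sum_singleton, F.siteKernel_eq, F.siteKernel_eq, normalized,
    normalized, h3', h3, hZ, hZ', ← sub_div]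
  refine le_trans (le_of_eq ?_) (le_abs_self _)
  rw [cNNN]
  push_cast
  congr 1 <;> ring

end Extremal

/-! ### The Dobrushin constant. -/

section Coefficients

variable {r : ℤ} {q : ℕ} {i j : Surv r}

theorem dobrushinCoeff_nn (hq : 7 ≤ q) (h : NN i j) :
    dobrushinCoeff (decWeight q r) i j = cNN q := by
  refine le_antisymm (dobrushinCoeff_le_of_nn hq h) ?_
  obtain ⟨F, rfl⟩ := exists_frame_nn h
  obtain ⟨p, rfl⟩ := Nat.exists_eq_add_of_le hq
  exact cNN_le_dobrushinCoeff F

theorem dobrushinCoeff_nnn (hq : 7 ≤ q) (h : NNN i j) :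
    dobrushinCoeff (decWeight q r) i j = cNNN q := by
  refine le_antisymm (dobrushinCoeff_le_of_nnn hq h) ?_
  obtain ⟨F, rfl⟩ := exists_frame_nnn h
  obtain ⟨p, rfl⟩ := Nat.exists_eq_add_of_le hq
  exact cNNN_le_dobrushinCoeff F

/-- The sites with a nonzero coefficient. -/
def Frame.support (F : Frame i) : Finset (Surv r) :=
  Finset.univ.image F.n ∪ Finset.univ.image fun s : Fin 3 × Fin 3 => F.m s.1 s.2

lemma Frame.dobrushinCoeff_eq_zero (F : Frame i) (hj : j ∉ F.support) :
    dobrushinCoeff (decWeight q r) i j = 0 := by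
  simp only [support, Finset.mem_union, Finset.mem_image, Finset.mem_univ, true_and, not_or] at hj
  refine dobrushinCoeff_of_far (fun h => hj.1 ?_) fun h => hj.2 ?_
  · obtain ⟨k, rfl⟩ := (F.nn_iff j).1 h
    exact ⟨k, rfl⟩
  · obtain ⟨k, l, rfl⟩ := (F.nnn_iff j).1 h
    exact ⟨(k, l), rfl⟩

lemma Frame.sum_dobrushinCoeff (hq : 7 ≤ q) (F : Frame i) :
    ∑ j ∈ F.support, dobrushinCoeff (decWeight q r) i j = 3 * cNN q + 9 * cNNN q := by
  rw [support, Finset.sum_union, Finset.sum_image fun k _ k' _ h => F.n_inj k k' h,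
    Finset.sum_image fun s _ s' _ h => Prod.ext (F.m_inj _ _ _ _ h).1 (F.m_inj _ _ _ _ h).2]
  · rw [Finset.sum_congr rfl fun k _ => dobrushinCoeff_nn hq ((F.nn_iff _).2 ⟨k, rfl⟩),
      Finset.sum_congr rfl fun (s : Fin 3 × Fin 3) _ =>
        dobrushinCoeff_nnn hq ((F.nnn_iff _).2 ⟨s.1, s.2, rfl⟩)]
    simp
  · rw [Finset.disjoint_left]
    simp only [Finset.mem_image, Finset.mem_univ, true_and, not_exists, forall_exists_index]
    rintro _ k rfl s h
    exact F.n_ne_m _ _ _ h.symm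

lemma summable_dobrushinCoeff (q : ℕ) (i : Surv r) :
    Summable (dobrushinCoeff (decWeight q r) i) := by
  obtain ⟨F⟩ := exists_frame i
  exact summable_of_ne_finset_zero (s := F.support) fun j hj => F.dobrushinCoeff_eq_zero hj

lemma tsum_dobrushinCoeff (hq : 7 ≤ q) (i : Surv r) :
    ∑' j, dobrushinCoeff (decWeight q r) i j = 3 * cNN q + 9 * cNNN q := by
  obtain ⟨F⟩ := exists_frame i
  rw [tsum_eq_sum (s := F.support) fun j hj => F.dobrushinCoeff_eq_zero hj, F.sum_dobrushinCoeff hq]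

theorem dobrushinConst_eq (hq : 7 ≤ q) (r : ℤ) :
    dobrushinConst (decWeight q r) = ENNReal.ofReal (3 * cNN q + 9 * cNNN q) := by
  have key : ∀ i : Surv r, ∑' j : {j : Surv r // j ≠ i},
      ENNReal.ofReal (dobrushinCoeff (decWeight q r) i j) =
        ENNReal.ofReal (3 * cNN q + 9 * cNNN q) := by
    intro i
    have e := tsum_subtype_eq_of_support_subset (s := {j : Surv r | j ≠ i})
      (f := fun j => ENNReal.ofReal (dobrushinCoeff (decWeight q r) i j)) (fun j hj h => by
        subst h
        simp [dobrushinCoeff_self] at hj)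
    rw [← tsum_dobrushinCoeff hq i, ENNReal.ofReal_tsum_of_nonneg
      (fun j => dobrushinCoeff_nonneg _ i j) (summable_dobrushinCoeff q i)]
    exact e
  have : Nonempty (Surv r) := ⟨⟨(r + 1, 0), by unfold IsCentre; omega⟩⟩
  rw [dobrushinConst, iSup_congr key, iSup_const]

lemma dist_le_of_dobrushinCoeff_ne_zero (h : dobrushinCoeff (decWeight q r) i j ≠ 0) :
    dist i j ≤ 2 := by
  by_cases h1 : NN i j
  · exact dist_le_of_nn h1
  by_cases h2 : NNN i j
  · exact dist_le_of_nnn h2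
  exact absurd (dobrushinCoeff_of_far h1 h2) h

/-- In the variable z = q - 11 ≥ 0 the cleared inequality is a polynomial with positive
coefficients. -/
lemma dobrushin_lt_one (hq : 11 ≤ q) : 3 * cNN q + 9 * cNNN q < 1 := by
  obtain ⟨z, hz⟩ : ∃ z : ℝ, (q : ℝ) = z + 11 := ⟨q - 11, by ring⟩
  have h1 : (11 : ℝ) ≤ q := by exact_mod_cast hq
  have hz0 : 0 ≤ z := by linarith
  rw [cNN, cNNN, hz]
  have e1 : (z + 11) ^ 4 - 21 * (z + 11) ^ 3 + 168 * (z + 11) ^ 2 - 609 * (z + 11) + 847 =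
      z ^ 4 + 23 * z ^ 3 + 201 * z ^ 2 + 788 * z + 1166 := by ring
  have e2 : (z + 11) ^ 4 - 21 * (z + 11) ^ 3 + 168 * (z + 11) ^ 2 - 608 * (z + 11) + 841 =
      z ^ 4 + 23 * z ^ 3 + 201 * z ^ 2 + 789 * z + 1171 := by ring
  rw [e1, e2]
  have p1 : 0 < z ^ 4 + 23 * z ^ 3 + 201 * z ^ 2 + 788 * z + 1166 := by positivity
  have p2 : 0 < z ^ 4 + 23 * z ^ 3 + 201 * z ^ 2 + 789 * z + 1171 := by positivity
  rw [mul_div_assoc', mul_div_assoc', div_add_div _ _ p1.ne' p2.ne', div_lt_one (mul_pos p1 p2),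
    ← sub_pos]
  ring_nf
  positivity

end Coefficients

end Potts

/-! ### Assembly of the theorem. -/

theorem mainTheorem3 (q : ℕ) (hq : 7 ≤ q) (r : ℤ) :
    -- both zero-temperature specifications are well defined
    (∀ (Λ : Finset (ℤ × ℤ)) (σ : ℤ × ℤ → Fin q),
      0 < Potts.partition (Potts.triWeight q) Λ σ) ∧
    (∀ (Λ : Finset (Potts.Surv r)) (t : Potts.Surv r → Fin q),
      0 < Potts.partition (Potts.decWeight q r) Λ t) ∧
    -- summing over the spins of the `r`-th sublattice produces the decimated model
    (∀ (Λ : Finset (Potts.Surv r)) (σ : ℤ × ℤ → Fin q),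
      ∑ s : Potts.centres r Λ → Fin q,
          Potts.triWeight q (Λ.image Subtype.val ∪ Potts.centres r Λ)
            (Potts.glue (Potts.centres r Λ) s σ) =
        Potts.decWeight q r Λ (fun x => σ x.1)) ∧
    (∀ μ : MeasureTheory.Measure (ℤ × ℤ → Fin q), Potts.IsGibbs (Potts.triWeight q) μ →
      Potts.IsGibbs (Potts.decWeight q r) (μ.map fun σ (x : Potts.Surv r) => σ x.1)) ∧
    -- the decimated lattice: 3 nearest and 9 next-to-nearest neighbours
    (∀ i : Potts.Surv r, {j | Potts.NN i j}.ncard = 3 ∧ {j | Potts.NNN i j}.ncard = 9) ∧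
    -- the Dobrushin coefficients and the Dobrushin constant
    (∀ i j : Potts.Surv r, Potts.NN i j →
      Potts.dobrushinCoeff (Potts.decWeight q r) i j = Potts.cNN q) ∧
    (∀ i j : Potts.Surv r, Potts.NNN i j →
      Potts.dobrushinCoeff (Potts.decWeight q r) i j = Potts.cNNN q) ∧
    (∀ i j : Potts.Surv r, i ≠ j → ¬ Potts.NN i j → ¬ Potts.NNN i j →
      Potts.dobrushinCoeff (Potts.decWeight q r) i j = 0) ∧
    Potts.dobrushinConst (Potts.decWeight q r) =
      ENNReal.ofReal (3 * Potts.cNN q + 9 * Potts.cNNN q) ∧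
    -- the Dobrushin condition and its consequences
    (11 ≤ q →
      Potts.dobrushinConst (Potts.decWeight q r) < 1 ∧
      (∃! μ : MeasureTheory.Measure (Potts.Surv r → Fin q),
        Potts.IsGibbs (Potts.decWeight q r) μ) ∧
      (∀ μ : MeasureTheory.Measure (Potts.Surv r → Fin q),
        Potts.IsGibbs (Potts.decWeight q r) μ → Potts.ExpDecay μ) ∧
      (∃! μ : MeasureTheory.Measure (ℤ × ℤ → Fin q), Potts.IsGibbs (Potts.triWeight q) μ) ∧
      (∀ μ : MeasureTheory.Measure (ℤ × ℤ → Fin q),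
        Potts.IsGibbs (Potts.triWeight q) μ → Potts.ExpDecay μ)) := by
  have : NeZero q := ⟨by omega⟩
  have hα0 : 0 ≤ 3 * Potts.cNN q + 9 * Potts.cNNN q := by
    have := Potts.cNN_pos hq
    have := Potts.cNNN_nonneg hq
    linarith
  refine ⟨(Potts.triWeight_regular hq).pos, (Potts.decWeight_regular hq r).pos,
    fun Λ σ => Potts.sum_triWeight Λ σ, fun μ hμ => hμ.map_restr hq, fun i => ?_,
    fun i j h => Potts.dobrushinCoeff_nn hq h, fun i j h => Potts.dobrushinCoeff_nnn hq h,
    fun i j _ h1 h2 => Potts.dobrushinCoeff_of_far h1 h2, Potts.dobrushinConst_eq hq r,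
    fun hq11 => ?_⟩
  · obtain ⟨F⟩ := Potts.exists_frame i
    exact ⟨F.ncard_nn, F.ncard_nnn⟩
  have hα := Potts.dobrushin_lt_one hq11
  have hc := Potts.summable_dobrushinCoeff (r := r) q
  have hcα : ∀ i : Potts.Surv r, ∑' j, Potts.dobrushinCoeff (Potts.decWeight q r) i j ≤
      3 * Potts.cNN q + 9 * Potts.cNNN q := fun i => (Potts.tsum_dobrushinCoeff hq i).le
  have hreg := Potts.decWeight_regular hq r
  have huniq : ∀ μ ν : MeasureTheory.Measure (Potts.Surv r → Fin q),
      Potts.IsGibbs (Potts.decWeight q r) μ → Potts.IsGibbs (Potts.decWeight q r) ν → μ = ν :=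
    fun μ ν hμ hν => Potts.IsGibbs.unique_of_dobrushin hreg hα0 hα hc hcα hμ hν
  have hdecay : ∀ μ : MeasureTheory.Measure (Potts.Surv r → Fin q),
      Potts.IsGibbs (Potts.decWeight q r) μ → Potts.ExpDecay μ := fun μ hμ =>
    Potts.IsGibbs.expDecay_of_dobrushin hreg hα0 hα hc hcα
      (fun _ _ => Potts.dist_le_of_dobrushinCoeff_ne_zero) hμ
  -- Existence is needed only on the triangular lattice; restriction supplies a Gibbs measure of the
  -- decimated model. Uniqueness and decay travel the other way, from the decimated model to the
  -- original one.
  obtain ⟨μ₀, hμ₀⟩ := Potts.exists_isGibbs (Potts.triWeight_regular hq) (Potts.triWeight_consistent q)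
  refine ⟨?_, ⟨_, hμ₀.map_restr hq, fun ν hν => huniq _ _ hν (hμ₀.map_restr hq)⟩, hdecay,
    ⟨μ₀, hμ₀, fun ν hν => hν.eq_of_map_restr_eq hq hμ₀
      (huniq _ _ (hν.map_restr hq) (hμ₀.map_restr (r := r) hq))⟩,
    fun μ hμ => hμ.expDecay_of_map_restr hq (hdecay _ (hμ.map_restr (r := r) hq))⟩
  rw [Potts.dobrushinConst_eq hq r, ENNReal.ofReal_lt_one]
  exact hα
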